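/- There are a single algorithm and a constant $C$ such that the following holds for all integers $n,m\ge 0$ and every function $f:\{0,1,\dots,m\}\to\mathbb{R}$, given as a table of its values. Given $n$, $m$ and $f$, the algorithm halts after at most $C\,(n^5m^2+n+1)$ steps (hence in $O(n^5m^2)$ time for $n,m\ge 1$). If no simple graph on the vertex set $\{1,\dots,n\}$ has exactly $m$ edges, it reports this. Otherwise it outputs the list of edges of a simple graph $G$ on $\{1,\dots,n\}$ with exactly $m$ edges whose degree sequence $(d_1,\dots,d_n)$ (with $d_i$ the number of edges containing $i$) maximizes $\sum_{i=1}^n f(d_i)$ among all such graphs, together with this maximum value. Here an algorithm is a program for a random access machine with unit costs, with registers and indirectly addressed memory for natural numbers and for real numbers, in which a step is a register assignment, a memory access, an addition or subtraction (truncated at $0$ for natural numbers), or a comparison controlling a branch or a loop. -/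

import Mathlib

/-! ### The optimization problem -/

namespace DegSeq

/-- Simple graphs on `n` labelled vertices with exactly `m` edges. -/
def GraphWith (n m : ℕ) : Type :=
  {G : SimpleGraph (Fin n) // G.edgeSet.ncard = m}

/-- The degree of the vertex `i`: the number of edges that contain `i`. -/
noncomputable def deg {n m : ℕ} (G : GraphWith n m) (i : Fin n) : ℕ :=
  (G.1.incidenceSet i).ncard

theorem deg_lt {n m : ℕ} (G : GraphWith n m) (i : Fin n) : deg G i < m + 1 := by
  have h : (G.1.incidenceSet i).ncard ≤ G.1.edgeSet.ncard :=
    Set.ncard_le_ncard (G.1.incidenceSet_subset i) (Set.toFinite _)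
  have h2 := G.2
  unfold deg
  omega

/-- The objective `∑ i, f (d i)`, where `d` is the degree sequence of `G` and
`f : {0, …, m} → ℝ`. -/
noncomputable def value {n m : ℕ} (f : Fin (m + 1) → ℝ) (G : GraphWith n m) : ℝ :=
  ∑ i : Fin n, f ⟨deg G i, deg_lt G i⟩

/-- `G` maximizes the objective among all graphs on `n` vertices with `m` edges. -/
def IsOptimal {n m : ℕ} (f : Fin (m + 1) → ℝ) (G : GraphWith n m) : Prop :=
  ∀ H : GraphWith n m, value f H ≤ value f G

end DegSeq

/-! ### Random access machine with unit costs

The machine has registers and random access memory for natural numbers, and registers and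
random access memory for real numbers. Natural numbers can be added, subtracted (truncated),
compared and used as addresses; real numbers can only be added, subtracted and compared.
There is no multiplication, so that the uniform cost measure cannot be abused by building
numbers of exponential length. -/

namespace RAM

/-- A machine configuration. -/
structure State where
  /-- registers holding natural numbers -/
  reg : ℕ → ℕ
  /-- memory holding natural numbers -/
  mem : ℕ → ℕ
  /-- registers holding real numbers -/
  rreg : ℕ → ℝ
  /-- memory holding real numbers -/
  rmem : ℕ → ℝ

/-- Elementary instructions. The arguments `x y z` are names of natural-number registers,
`a b c` are names of real registers, and `k` is a literal. -/
inductive Instr where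
  /-- `x := k` -/
  | const (x k : ℕ)
  /-- `x := y` -/
  | copy (x y : ℕ)
  /-- `x := y + z` -/
  | add (x y z : ℕ)
  /-- `x := y - z`, truncated at `0` -/
  | sub (x y z : ℕ)
  /-- `x := mem[y]` -/
  | load (x y : ℕ)
  /-- `mem[x] := y` -/
  | store (x y : ℕ)
  /-- `a := b` -/
  | rcopy (a b : ℕ)
  /-- `a := b + c` -/
  | radd (a b c : ℕ)
  /-- `a := b - c` -/
  | rsub (a b c : ℕ)
  /-- `a := rmem[y]` -/
  | rload (a y : ℕ)
  /-- `rmem[x] := b` -/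
  | rstore (x b : ℕ)

/-- The effect of an elementary instruction. -/
noncomputable def Instr.apply : Instr → State → State
  | .const x k, s => { s with reg := Function.update s.reg x k }
  | .copy x y, s => { s with reg := Function.update s.reg x (s.reg y) }
  | .add x y z, s => { s with reg := Function.update s.reg x (s.reg y + s.reg z) }
  | .sub x y z, s => { s with reg := Function.update s.reg x (s.reg y - s.reg z) }
  | .load x y, s => { s with reg := Function.update s.reg x (s.mem (s.reg y)) }
  | .store x y, s => { s with mem := Function.update s.mem (s.reg x) (s.reg y) }
  | .rcopy a b, s => { s with rreg := Function.update s.rreg a (s.rreg b) }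
  | .radd a b c, s => { s with rreg := Function.update s.rreg a (s.rreg b + s.rreg c) }
  | .rsub a b c, s => { s with rreg := Function.update s.rreg a (s.rreg b - s.rreg c) }
  | .rload a y, s => { s with rreg := Function.update s.rreg a (s.rmem (s.reg y)) }
  | .rstore x b, s => { s with rmem := Function.update s.rmem (s.reg x) (s.rreg b) }

/-- Tests that control branching: comparison of two registers. -/
inductive Test where
  /-- natural-number registers: `x < y` -/
  | lt (x y : ℕ)
  /-- real registers: `a < b` -/
  | rlt (a b : ℕ)

/-- Truth of a test in a configuration. -/
def Test.Holds : Test → State → Prop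
  | .lt x y, s => s.reg x < s.reg y
  | .rlt a b, s => s.rreg a < s.rreg b

/-- Programs: finite texts built from elementary instructions by sequencing, branching and
while loops. -/
inductive Prog where
  | instr (i : Instr)
  | seq (p q : Prog)
  | ite (c : Test) (p q : Prog)
  | loop (c : Test) (p : Prog)

/-- `Exec p s t s'`: started in `s`, the program `p` halts in `s'` after exactly `t` steps.
Each execution of an elementary instruction and each evaluation of a test is one step. -/
inductive Exec : Prog → State → ℕ → State → Prop where
  | instr (i : Instr) (s : State) : Exec (.instr i) s 1 (i.apply s)
  | seq {p q : Prog} {s s' s'' : State} {t t' : ℕ} :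
      Exec p s t s' → Exec q s' t' s'' → Exec (.seq p q) s (t + t') s''
  | ite_true {c : Test} {p q : Prog} {s s' : State} {t : ℕ} :
      c.Holds s → Exec p s t s' → Exec (.ite c p q) s (t + 1) s'
  | ite_false {c : Test} {p q : Prog} {s s' : State} {t : ℕ} :
      ¬ c.Holds s → Exec q s t s' → Exec (.ite c p q) s (t + 1) s'
  | loop_true {c : Test} {p : Prog} {s s' s'' : State} {t t' : ℕ} :
      c.Holds s → Exec p s t s' → Exec (.loop c p) s' t' s'' →
        Exec (.loop c p) s (t + t' + 1) s''
  | loop_false {c : Test} {p : Prog} {s : State} :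
      ¬ c.Holds s → Exec (.loop c p) s 1 s

/-- The machine is deterministic: result and running time are determined by program and input. -/
theorem Exec.unique {p : Prog} {s s₁ s₂ : State} {t₁ t₂ : ℕ}
    (h₁ : Exec p s t₁ s₁) (h₂ : Exec p s t₂ s₂) : t₁ = t₂ ∧ s₁ = s₂ := by
  induction h₁ generalizing t₂ s₂ with
  | instr i s => cases h₂; exact ⟨rfl, rfl⟩
  | seq _ _ ih ih' =>
    cases h₂ with
    | seq a b =>
      obtain ⟨rfl, rfl⟩ := ih a
      obtain ⟨rfl, rfl⟩ := ih' b
      exact ⟨rfl, rfl⟩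
  | ite_true hc _ ih =>
    cases h₂ with
    | ite_true _ a => obtain ⟨rfl, rfl⟩ := ih a; exact ⟨rfl, rfl⟩
    | ite_false hn _ => exact absurd hc hn
  | ite_false hc _ ih =>
    cases h₂ with
    | ite_true hn _ => exact absurd hn hc
    | ite_false _ a => obtain ⟨rfl, rfl⟩ := ih a; exact ⟨rfl, rfl⟩
  | loop_true hc _ _ ih ih' =>
    cases h₂ with
    | loop_true _ a b =>
      obtain ⟨rfl, rfl⟩ := ih a
      obtain ⟨rfl, rfl⟩ := ih' b
      exact ⟨rfl, rfl⟩
    | loop_false hn => exact absurd hc hn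
  | loop_false hc =>
    cases h₂ with
    | loop_true hn _ _ => exact absurd hn hc
    | loop_false _ => exact ⟨rfl, rfl⟩

end RAM

namespace DegSeq

/-- The initial configuration for the instance `(n, m, f)`: register `0` holds `n`, register `1`
holds `m`, the real memory cells `0, …, m` hold the table of `f`, and all else is `0`. -/
noncomputable def input (n m : ℕ) (f : Fin (m + 1) → ℝ) : RAM.State where
  reg := fun x => if x = 0 then n else if x = 1 then m else 0
  mem := fun _ => 0
  rreg := fun _ => 0
  rmem := fun x => if h : x < m + 1 then f ⟨x, h⟩ else 0

/-- The natural-number memory cells `0, …, 2 * m - 1` list the `m` edges of `G` as pairs of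
endpoints: the `j`-th edge joins the contents of the cells `2 * j` and `2 * j + 1`. -/
def ListsEdges {n m : ℕ} (s : RAM.State) (G : GraphWith n m) : Prop :=
  (∀ j < m, ∃ u v : Fin n, s.mem (2 * j) = u ∧ s.mem (2 * j + 1) = v ∧ G.1.Adj u v) ∧
  ∀ u v : Fin n, G.1.Adj u v → ∃ j < m,
    (s.mem (2 * j) = u ∧ s.mem (2 * j + 1) = v) ∨ (s.mem (2 * j) = v ∧ s.mem (2 * j + 1) = u)

/-- The final configuration `s` answers the instance `(n, m, f)`: either register `0` holds `0` and
there is no graph on `n` vertices with `m` edges; or register `0` holds `1`, the memory lists the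
edges of an optimal graph, and real register `0` holds the optimal value. -/
def Solves (n m : ℕ) (f : Fin (m + 1) → ℝ) (s : RAM.State) : Prop :=
  (s.reg 0 = 0 ∧ IsEmpty (GraphWith n m)) ∨
  (s.reg 0 = 1 ∧ ∃ G : GraphWith n m, IsOptimal f G ∧ ListsEdges s G ∧ s.rreg 0 = value f G)

end DegSeq

/-! ### Degree sequences of graphs -/

namespace DegSeq

open Finset

section Graphs

variable {V : Type*}

/-! By the Erdős–Gallai theorem, a sequence `d` on `n` vertices is graphic exactly when its sum is
even and `∑_S d ≤ |S| (n - 1 - |T|) + ∑_T d` for all disjoint `S` and `T`. For a nonincreasing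
sequence it suffices to take for `S` the `s` largest entries and for `T` the entries below `s`. So
the condition at `s` depends only on the sum of the `s` largest entries and on the number and the
sum of the entries below `s`.

This makes a dynamic program possible that builds the sequence from both ends. If `k` top entries
with sum `A` and `l` bottom entries with sum `T` are fixed, and `r` bounds the rest, then one may
lower `r`, put an entry of value exactly `k` at the bottom, or put an entry of value `r > k` at the
top. When the top entry number `k + 1` is fixed, all entries of value at most `k` are already at the
bottom, so the condition at `s = k + 1` reads `A + r + (k + 1) l ≤ (k + 1) (n - 1) + T`. Later moves
cannot break it, since all later entries are at least `s`.

`ErdosGallai.path` shows that every graphic sequence arises from moves, `Partial.erdosGallai` that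
moves produce only sequences with the Erdős–Gallai condition, and `ErdosGallai.exists_graph` turns
these into graphs. The value of a sequence is the sum of the gains of its moves, so the best
completion of each state `(k, l, r, A, T)` follows from at most three others.

There are `(n + 1)² (m + 1) (2m + 1)²` states, each handled in constant time. Instances with `m >
n²` are rejected beforehand, and otherwise `n² m³ ≤ n⁴ m² ≤ n⁵ m²` for positive `n`. Following the
stored moves recovers an optimal sequence, and a Havel–Hakimi procedure (`exists_remove_max`) lists
the edges of a graph realizing it. The programs are verified with `Runs`, a Hoare triple with a step
budget. -/

/-- The number of neighbours of a vertex. -/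
noncomputable def nbrs (G : SimpleGraph V) (x : V) : ℕ := (G.neighborSet x).ncard

theorem nbrs_congr {G H : SimpleGraph V} {x : V} (h : ∀ y, G.Adj x y ↔ H.Adj x y) :
    nbrs G x = nbrs H x := by
  unfold nbrs
  congr 1
  ext y
  exact h y

/-- Otherwise the neighbourhood of `x` would be contained in that of `b`, apart from `b` and `x`
themselves, which are adjacent to each other or not at all. This provides the last vertex of every
edge swap below. -/
theorem exists_adj_not_adj [Finite V] (G : SimpleGraph V) {b x : V} (h : nbrs G b < nbrs G x) :
    ∃ y, G.Adj x y ∧ ¬ G.Adj b y ∧ y ≠ b := by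
  by_contra! hc
  have hf : ∀ z, (G.neighborSet z).Finite := fun z => Set.toFinite _
  by_cases hbx : G.Adj x b
  · have h1 : G.neighborSet x \ {b} ⊆ G.neighborSet b \ {x} := by
      rintro y ⟨hy, hyb⟩
      refine ⟨by_contra fun hn => hyb (hc y hy hn), ?_⟩
      rintro rfl
      exact G.irrefl hy
    have h2 := Set.ncard_le_ncard h1 (Set.toFinite _)
    have h3 := Set.ncard_sdiff_singleton_add_one (s := G.neighborSet x) hbx (hf x)
    have h4 := Set.ncard_sdiff_singleton_add_one (s := G.neighborSet b) hbx.symm (hf b)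
    unfold nbrs at h
    omega
  · have h1 : G.neighborSet x ⊆ G.neighborSet b := by
      intro y hy
      by_contra hn
      have := hc y hy hn
      subst this
      exact hbx hy
    have h2 := Set.ncard_le_ncard h1 (Set.toFinite _)
    unfold nbrs at h
    omega

theorem sum_nbrs [Fintype V] (G : SimpleGraph V) : ∑ x, nbrs G x = 2 * G.edgeSet.ncard := by
  classical
  have h := G.sum_degrees_eq_twice_card_edges
  rw [← SimpleGraph.coe_edgeFinset, Set.ncard_coe_finset, ← h]
  refine sum_congr rfl fun x _ => ?_
  rw [nbrs, ← SimpleGraph.card_neighborFinset_eq_degree, ← Set.ncard_coe_finset,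
    SimpleGraph.coe_neighborFinset]

variable [Fintype V] [DecidableEq V]

/-- Adding a missing edge raises the degrees of its ends by one. -/
theorem exists_add_edge (G : SimpleGraph V) {u v : V} (huv : u ≠ v) (h : ¬ G.Adj u v) :
    ∃ G' : SimpleGraph V,
      (∀ x, nbrs G' x = nbrs G x + (if x = u then 1 else 0) + (if x = v then 1 else 0)) ∧
      ∀ p q, G'.Adj p q ↔ G.Adj p q ∨ (p = u ∧ q = v) ∨ (p = v ∧ q = u) := by
  have hadj : ∀ p q, (G ⊔ SimpleGraph.edge u v).Adj p q ↔
      G.Adj p q ∨ (p = u ∧ q = v) ∨ (p = v ∧ q = u) := by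
    intro p q
    rw [SimpleGraph.sup_adj, SimpleGraph.edge_adj]
    constructor
    · tauto
    · rintro (h | ⟨rfl, rfl⟩ | ⟨rfl, rfl⟩)
      · exact Or.inl h
      · exact Or.inr ⟨Or.inl ⟨rfl, rfl⟩, huv⟩
      · exact Or.inr ⟨Or.inr ⟨rfl, rfl⟩, huv.symm⟩
  refine ⟨G ⊔ SimpleGraph.edge u v, fun x => ?_, hadj⟩
  by_cases hu : x = u
  · subst hu
    have : (G ⊔ SimpleGraph.edge x v).neighborSet x = insert v (G.neighborSet x) := by
      ext y
      simp only [SimpleGraph.mem_neighborSet, hadj, Set.mem_insert_iff]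
      grind
    unfold nbrs
    rw [this, Set.ncard_insert_of_notMem (by simpa using h) (Set.toFinite _)]
    simp [huv]
  · by_cases hv : x = v
    · subst hv
      have : (G ⊔ SimpleGraph.edge u x).neighborSet x = insert u (G.neighborSet x) := by
        ext y
        simp only [SimpleGraph.mem_neighborSet, hadj, Set.mem_insert_iff]
        grind
      unfold nbrs
      rw [this, Set.ncard_insert_of_notMem (by simpa [G.adj_comm] using h) (Set.toFinite _)]
      simp [hu]
    · rw [nbrs_congr (H := G) (fun y => by rw [hadj]; simp [hu, hv])]
      simp [hu, hv]

/-- Removing an edge lowers the degrees of its ends by one. -/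
theorem exists_remove_edge (G : SimpleGraph V) {u v : V} (h : G.Adj u v) :
    ∃ G' : SimpleGraph V,
      (∀ x, nbrs G' x + (if x = u then 1 else 0) + (if x = v then 1 else 0) = nbrs G x) ∧
      ∀ p q, G'.Adj p q ↔ G.Adj p q ∧ ¬ (p = u ∧ q = v) ∧ ¬ (p = v ∧ q = u) := by
  have hadj : ∀ p q, (G.deleteEdges {s(u, v)}).Adj p q ↔
      G.Adj p q ∧ ¬ (p = u ∧ q = v) ∧ ¬ (p = v ∧ q = u) := by
    intro p q
    rw [SimpleGraph.deleteEdges_adj]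
    simp
  have hn : ¬ (G.deleteEdges {s(u, v)}).Adj u v := by simp
  -- Adding the edge back restores `G`, so the degree formula for an added edge can be read
  -- backwards.
  obtain ⟨G', h1, h2⟩ := exists_add_edge _ h.ne hn
  refine ⟨_, fun x => ?_, hadj⟩
  rw [← h1]
  apply nbrs_congr
  intro y
  rw [h2, hadj]
  have := h.symm
  grind

/-- One step of the Havel–Hakimi procedure: if all neighbours of `v` lie in `Q` and `u` has maximal
degree in `Q`, then the degrees without the edge `uv` are those of a graph. -/
theorem exists_remove_max (H : SimpleGraph V) {v u : V} {Q : Set V} (hv : v ∉ Q) (hu : u ∈ Q)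
    (hN : ∀ w, H.Adj v w → w ∈ Q) (hpos : 0 < nbrs H v) (hmax : ∀ w ∈ Q, nbrs H w ≤ nbrs H u) :
    ∃ H' : SimpleGraph V,
      (∀ x, nbrs H' x + (if x = u then 1 else 0) + (if x = v then 1 else 0) = nbrs H x) ∧
      ¬ H'.Adj v u ∧
      ∀ p q, H'.Adj p q → H.Adj p q ∨ (p ≠ v ∧ q ≠ v ∧ (∃ z, H.Adj p z) ∧ ∃ z, H.Adj q z) := by
  have huv : u ≠ v := fun h => hv (h ▸ hu)
  by_cases hvu : H.Adj v u
  · obtain ⟨H', h1, h2⟩ := exists_remove_edge H hvu.symm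
    refine ⟨H', h1, by simp [h2], fun p q h => Or.inl ((h2 p q).1 h).1⟩
  · obtain ⟨w, hw⟩ : ∃ w, H.Adj v w := by
      by_contra! hc
      have : H.neighborSet v = ∅ := by
        ext y
        simpa using hc y
      simp [nbrs, this] at hpos
    have hwu : w ≠ u := fun h => hvu (h ▸ hw)
    obtain ⟨H1, hd1, ha1⟩ := exists_remove_edge H hw
    -- Deleting `vw` makes the maximality of `u` strict against `w`, so that a partner `x` for a
    -- swap exists.
    have hlt : nbrs H1 w < nbrs H1 u := by
      have e1 := hd1 w
      have e2 := hd1 u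
      have e3 := hmax w (hN w hw)
      simp only [hw.ne', huv, hwu.symm, if_true, if_false] at e1 e2
      omega
    obtain ⟨x, hux, hwx, hxw⟩ := exists_adj_not_adj H1 hlt
    have hHux : H.Adj u x := ((ha1 u x).1 hux).1
    have hxv : x ≠ v := by
      rintro rfl
      exact hvu hHux.symm
    -- The edge `ux` is traded for `wx`, so in total only `u` and `v` lose a degree. The new edge
    -- avoids `v`, and both of its ends had an edge before.
    obtain ⟨H2, hd2, ha2⟩ := exists_remove_edge H1 hux
    have hn : ¬ H2.Adj w x := fun h => hwx ((ha2 w x).1 h).1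
    obtain ⟨H3, hd3, ha3⟩ := exists_add_edge H2 hxw.symm hn
    refine ⟨H3, fun z => ?_, ?_, fun p q hpq => ?_⟩
    · have e1 := hd1 z
      have e2 := hd2 z
      have e3 := hd3 z
      omega
    · rw [ha3, ha2, ha1]
      have := hw.ne
      tauto
    · rw [ha3, ha2, ha1] at hpq
      rcases hpq with h | ⟨rfl, rfl⟩ | ⟨rfl, rfl⟩
      · exact Or.inl h.1.1
      · exact Or.inr ⟨hw.ne', hxv, ⟨v, hw.symm⟩, ⟨u, hHux.symm⟩⟩
      · exact Or.inr ⟨hxv, hw.ne', ⟨u, hHux.symm⟩, ⟨v, hw.symm⟩⟩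

/-! ### The Erdős–Gallai theorem -/

/-- The slack in the Erdős–Gallai inequality for the disjoint vertex sets `S` and `T`. -/
def slack (d : V → ℕ) (S T : Finset V) : ℤ :=
  #S * ((Fintype.card V : ℤ) - 1 - #T) + ∑ x ∈ T, (d x : ℤ) - ∑ x ∈ S, (d x : ℤ)

/-- The Erdős–Gallai condition, for all pairs of disjoint vertex sets. -/
def ErdosGallai (d : V → ℕ) : Prop := ∀ S T : Finset V, Disjoint S T → 0 ≤ slack d S T

theorem slack_insert_left (d : V → ℕ) {S : Finset V} (T : Finset V) {x : V} (hx : x ∉ S) :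
    slack d (insert x S) T = slack d S T + ((Fintype.card V : ℤ) - 1 - #T) - d x := by
  unfold slack
  rw [card_insert_of_notMem hx, sum_insert hx]
  push_cast
  ring

theorem slack_insert_right (d : V → ℕ) (S : Finset V) {T : Finset V} {y : V} (hy : y ∉ T) :
    slack d S (insert y T) = slack d S T - #S + d y := by
  unfold slack
  rw [card_insert_of_notMem hy, sum_insert hy]
  push_cast
  ring

theorem slack_erase_left (d : V → ℕ) {S : Finset V} (T : Finset V) {x : V} (hx : x ∈ S) :
    slack d (S.erase x) T = slack d S T - ((Fintype.card V : ℤ) - 1 - #T) + d x := by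
  have := slack_insert_left d T (notMem_erase x S)
  rw [insert_erase hx] at this
  linarith

theorem slack_erase_right (d : V → ℕ) (S : Finset V) {T : Finset V} {y : V} (hy : y ∈ T) :
    slack d S (T.erase y) = slack d S T + #S - d y := by
  have := slack_insert_right d S (notMem_erase y T)
  rw [insert_erase hy] at this
  linarith

/-- Degree sequences of graphs satisfy the Erdős–Gallai condition. -/
theorem erdosGallai_nbrs (G : SimpleGraph V) : ErdosGallai (nbrs G) := by
  classical
  intro S T hST
  have hdeg : ∀ x, nbrs G x = #{y | G.Adj x y} := by
    intro x
    unfold nbrs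
    rw [← Set.ncard_coe_finset]
    congr 1
    ext y
    simp
  -- The neighbours of `x` outside `T` avoid `T` and `x` itself, which leaves `n - 1 - #T` vertices.
  -- The edges between `S` and `T` are then counted from both sides.
  have h1 : ∀ x ∈ S, (nbrs G x : ℤ) ≤ #{y ∈ T | G.Adj x y} + ((Fintype.card V : ℤ) - 1 - #T) := by
    intro x hx
    have hxT : x ∉ T := disjoint_left.1 hST hx
    have e1 : #{y | G.Adj x y} ≤ #{y ∈ T | G.Adj x y} + #((insert x T)ᶜ) := by
      refine (card_le_card ?_).trans (card_union_le _ _)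
      intro y hy
      have hy' : G.Adj x y := by simpa using hy
      have := hy'.ne'
      by_cases hyT : y ∈ T <;> simp [hy', hyT, this]
    have e2 := card_compl_add_card (insert x T)
    rw [card_insert_of_notMem hxT] at e2
    rw [hdeg]
    omega
  have h2 : ∑ x ∈ S, #{y ∈ T | G.Adj x y} = ∑ y ∈ T, #{x ∈ S | G.Adj x y} :=
    sum_card_bipartiteAbove_eq_sum_card_bipartiteBelow _
  have h3 : ∑ y ∈ T, #{x ∈ S | G.Adj x y} ≤ ∑ y ∈ T, nbrs G y := by
    refine sum_le_sum fun y _ => ?_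
    rw [hdeg]
    refine card_le_card fun x hx => ?_
    have := (mem_filter.1 hx).2.symm
    simpa using this
  have h4 := sum_le_sum h1
  rw [sum_add_distrib, sum_const, nsmul_eq_mul] at h4
  have h5 : (∑ x ∈ S, (#{y ∈ T | G.Adj x y} : ℤ)) ≤ ∑ y ∈ T, (nbrs G y : ℤ) := by
    exact_mod_cast h2.le.trans h3
  unfold slack
  linarith

/-- Lowering a maximal entry and another positive entry keeps the Erdős–Gallai condition. -/
theorem ErdosGallai.lower {d d' : V → ℕ} (h : ErdosGallai d) (heven : Even (∑ x, d x)) {a b : V}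
    (hab : a ≠ b) (ha : ∀ x, d x ≤ d a) (hb : 0 < d b)
    (hd' : ∀ x, d' x + (if x = a then 1 else 0) + (if x = b then 1 else 0) = d x) :
    ErdosGallai d' := by
  intro S T hST
  have hsum : ∀ U : Finset V, ∑ x ∈ U, (d' x : ℤ) =
      ∑ x ∈ U, (d x : ℤ) - (if a ∈ U then 1 else 0) - (if b ∈ U then 1 else 0) := by
    intro U
    have : ∀ x, (d' x : ℤ) = d x - (if x = a then 1 else 0) - (if x = b then 1 else 0) := by
      intro x
      rw [← hd' x]
      push_cast
      ring
    simp only [this, sum_sub_distrib]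
    simp
  -- The slack changes only through the membership of `a` and `b`. What has to be excluded is a
  -- slack below `2` when both lie in `T`, and slack `0` when one lies in `T` and the other outside
  -- `S ∪ T`.
  have hslack : slack d' S T = slack d S T + (if a ∈ S then 1 else 0) + (if b ∈ S then 1 else 0)
      - (if a ∈ T then 1 else 0) - (if b ∈ T then 1 else 0) := by
    unfold slack
    rw [hsum, hsum]
    ring
  have h0 := h S T hST
  have hda : (1 : ℤ) ≤ d a := by exact_mod_cast hb.trans_le (ha b)
  have hdb : (1 : ℤ) ≤ d b := by exact_mod_cast hb
  have hcard : #S + #T + #((S ∪ T)ᶜ) = Fintype.card V := by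
    rw [← card_union_of_disjoint hST, add_comm, card_compl_add_card]
  have hS : ∑ x ∈ S, (d x : ℤ) ≤ #S * (d a : ℤ) := by
    rw [← nsmul_eq_mul]
    exact sum_le_card_nsmul _ _ _ fun x _ => by exact_mod_cast ha x
  have hcard' : (Fintype.card V : ℤ) = #S + #T + #((S ∪ T)ᶜ) := by exact_mod_cast hcard.symm
  have hTnn : ∀ U : Finset V, (0 : ℤ) ≤ ∑ x ∈ U, (d x : ℤ) :=
    fun U => sum_nonneg fun x _ => by positivity
  have hTmem : ∀ {y : V} {U : Finset V}, y ∈ U → (d y : ℤ) ≤ ∑ x ∈ U, (d x : ℤ) := by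
    intro y U hy
    exact single_le_sum (f := fun x => (d x : ℤ)) (fun x _ => by positivity) hy
  have hval : slack d S T = #S * ((#S : ℤ) - 1 + #((S ∪ T)ᶜ)) + ∑ x ∈ T, (d x : ℤ)
      - ∑ x ∈ S, (d x : ℤ) := by
    unfold slack
    rw [hcard']
    ring
  have hs0 : (0 : ℤ) ≤ #S := by positivity
  rw [hslack]
  by_cases haT : a ∈ T
  · have haS : a ∉ S := disjoint_right.1 hST haT
    -- Taking `a` out of `T` shows `d a ≤ #S + slack d S T`.
    have e1 : 0 ≤ slack d S (T.erase a) := h _ _ (hST.mono_right (erase_subset _ _))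
    rw [slack_erase_right d S haT] at e1
    by_cases hbT : b ∈ T
    · have hbS : b ∉ S := disjoint_right.1 hST hbT
      simp only [haT, hbT, haS, hbS, if_true, if_false]
      by_contra hlt
      have hT2 : (d a : ℤ) + d b ≤ ∑ x ∈ T, (d x : ℤ) := by
        rw [← add_sum_erase _ _ haT]
        have := hTmem (mem_erase.2 ⟨hab.symm, hbT⟩)
        linarith
      -- If `S ∪ T` is everything, parity decides: the slack is even, hence `0`, and moving `a` from
      -- `T` to `S` sharpens the bound to `d a ≤ #S`. Otherwise an outside vertex adds another `#S`
      -- to the slack.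
      by_cases hρ : #((S ∪ T)ᶜ) = 0
      · have huniv : S ∪ T = univ := by
          rw [card_eq_zero, compl_eq_empty_iff] at hρ
          exact hρ
        have hev : Even (slack d S T) := by
          have e2 : ∑ x, (d x : ℤ) = ∑ x ∈ S, (d x : ℤ) + ∑ x ∈ T, (d x : ℤ) := by
            rw [← huniv, sum_union hST]
          have e3 : Even (∑ x, (d x : ℤ)) := by exact_mod_cast heven
          have e4 : slack d S T =
              (#S : ℤ) * (#S - 1) + ∑ x, (d x : ℤ) - 2 * ∑ x ∈ S, (d x : ℤ) := by
            rw [hval, e2, hρ]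
            push_cast
            ring
          rw [e4]
          exact ((Int.even_mul_pred_self _).add e3).sub (even_two_mul _)
        have hz : slack d S T = 0 := by
          obtain ⟨q, hq⟩ := hev
          omega
        have e5 : 0 ≤ slack d (insert a S) (T.erase a) := by
          apply h
          rw [disjoint_insert_left]
          exact ⟨notMem_erase _ _, hST.mono_right (erase_subset _ _)⟩
        rw [slack_insert_left d _ haS, slack_erase_right d S haT,
          card_erase_of_mem haT, hz, hcard', hρ] at e5
        have hTpos : 1 ≤ #T := card_pos.2 ⟨a, haT⟩
        push_cast [Nat.cast_sub hTpos] at e5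
        rw [hz, hρ] at hval
        push_cast at hval
        have : (d a : ℤ) ≤ #S := by linarith
        nlinarith
      · have hρ' : (1 : ℤ) ≤ #((S ∪ T)ᶜ) := by exact_mod_cast Nat.one_le_iff_ne_zero.2 hρ
        have e6 : (#S : ℤ) * 1 ≤ #S * #((S ∪ T)ᶜ) := mul_le_mul_of_nonneg_left hρ' hs0
        have e7 : (d a : ℤ) ≤ #S + 1 := by linarith
        have e8 : (#S : ℤ) * (#S - d a) + d a + d b ≤ 1 := by nlinarith
        rcases e7.lt_or_eq with h7 | h7
        · have : 0 ≤ (#S : ℤ) * (#S - d a) := mul_nonneg hs0 (by omega)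
          linarith
        · rw [h7] at e8
          nlinarith
    · simp only [haT, hbT, haS, if_true, if_false]
      by_cases hbS : b ∈ S
      · simp only [hbS, if_true]
        linarith
      · simp only [hbS, if_false]
        by_contra hlt
        have hz : slack d S T = 0 := by linarith
        have hρ' : (1 : ℤ) ≤ #((S ∪ T)ᶜ) := by
          exact_mod_cast card_pos.2 ⟨b, by simp [hbS, hbT]⟩
        have e6 : (#S : ℤ) * 1 ≤ #S * #((S ∪ T)ᶜ) := mul_le_mul_of_nonneg_left hρ' hs0
        have e7 : 0 ≤ (#S : ℤ) * (#S - d a) := mul_nonneg hs0 (by linarith)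
        have e8 := hTmem haT
        nlinarith
  · by_cases hbT : b ∈ T
    · have hbS : b ∉ S := disjoint_right.1 hST hbT
      simp only [haT, hbT, hbS, if_true, if_false]
      by_cases haS : a ∈ S
      · simp only [haS, if_true]
        linarith
      · simp only [haS, if_false]
        by_contra hlt
        have hz : slack d S T = 0 := by linarith
        -- Moving `a` into `S` gives `d a ≤ n - 1 - #T`. As `d a` is maximal, the slack is then at
        -- least the sum over `T`, which is positive because of `b`.
        have e1 : 0 ≤ slack d (insert a S) T := by
          apply h
          rw [disjoint_insert_left]
          exact ⟨haT, hST⟩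
        rw [slack_insert_left d _ haS, hz] at e1
        have e2 : ∑ x ∈ S, (d x : ℤ) ≤ #S * ((Fintype.card V : ℤ) - 1 - #T) := by
          have : (#S : ℤ) * (d a : ℤ) ≤ #S * ((Fintype.card V : ℤ) - 1 - #T) :=
            mul_le_mul_of_nonneg_left (by linarith) hs0
          linarith
        have e3 := hTmem hbT
        unfold slack at hz
        linarith
    · simp only [haT, hbT, if_false]
      have : ∀ p : Prop, [Decidable p] → (0 : ℤ) ≤ if p then 1 else 0 := by
        intro p _
        split_ifs <;> norm_num
      have h1 := this (a ∈ S)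
      have h2 := this (b ∈ S)
      linarith

/-- The Erdős–Gallai theorem: an even sequence with the Erdős–Gallai condition is the degree
sequence of a graph. -/
theorem ErdosGallai.exists_graph {d : V → ℕ} (h : ErdosGallai d) (heven : Even (∑ x, d x)) :
    ∃ G : SimpleGraph V, ∀ x, nbrs G x = d x := by
  induction hN : ∑ x, d x using Nat.strong_induction_on generalizing d with
  | _ N ih =>
  by_cases hzero : ∀ x, d x = 0
  · refine ⟨⊥, fun x => ?_⟩
    rw [hzero]
    simp [nbrs]
  push Not at hzero
  obtain ⟨c, hc⟩ := hzero
  obtain ⟨a, -, ha⟩ := exists_max_image univ d ⟨c, mem_univ c⟩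
  have ha' : ∀ x, d x ≤ d a := fun x => ha x (mem_univ x)
  have hda : 0 < d a := (Nat.pos_of_ne_zero hc).trans_le (ha' c)
  set P : Finset V := {x | x ≠ a ∧ 0 < d x} with hP
  -- The condition for `{a}` against the other vertices of degree `0` says that `a` has enough
  -- possible neighbours.
  have hPcard : d a ≤ #P := by
    have hdisj : Disjoint {a} (insert a P)ᶜ := by simp
    have h1 := h {a} (insert a P)ᶜ hdisj
    have haP : a ∉ P := by simp [hP]
    have h2 : ∑ x ∈ (insert a P)ᶜ, (d x : ℤ) = 0 := by
      refine sum_eq_zero fun x hx => ?_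
      have : ¬ 0 < d x := fun hpos => by
        rw [mem_compl, mem_insert, hP, mem_filter] at hx
        exact hx (or_iff_not_imp_left.2 fun hne => ⟨mem_univ _, hne, hpos⟩)
      exact_mod_cast Nat.eq_zero_of_not_pos this
    have h3 := card_compl_add_card (insert a P)
    rw [card_insert_of_notMem haP] at h3
    unfold slack at h1
    rw [h2] at h1
    simp only [card_singleton, sum_singleton] at h1
    push_cast at h1
    omega
  obtain ⟨b, hbP, hb⟩ := exists_min_image P d (card_pos.1 (hda.trans_le hPcard))
  have hb' : b ≠ a ∧ 0 < d b := by simpa [hP] using hbP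
  set d' : V → ℕ := fun x => d x - (if x = a then 1 else 0) - (if x = b then 1 else 0) with hd'def
  have hd' : ∀ x, d' x + (if x = a then 1 else 0) + (if x = b then 1 else 0) = d x := by
    intro x
    have := hb'.1
    have := hb'.2
    rw [hd'def]
    grind
  have hsum : ∑ x, d' x + 2 = ∑ x, d x := by
    simp only [← hd', sum_add_distrib]
    simp
  obtain ⟨G, hG⟩ := ih (∑ x, d' x) (by omega) (h.lower heven hb'.1.symm ha' hb'.2 hd')
    (by rw [← hsum, Nat.even_add] at heven; exact heven.2 (by norm_num)) rfl
  -- If `ab` is already an edge, some `x ∈ P` is not joined to `a`, because `a` has only `d a - 1`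
  -- neighbours in `G`. As `d b` is minimal in `P` and was lowered, `b` has fewer neighbours than
  -- `x`. So some edge `xy` can be replaced by `ax` and `by`, which raises just `a` and `b`.
  by_cases hadj : G.Adj a b
  · obtain ⟨x, hxP, hx⟩ : ∃ x ∈ P, ¬ G.Adj a x := by
      by_contra! hall
      have h1 : (P : Set V) ⊆ G.neighborSet a := fun x hx => hall x hx
      have h2 := Set.ncard_le_ncard h1 (Set.toFinite _)
      rw [Set.ncard_coe_finset] at h2
      have h3 := hG a
      have h4 := hd' a
      unfold nbrs at h3
      simp only [if_true] at h4
      omega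
    have hx' : x ≠ a ∧ 0 < d x := by simpa [hP] using hxP
    have hxb : x ≠ b := by
      rintro rfl
      exact hx hadj
    have hlt : nbrs G b < nbrs G x := by
      have e1 := hd' b
      have e2 := hd' x
      have e3 := hb x hxP
      simp only [hx'.1, hxb, if_true, if_false] at e1 e2
      rw [hG, hG]
      omega
    obtain ⟨y, hxy, hby, hyb⟩ := exists_adj_not_adj G hlt
    have hya : y ≠ a := by
      rintro rfl
      exact hx hxy.symm
    obtain ⟨G1, hd1, ha1⟩ := exists_remove_edge G hxy
    have hn1 : ¬ G1.Adj a x := fun hh => hx ((ha1 _ _).1 hh).1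
    obtain ⟨G2, hd2, ha2⟩ := exists_add_edge G1 hx'.1.symm hn1
    have hn2 : ¬ G2.Adj b y := by
      rw [ha2, ha1]
      have := hb'.1
      tauto
    obtain ⟨G3, hd3, -⟩ := exists_add_edge G2 hyb.symm hn2
    refine ⟨G3, fun z => ?_⟩
    have e1 := hd1 z
    have e2 := hd2 z
    have e3 := hd3 z
    have e4 := hd' z
    rw [hG z] at e1
    omega
  · obtain ⟨G', h1, -⟩ := exists_add_edge G hb'.1.symm hadj
    exact ⟨G', fun x => by rw [h1, hG, hd']⟩

end Graphs

end DegSeq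

/-! ### The dynamic program

A sequence is built from both ends: `k` large entries with sum `A` are fixed from the top and `l` small
entries with sum `T` from the bottom, and `r` bounds the entries still to be chosen. -/

namespace DegSeq

open Finset

/-- `Path n m F k l r A T v`: the partial sequence can be completed with additional value `v`. -/
inductive Path (n m : ℕ) (F : ℕ → ℝ) : ℕ → ℕ → ℕ → ℕ → ℕ → ℝ → Prop where
  | finish {k l r A T : ℕ} : n ≤ k + l → A + T = 2 * m → Path n m F k l r A T 0
  | lower {k l r A T : ℕ} {v : ℝ} : k + l < n → Path n m F k l r A T v →
      Path n m F k l (r + 1) A T v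
  -- An entry equal to `k` contributes nothing to the conditions at `s ≤ k`, so no check is needed.
  | bottom {k l r A T : ℕ} {v : ℝ} : k + l < n → k ≤ r → T + k ≤ 2 * m →
      Path n m F k (l + 1) r A (T + k) v → Path n m F k l r A T (v + F k)
  -- The last guard is the Erdős–Gallai inequality for the `k + 1` top entries against the `l`
  -- bottom entries, with all terms moved so that no subtraction of sums occurs.
  | top {k l r A T : ℕ} {v : ℝ} : k + l < n → k < r → A + r ≤ 2 * m →
      A + r + (k + 1) * l ≤ (k + 1) * (n - 1) + T →
      Path n m F (k + 1) l r (A + r) T v → Path n m F k l r A T (v + F r)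

/-- `FirstMove n m F k l r A T j v`: there is a completion of value `v` whose first move has
code `j`. -/
def FirstMove (n m : ℕ) (F : ℕ → ℝ) (k l r A T j : ℕ) (v : ℝ) : Prop :=
  (j = 1 ∧ n ≤ k + l ∧ A + T = 2 * m ∧ v = 0) ∨
  (j = 2 ∧ k + l < n ∧ 0 < r ∧ Path n m F k l (r - 1) A T v) ∨
  (j = 3 ∧ k + l < n ∧ k ≤ r ∧ T + k ≤ 2 * m ∧
    ∃ w, Path n m F k (l + 1) r A (T + k) w ∧ v = w + F k) ∨
  (j = 4 ∧ k + l < n ∧ k < r ∧ A + r ≤ 2 * m ∧ A + r + (k + 1) * l ≤ (k + 1) * (n - 1) + T ∧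
    ∃ w, Path n m F (k + 1) l r (A + r) T w ∧ v = w + F r)

/-- This is the recursion that the table evaluates. Codes start at `1`, so that `0` can stand for a
state without completion. -/
theorem path_iff_firstMove {n m : ℕ} {F : ℕ → ℝ} {k l r A T : ℕ} {v : ℝ} :
    Path n m F k l r A T v ↔ ∃ j, FirstMove n m F k l r A T j v := by
  constructor
  · intro h
    cases h with
    | finish h1 h2 => exact ⟨1, Or.inl ⟨rfl, h1, h2, rfl⟩⟩
    | lower h1 h2 => exact ⟨2, Or.inr (Or.inl ⟨rfl, h1, Nat.succ_pos _, h2⟩)⟩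
    | bottom h1 h2 h3 h4 => exact ⟨3, Or.inr (Or.inr (Or.inl ⟨rfl, h1, h2, h3, _, h4, rfl⟩))⟩
    | top h1 h2 h3 h4 h5 =>
      exact ⟨4, Or.inr (Or.inr (Or.inr ⟨rfl, h1, h2, h3, h4, _, h5, rfl⟩))⟩
  · rintro ⟨j, ⟨-, h1, h2, rfl⟩ | ⟨-, h1, h2, h3⟩ | ⟨-, h1, h2, h3, w, h4, rfl⟩ |
      ⟨-, h1, h2, h3, h4, w, h5, rfl⟩⟩
    · exact .finish h1 h2
    · obtain ⟨r, rfl⟩ := Nat.exists_eq_succ_of_ne_zero h2.ne'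
      exact .lower h1 h3
    · exact .bottom h1 h2 h3 h4
    · exact .top h1 h2 h3 h4 h5

/-- Every sequence with the Erdős–Gallai condition arises from a path. -/
theorem ErdosGallai.path {n m : ℕ} {d : Fin n → ℕ} (F : ℕ → ℝ) (h : ErdosGallai d)
    (hsum : ∑ x, d x = 2 * m) {S B X : Finset (Fin n)} (r : ℕ) (hSB : Disjoint S B)
    (hX : X = (S ∪ B)ᶜ) (hlo : ∀ x ∈ X, #S ≤ d x) (hhi : ∀ x ∈ X, d x ≤ r) :
    Path n m F #S #B r (∑ x ∈ S, d x) (∑ x ∈ B, d x) (∑ x ∈ X, F (d x)) := by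
  induction hN : 2 * #X + r using Nat.strong_induction_on generalizing S B X r with
  | _ N ih =>
  have hcard : #S + #B + #X = n := by
    rw [hX, ← card_union_of_disjoint hSB, add_comm, card_compl_add_card, Fintype.card_fin]
  have htot : ∑ x ∈ S, d x + ∑ x ∈ B, d x + ∑ x ∈ X, d x = 2 * m := by
    rw [hX, ← sum_union hSB, sum_add_sum_compl, hsum]
  have hmem : ∀ x, x ∈ X ↔ x ∉ S ∧ x ∉ B := by
    intro x
    simp [hX]
  have hle : ∀ x ∈ X, d x ≤ ∑ x ∈ X, d x := fun x hx =>
    single_le_sum (f := d) (fun _ _ => Nat.zero_le _) hx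
  rcases X.eq_empty_or_nonempty with rfl | hne
  · rw [sum_empty]
    refine .finish ?_ ?_
    · simp only [card_empty] at hcard
      omega
    · simpa using htot
  have hXpos := card_pos.2 hne
  -- Entries equal to `#S` go to the bottom first. When a top entry is fixed, the unassigned entries
  -- therefore exceed `#S`, and the lower bound survives the growth of `S`.
  by_cases hk : ∃ x ∈ X, d x = #S
  · obtain ⟨x, hx, hdx⟩ := hk
    have hxB := ((hmem x).1 hx).2
    have hp := ih (2 * #(X.erase x) + r) (by rw [card_erase_of_mem hx]; omega)
      (S := S) (B := insert x B) (X := X.erase x) r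
      (by rw [disjoint_insert_right]; exact ⟨((hmem x).1 hx).1, hSB⟩)
      (by ext y; simp only [mem_erase, hmem, mem_compl, mem_union, mem_insert]; tauto)
      (fun y hy => hlo y (mem_of_mem_erase hy)) (fun y hy => hhi y (mem_of_mem_erase hy)) rfl
    rw [card_insert_of_notMem hxB, sum_insert hxB, hdx, add_comm #S] at hp
    rw [← sum_erase_add _ _ hx, hdx]
    have := hle x hx
    have := hhi x hx
    exact .bottom (by omega) (by omega) (by omega) hp
  · push Not at hk
    have hlo' : ∀ x ∈ X, #S < d x := fun x hx => lt_of_le_of_ne (hlo x hx) (hk x hx).symm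
    by_cases hr : ∃ x ∈ X, d x = r
    · obtain ⟨x, hx, hdx⟩ := hr
      have hxS := ((hmem x).1 hx).1
      have hxB := ((hmem x).1 hx).2
      have hdisj : Disjoint (insert x S) B := by
        rw [disjoint_insert_left]
        exact ⟨hxB, hSB⟩
      have hp := ih (2 * #(X.erase x) + r) (by rw [card_erase_of_mem hx]; omega)
        (S := insert x S) (B := B) (X := X.erase x) r hdisj
        (by ext y; simp only [mem_erase, hmem, mem_compl, mem_union, mem_insert]; tauto)
        (fun y hy => by
          rw [card_insert_of_notMem hxS]
          exact hlo' y (mem_of_mem_erase hy)) (fun y hy => hhi y (mem_of_mem_erase hy)) rfl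
      -- The guard of the move is the hypothesis for the pair `insert x S`, `B`.
      have hs := h _ _ hdisj
      unfold slack at hs
      rw [card_insert_of_notMem hxS, sum_insert hxS, hdx, Fintype.card_fin] at hs
      rw [card_insert_of_notMem hxS, sum_insert hxS, hdx, add_comm r] at hp
      rw [← sum_erase_add _ _ hx, hdx]
      have h1 := hle x hx
      have h2 := hlo' x hx
      refine .top (by omega) (by omega) (by omega) ?_ hp
      have hn : 1 ≤ n := by omega
      zify [hn]
      push_cast at hs
      linarith
    · push Not at hr
      have hhi' : ∀ x ∈ X, d x < r := fun x hx => lt_of_le_of_ne (hhi x hx) (hr x hx)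
      obtain ⟨x, hx⟩ := hne
      have := hhi' x hx
      obtain ⟨r, rfl⟩ : ∃ q, r = q + 1 := ⟨r - 1, by omega⟩
      exact .lower (by omega) (ih (2 * #X + r) (by omega) r hSB hX hlo
        (fun y hy => Nat.le_of_lt_succ (hhi' y hy)) rfl)

/-! ### Soundness of the moves -/

/-- The invariant of a partial sequence `d` in which the first `k` and the last `l` of `n` entries
are fixed. -/
structure Partial (n k l r A T : ℕ) (d : ℕ → ℕ) : Prop where
  card_le : k + l ≤ n
  sum_top : ∑ i ∈ range k, d i = A
  sum_bottom : ∑ i ∈ Ico (n - l) n, d i = T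
  le_top : ∀ i < k, k ≤ d i ∧ r ≤ d i
  bottom_le : ∀ i, n - l ≤ i → i < n → d i ≤ k
  anti_top : ∀ i j, i ≤ j → j < k → d j ≤ d i
  anti_bottom : ∀ i j, n - l ≤ i → i ≤ j → j < n → d j ≤ d i
  -- Truncation matters here: only bottom entries below `s` count, which amounts to choosing the
  -- best `T` in the Erdős–Gallai condition.
  bound : ∀ s ≤ k, ∑ i ∈ range s, d i + ∑ i ∈ Ico (n - l) n, (s - d i) ≤ s * (n - 1)

theorem Partial.init (n r : ℕ) (d : ℕ → ℕ) : Partial n 0 0 r 0 0 d where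
  card_le := Nat.zero_le _
  sum_top := by simp
  sum_bottom := by simp
  le_top := by simp
  bottom_le := by intros; omega
  anti_top := by intros; omega
  anti_bottom := by intros; omega
  bound := by simp

theorem Partial.lower {n k l r A T : ℕ} {d : ℕ → ℕ} (h : Partial n k l r A T d) :
    Partial n k l (r - 1) A T d :=
  { h with le_top := fun i hi => ⟨(h.le_top i hi).1, (Nat.sub_le _ _).trans (h.le_top i hi).2⟩ }

/-- The new entry is `k`, so its truncated difference `s - k` vanishes for all `s ≤ k` and no
inequality changes. -/
theorem Partial.bottom {n k l r A T : ℕ} {d : ℕ → ℕ} (h : Partial n k l r A T d)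
    (hlt : k + l < n) :
    Partial n k (l + 1) r A (T + k) (Function.update d (n - 1 - l) k) := by
  set d' := Function.update d (n - 1 - l) k with hd'
  have hnew : d' (n - 1 - l) = k := by simp [hd']
  have hold : ∀ i, i ≠ n - 1 - l → d' i = d i := fun i hi => by simp [hd', hi]
  have h1 : ∀ s ≤ k, ∑ i ∈ range s, d' i = ∑ i ∈ range s, d i := fun s hs =>
    sum_congr rfl fun i hi => hold i (by rw [mem_range] at hi; omega)
  have hI : Ico (n - (l + 1)) n = insert (n - 1 - l) (Ico (n - l) n) := by
    ext i
    simp only [mem_Ico, mem_insert]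
    omega
  have hnm : n - 1 - l ∉ Ico (n - l) n := by
    simp only [mem_Ico]
    omega
  have h2 : ∀ i ∈ Ico (n - l) n, d' i = d i := fun i hi =>
    hold i (by rw [mem_Ico] at hi; omega)
  constructor
  · omega
  · rw [h1 k le_rfl, h.sum_top]
  · rw [hI, sum_insert hnm, hnew, sum_congr rfl h2, h.sum_bottom, add_comm]
  · intro i hi
    rw [hold i (by omega)]
    exact h.le_top i hi
  · intro i hi hin
    by_cases he : i = n - 1 - l
    · rw [he, hnew]
    · rw [hold i he]
      exact h.bottom_le i (by omega) hin
  · intro i j hij hj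
    rw [hold i (by omega), hold j (by omega)]
    exact h.anti_top i j hij hj
  · intro i j hi hij hj
    by_cases hi' : i = n - 1 - l
    · by_cases hj' : j = n - 1 - l
      · rw [hi', hj']
      · rw [hi', hnew, hold j hj']
        exact h.bottom_le j (by omega) hj
    · rw [hold i hi', hold j (by omega)]
      exact h.anti_bottom i j (by omega) hij hj
  · intro s hs
    rw [h1 s hs, hI, sum_insert hnm, hnew, Nat.sub_eq_zero_of_le hs, zero_add,
      sum_congr rfl (s₂ := Ico (n - l) n) fun i hi => by rw [h2 i hi]]
    exact h.bound s hs

/-- Only the inequality at `s = k + 1` is new. Bottom entries are at most `k`, so nothing is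
truncated there, the differences add up to `(k + 1) * l - T`, and the inequality becomes the guard
of the move. -/
theorem Partial.top {n k l r A T : ℕ} {d : ℕ → ℕ} (h : Partial n k l r A T d)
    (hlt : k + l < n) (hkr : k < r)
    (hb : A + r + (k + 1) * l ≤ (k + 1) * (n - 1) + T) :
    Partial n (k + 1) l r (A + r) T (Function.update d k r) := by
  set d' := Function.update d k r with hd'
  have hnew : d' k = r := by simp [hd']
  have hold : ∀ i, i ≠ k → d' i = d i := fun i hi => by simp [hd', hi]
  have h1 : ∀ s ≤ k, ∑ i ∈ range s, d' i = ∑ i ∈ range s, d i := fun s hs =>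
    sum_congr rfl fun i hi => hold i (by rw [mem_range] at hi; omega)
  have h2 : ∀ i ∈ Ico (n - l) n, d' i = d i := fun i hi =>
    hold i (by rw [mem_Ico] at hi; omega)
  have hA : ∑ i ∈ range (k + 1), d' i = A + r := by
    rw [sum_range_succ, h1 k le_rfl, hnew, h.sum_top]
  constructor
  · omega
  · exact hA
  · rw [sum_congr rfl h2, h.sum_bottom]
  · intro i hi
    by_cases he : i = k
    · rw [he, hnew]
      exact ⟨hkr, le_rfl⟩
    · rw [hold i he]
      have := h.le_top i (by omega)
      omega
  · intro i hi hin
    rw [hold i (by omega)]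
    exact (h.bottom_le i hi hin).trans (Nat.le_succ _)
  · intro i j hij hj
    by_cases hj' : j = k
    · by_cases hi' : i = k
      · rw [hi', hj']
      · rw [hj', hnew, hold i hi']
        exact (h.le_top i (by omega)).2
    · rw [hold i (by omega), hold j hj']
      exact h.anti_top i j hij (by omega)
  · intro i j hi hij hj
    rw [hold i (by omega), hold j (by omega)]
    exact h.anti_bottom i j hi hij hj
  · intro s hs
    rw [sum_congr rfl (s₂ := Ico (n - l) n) fun i hi => by rw [h2 i hi]]
    rcases Nat.lt_or_ge k s with hks | hks
    · obtain rfl : s = k + 1 := by omega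
      rw [hA]
      have e1 : ∑ i ∈ Ico (n - l) n, (k + 1 - d i) + T = (k + 1) * l := by
        rw [← h.sum_bottom, ← sum_add_distrib]
        have : ∀ i ∈ Ico (n - l) n, k + 1 - d i + d i = k + 1 := by
          intro i hi
          rw [mem_Ico] at hi
          have := h.bottom_le i hi.1 hi.2
          omega
        rw [sum_congr rfl this, sum_const, Nat.card_Ico, smul_eq_mul, mul_comm]
        congr 1
        omega
      omega
    · rw [h1 s hks]
      exact h.bound s hks

/-- For a nonincreasing sequence no `s` entries have a larger sum than the first `s`. -/
theorem sum_le_sum_range {n : ℕ} {d : ℕ → ℕ} (hd : ∀ i j, i ≤ j → j < n → d j ≤ d i)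
    (P : Finset ℕ) (hP : ∀ i ∈ P, i < n) : ∑ i ∈ P, d i ≤ ∑ i ∈ range #P, d i := by
  induction hs : #P generalizing P with
  | zero =>
    rw [card_eq_zero] at hs
    simp [hs]
  | succ s ih =>
    have hne : P.Nonempty := card_pos.1 (by omega)
    set x := P.max' hne with hx
    have hxP : x ∈ P := P.max'_mem hne
    -- The largest of `s + 1` indices is at least `s`, so its entry is at most `d s`.
    have hxs : s ≤ x := by
      have h1 : P ⊆ range (x + 1) := fun i hi => by
        rw [mem_range]
        exact Nat.lt_succ_of_le (P.le_max' i hi)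
      have h2 := card_le_card h1
      rw [card_range] at h2
      omega
    have h3 := ih (P.erase x) (fun i hi => hP i (mem_of_mem_erase hi))
      (by rw [card_erase_of_mem hxP, hs]; rfl)
    rw [← sum_erase_add _ _ hxP, sum_range_succ]
    exact Nat.add_le_add h3 (hd s x hxs (hP x hxP))

/-- A complete sequence satisfies the Erdős–Gallai condition. -/
theorem Partial.erdosGallai {n k l r A T : ℕ} {d : ℕ → ℕ} (h : Partial n k l r A T d)
    (hn : n ≤ k + l) : ErdosGallai (fun i : Fin n => d i) := by
  have hkl : n - l = k := by have := h.card_le; omega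
  have hkn : k ≤ n := by omega
  have hanti : ∀ i j, i ≤ j → j < n → d j ≤ d i := by
    intro i j hij hj
    rcases Nat.lt_or_ge j k with h1 | h1
    · exact h.anti_top i j hij h1
    · rcases Nat.lt_or_ge i k with h2 | h2
      · exact (h.bottom_le j (by omega) hj).trans (h.le_top i h2).1
      · exact h.anti_bottom i j (by omega) hij hj
  intro S T' hST
  induction hs : #S generalizing S with
  | zero =>
    rw [card_eq_zero] at hs
    unfold slack
    rw [hs]
    simp only [card_empty, Nat.cast_zero, zero_mul, sum_empty, zero_add, sub_zero]
    exact sum_nonneg fun x _ => by positivity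
  | succ s ih =>
    have hcard : #S + #T' ≤ n := by
      rw [← card_union_of_disjoint hST]
      simpa using card_le_univ (S ∪ T')
    -- An entry of `S` below `#S` can be dropped without raising the slack, because `n - 1 - #T' ≥
    -- #S - 1`.
    by_cases hx : ∃ x ∈ S, d x ≤ s
    · obtain ⟨x, hxS, hdx⟩ := hx
      have h1 := ih (S.erase x) (hST.mono_left (erase_subset _ _))
        (by rw [card_erase_of_mem hxS, hs]; rfl)
      rw [slack_erase_left _ _ hxS, Fintype.card_fin] at h1
      have h2 : ((d x : ℕ) : ℤ) ≤ s := by exact_mod_cast hdx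
      have h3 : (#S : ℤ) + #T' ≤ n := by exact_mod_cast hcard
      rw [hs] at h3
      push_cast at h3
      linarith
    · push Not at hx
      set P : Finset ℕ := S.map Fin.valEmbedding with hP
      set Q : Finset ℕ := T'.map Fin.valEmbedding with hQ
      have hPn : ∀ i ∈ P, i < n := by
        intro i hi
        obtain ⟨x, -, rfl⟩ := mem_map.1 hi
        exact x.2
      have hQn : ∀ i ∈ Q, i < n := by
        intro i hi
        obtain ⟨x, -, rfl⟩ := mem_map.1 hi
        exact x.2
      have hPd : ∀ i ∈ P, s < d i := by
        intro i hi
        obtain ⟨x, hxS, rfl⟩ := mem_map.1 hi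
        exact hx x hxS
      have hPc : #P = s + 1 := by rw [hP, card_map, hs]
      -- All entries of `S` now exceed `s`. If `s ≥ k`, they would all lie among the `k` top
      -- positions, which are too few.
      have hsk : s + 1 ≤ k := by
        by_contra hlt
        have h1 : P ⊆ range k := by
          intro i hi
          rw [mem_range]
          by_contra hik
          have h2 := h.bottom_le i (by omega) (hPn i hi)
          have h3 := hPd i hi
          omega
        have h4 := card_le_card h1
        rw [card_range] at h4
        omega
      have h1 := sum_le_sum_range hanti P hPn
      rw [hPc] at h1
      have h2 := h.bound (s + 1) hsk
      -- Top entries are at least `k ≥ s + 1` and contribute `0`, so only bottom positions of `Q`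
      -- count.
      have h3 : ∑ i ∈ Q, (s + 1 - d i) ≤ ∑ i ∈ Ico (n - l) n, (s + 1 - d i) := by
        have h4 : ∑ i ∈ Q, (s + 1 - d i) = ∑ i ∈ Q with k ≤ i, (s + 1 - d i) := by
          rw [sum_filter]
          refine sum_congr rfl fun i _ => ?_
          split_ifs with hik
          · rfl
          · have := (h.le_top i (by omega)).1
            omega
        rw [h4]
        refine sum_le_sum_of_subset fun i hi => ?_
        rw [mem_filter] at hi
        rw [mem_Ico]
        exact ⟨by omega, hQn i hi.1⟩
      have h5 : (s + 1) * #Q ≤ ∑ i ∈ Q, (s + 1 - d i) + ∑ i ∈ Q, d i := by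
        rw [← sum_add_distrib, mul_comm, ← smul_eq_mul]
        exact card_nsmul_le_sum _ _ _ fun i _ => by omega
      have h6 : ∑ i ∈ P, d i + (s + 1) * #Q ≤ (s + 1) * (n - 1) + ∑ i ∈ Q, d i := by omega
      rw [hP, hQ, sum_map, sum_map, card_map] at h6
      have hn1 : 1 ≤ n := by omega
      zify [hn1] at h6
      unfold slack
      rw [hs, Fintype.card_fin]
      push_cast
      simp only [Fin.valEmbedding_apply] at h6
      linarith

end DegSeq

/-! ### Reasoning about programs -/

namespace RAM

/-- Started in `s`, the program `p` halts within `K` steps in a configuration that satisfies `Q`. -/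
def Runs (p : Prog) (s : State) (K : ℕ) (Q : State → Prop) : Prop :=
  ∃ t s', Exec p s t s' ∧ t ≤ K ∧ Q s'

theorem Runs.mono {p : Prog} {s : State} {K K' : ℕ} {Q Q' : State → Prop} (h : Runs p s K Q)
    (hK : K ≤ K') (hQ : ∀ s', Q s' → Q' s') : Runs p s K' Q' := by
  obtain ⟨t, s', h1, h2, h3⟩ := h
  exact ⟨t, s', h1, h2.trans hK, hQ _ h3⟩

theorem Runs.seq {p q : Prog} {s : State} {K₁ K₂ K : ℕ} {Q R : State → Prop} (h : Runs p s K₁ Q)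
    (hq : ∀ s', Q s' → Runs q s' K₂ R) (hK : K₁ + K₂ ≤ K) : Runs (.seq p q) s K R := by
  obtain ⟨t, s', h1, h2, h3⟩ := h
  obtain ⟨t', s'', h4, h5, h6⟩ := hq s' h3
  exact ⟨_, _, .seq h1 h4, by omega, h6⟩

theorem Runs.ite {c : Test} {p q : Prog} {s : State} {K : ℕ} {Q : State → Prop}
    (hp : c.Holds s → Runs p s K Q) (hq : ¬ c.Holds s → Runs q s K Q) :
    Runs (.ite c p q) s (K + 1) Q := by
  by_cases hc : c.Holds s
  · obtain ⟨t, s', h1, h2, h3⟩ := hp hc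
    exact ⟨_, _, .ite_true hc h1, by omega, h3⟩
  · obtain ⟨t, s', h1, h2, h3⟩ := hq hc
    exact ⟨_, _, .ite_false hc h1, by omega, h3⟩

/-- A while loop with invariant `I` and variant `μ`. -/
theorem Runs.loop {c : Test} {p : Prog} {K : ℕ} (I : State → Prop) (μ : State → ℕ)
    (hp : ∀ s, I s → c.Holds s → Runs p s K fun s' => I s' ∧ μ s' < μ s) {s : State} (hs : I s) :
    Runs (.loop c p) s (μ s * (K + 1) + 1) fun s' => I s' ∧ ¬ c.Holds s' := by
  induction hN : μ s using Nat.strong_induction_on generalizing s with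
  | _ N ih =>
  by_cases hc : c.Holds s
  · obtain ⟨t, s', h1, h2, h3, h4⟩ := hp s hs hc
    obtain ⟨t', s'', h5, h6, h7⟩ := ih (μ s') (by omega) h3 rfl
    refine ⟨_, _, .loop_true hc h1 h5, ?_, h7⟩
    have : (μ s' + 1) * (K + 1) ≤ N * (K + 1) := Nat.mul_le_mul_right _ (by omega)
    rw [Nat.add_mul] at this
    omega
  · exact ⟨_, _, .loop_false hc, by omega, hs, hc⟩

/-- Straight-line programs. -/
def block : List Instr → Prog
  -- A copy of a register to itself does nothing; it is why a block costs one step more than its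
  -- length.
  | [] => .instr (.copy 0 0)
  | i :: is => .seq (.instr i) (block is)

/-- The effect of a straight-line program. -/
noncomputable def effect : List Instr → State → State
  | [], s => s
  | i :: is, s => effect is (i.apply s)

theorem exec_block (is : List Instr) (s : State) :
    Exec (block is) s (is.length + 1) (effect is s) := by
  induction is generalizing s with
  | nil =>
    have h := Exec.instr (.copy 0 0) s
    have : (Instr.copy 0 0).apply s = s := by
      cases s
      simp [Instr.apply]
    rw [this] at h
    exact h
  | cons i is ih =>
    have h := Exec.seq (Exec.instr i s) (ih (i.apply s))
    rw [List.length_cons, Nat.add_comm is.length 1, Nat.add_assoc]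
    exact h

theorem Runs.block {is : List Instr} {s : State} {K : ℕ} {Q : State → Prop}
    (h : Q (effect is s)) (hK : is.length + 1 ≤ K) : Runs (block is) s K Q :=
  ⟨_, _, exec_block is s, hK, h⟩

theorem Runs.block_seq {is : List Instr} {q : Prog} {s : State} {K K' : ℕ} {R : State → Prop}
    (h : ∀ s', s' = effect is s → Runs q s' K R) (hK : is.length + 1 + K ≤ K') :
    Runs (.seq (RAM.block is) q) s K' R :=
  Runs.seq (Runs.block (Q := fun s' => s' = effect is s) rfl le_rfl) h hK

/-- Overwriting a natural-number register. -/
def State.setReg (s : State) (x v : ℕ) : State := { s with reg := Function.update s.reg x v }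

/-- `for x := 0, …, reg y - 1 do p`, where register `o` holds `1`. -/
def forLoop (x y o : ℕ) (p : Prog) : Prog :=
  .seq (.instr (.const x 0)) (.loop (.lt x y) (.seq p (.instr (.add x x o))))

/-- The invariant may mention the counter, so the body has to establish it for the state in which
the counter has already been advanced. -/
theorem Runs.forLoop {x y o : ℕ} {p : Prog} {N K : ℕ} (I : ℕ → State → Prop)
    (hI : ∀ i s, I i s → s.reg x = i ∧ s.reg y = N)
    (hp : ∀ i < N, ∀ s, I i s →
      Runs p s K fun s' => I (i + 1) (s'.setReg x (i + 1)) ∧ s'.reg x = i ∧ s'.reg o = 1)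
    {s : State} (hs : I 0 (s.setReg x 0)) :
    Runs (forLoop x y o p) s (N * (K + 2) + 2) (I N) := by
  have h1 : Runs (.instr (.const x 0)) s 1 (I 0) := ⟨_, _, .instr _ _, le_rfl, hs⟩
  refine h1.seq (K₂ := N * (K + 2) + 1) (fun s' hs' => ?_) (by omega)
  have h2 := Runs.loop (c := .lt x y) (p := .seq p (.instr (.add x x o))) (K := K + 1)
    (fun s => ∃ i ≤ N, I i s) (fun s => N - s.reg x) (fun s ⟨i, hi, hs⟩ hc => by
      have h3 := hI i s hs
      have hlt : i < N := by
        have : s.reg x < s.reg y := hc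
        omega
      refine (hp i hlt s hs).seq (K₂ := 1)
        (fun s₁ hs₁ => ⟨_, _, .instr _ _, le_rfl, ?_⟩) le_rfl
      have : (Instr.add x x o).apply s₁ = s₁.setReg x (i + 1) := by
        simp only [Instr.apply, State.setReg, hs₁.2.1, hs₁.2.2]
      rw [this]
      refine ⟨⟨i + 1, hlt, hs₁.1⟩, ?_⟩
      have h4 := hI _ _ hs₁.1
      show N - (s₁.setReg x (i + 1)).reg x < N - s.reg x
      omega) (s := s') ⟨0, Nat.zero_le _, hs'⟩
  refine h2.mono ?_ ?_
  · show (N - s'.reg x) * (K + 1 + 1) + 1 ≤ _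
    have : (N - s'.reg x) * (K + 1 + 1) ≤ N * (K + 2) := Nat.mul_le_mul_right _ (Nat.sub_le _ _)
    omega
  · rintro s₁ ⟨⟨i, hi, hs₁⟩, hc⟩
    have h3 := hI i s₁ hs₁
    have : ¬ s₁.reg x < s₁.reg y := hc
    obtain rfl : i = N := by omega
    exact hs₁

/-- `z := x * y` by repeated addition, with counter `i`; register `o` holds `1`. -/
def mul (z x y i o : ℕ) : Prog :=
  .seq (.instr (.const z 0)) (forLoop i y o (.instr (.add z z x)))

theorem Runs.mul {z x y i o : ℕ} {s : State} (hzx : z ≠ x) (hzy : z ≠ y) (hzi : z ≠ i)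
    (hzo : z ≠ o) (hix : i ≠ x) (hiy : i ≠ y) (hio : i ≠ o) (ho : s.reg o = 1) :
    Runs (mul z x y i o) s (s.reg y * 3 + 3) fun s' => s' =
      (s.setReg z (s.reg x * s.reg y)).setReg i (s.reg y) := by
  have h1 : Runs (.instr (.const z 0)) s 1 (fun s' => s' = s.setReg z 0) :=
    ⟨_, _, .instr _ _, le_rfl, rfl⟩
  refine h1.seq (K₂ := s.reg y * 3 + 2) ?_ (by omega)
  rintro _ rfl
  refine (Runs.forLoop (N := s.reg y) (K := 1)
    (fun j s' => s' = (s.setReg z (s.reg x * j)).setReg i j) ?_ ?_ ?_).mono (by omega)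
    fun s' h => h
  · rintro j _ rfl
    simp [State.setReg, hzy.symm, hiy.symm]
  · rintro j hj _ rfl
    refine ⟨_, _, .instr _ _, le_rfl, ?_, ?_, ?_⟩
    · simp only [Instr.apply, State.setReg, State.mk.injEq, and_true]
      funext w
      simp only [Function.update_apply]
      grind
    · simp [Instr.apply, State.setReg, hzi.symm]
    · simp [Instr.apply, State.setReg, hzo.symm, hio.symm, ho]
  · simp [State.setReg]

end RAM

/-! ### Filling the table

Registers `0, …, 15` hold constants: `n`, `m`, `1`, the strides of the table, its base address and the
like. Register `16` holds the address of the current table cell, `17, …, 21` are the counters of the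
nested loops. Register `27` and real register `1` hold the code of the best first move found so far and its
value. Real register `4` holds `0`. -/

namespace DegSeq

open RAM

/-- The contents of the registers for constants. -/
structure Consts (n m : ℕ) (R : ℕ → ℕ) : Prop where
  r0 : R 0 = n
  r1 : R 1 = m
  r2 : R 2 = 1
  r3 : R 3 = 2 * m + 1
  r4 : R 4 = n + 1
  r5 : R 5 = m + 1
  r6 : R 6 = (2 * m + 1) * (2 * m + 1)
  r7 : R 7 = (2 * m + 1) * (2 * m + 1) * (m + 1)
  r8 : R 8 = (2 * m + 1) * (2 * m + 1) * (m + 1) * (n + 1)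
  r9 : R 9 = 2 * m + 2 * n
  r10 : R 10 = 2 * m
  r11 : R 11 = 0
  r12 : R 12 = n - 1
  r13 : R 13 = 2 * m + n

theorem Consts.congr {n m : ℕ} {R R' : ℕ → ℕ} (h : Consts n m R) (hR : ∀ x < 16, R' x = R x) :
    Consts n m R' := by
  obtain ⟨h0, h1, h2, h3, h4, h5, h6, h7, h8, h9, h10, h11, h12, h13⟩ := h
  constructor <;> rw [hR _ (by norm_num)] <;> assumption

/-! ### The layout of the table -/

/-- `j` and `v` describe a best element of `X`: `j = 0` if there is none. -/
def BestOf (X : ℕ → ℝ → Prop) (j : ℕ) (v : ℝ) : Prop :=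
  (j = 0 ∧ ∀ i w, ¬ X i w) ∨ (0 < j ∧ X j v ∧ ∀ i w, X i w → w ≤ v)

theorem BestOf.congr {X Y : ℕ → ℝ → Prop} {j : ℕ} {v : ℝ} (h : BestOf X j v)
    (hXY : ∀ i w, Y i w ↔ X i w) : BestOf Y j v := by
  have : Y = X := by
    funext i w
    exact propext (hXY i w)
  rwa [this]

/-- The position of a state in the table. -/
def idx (n m kb lb r A T : ℕ) : ℕ :=
  (((kb * (n + 1) + lb) * (m + 1) + r) * (2 * m + 1) + A) * (2 * m + 1) + T

/-- This and the next two identities locate the target of a move relative to the current cell. The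
strides on the left are the contents of registers `6`, `7` and `8`. -/
theorem idx_lower (n m kb lb r A T : ℕ) :
    idx n m kb lb r A T + (2 * m + 1) * (2 * m + 1) = idx n m kb lb (r + 1) A T := by
  unfold idx
  ring

theorem idx_bottom (n m kb lb r A T k : ℕ) :
    idx n m kb lb r A (T + k) + (2 * m + 1) * (2 * m + 1) * (m + 1) =
      idx n m kb (lb + 1) r A T + k := by
  unfold idx
  ring

theorem idx_top (n m kb lb r A T : ℕ) :
    idx n m kb lb r (A + r) T + (2 * m + 1) * (2 * m + 1) * (m + 1) * (n + 1) =
      idx n m (kb + 1) lb r A T + (2 * m + 1) * r := by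
  unfold idx
  ring

theorem mul_add_inj {b x y x' y' : ℕ} (hy : y < b) (hy' : y' < b)
    (h : x * b + y = x' * b + y') : x = x' ∧ y = y' := by
  have h1 : (x * b + y) / b = x := by
    rw [mul_comm, Nat.mul_add_div (by omega), Nat.div_eq_of_lt hy, add_zero]
  have h2 : (x' * b + y') / b = x' := by
    rw [mul_comm, Nat.mul_add_div (by omega), Nat.div_eq_of_lt hy', add_zero]
  have h3 : x = x' := by rw [← h1, ← h2, h]
  subst h3
  exact ⟨rfl, by omega⟩

theorem idx_inj {n m kb lb r A T kb' lb' r' A' T' : ℕ} (hlb : lb ≤ n) (hlb' : lb' ≤ n)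
    (hr : r ≤ m) (hr' : r' ≤ m) (hA : A ≤ 2 * m) (hA' : A' ≤ 2 * m) (hT : T ≤ 2 * m)
    (hT' : T' ≤ 2 * m) (h : idx n m kb lb r A T = idx n m kb' lb' r' A' T') :
    kb = kb' ∧ lb = lb' ∧ r = r' ∧ A = A' ∧ T = T' := by
  obtain ⟨h1, e1⟩ := mul_add_inj (by omega) (by omega) h
  obtain ⟨h2, e2⟩ := mul_add_inj (by omega) (by omega) h1
  obtain ⟨h3, e3⟩ := mul_add_inj (by omega) (by omega) h2
  obtain ⟨h4, e4⟩ := mul_add_inj (by omega) (by omega) h3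
  exact ⟨h4, e4, e3, e2, e1⟩

/-- All table cells with position less than `N` are correct. -/
def TableBelow (n m : ℕ) (F : ℕ → ℝ) (N : ℕ) (mem : ℕ → ℕ) (rmem : ℕ → ℝ) : Prop :=
  ∀ kb lb r A T, kb ≤ n → lb ≤ n → r ≤ m → A ≤ 2 * m → T ≤ 2 * m → idx n m kb lb r A T < N →
    -- Indexing by the numbers `kb = n - k` and `lb = n - l` makes every move lead to a smaller
    -- position, so one sweep in increasing order fills the table.
    BestOf (FirstMove n m F (n - kb) (n - lb) r A T)
      (mem (2 * m + 2 * n + idx n m kb lb r A T)) (rmem (2 * m + 2 * n + idx n m kb lb r A T))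

/-! ### Computing one cell -/

/-- The program that does nothing. -/
def nop : Prog := block []

/-- Compare the best move found so far with the move of code `j` to the table cell in
register `28`, with gain in real register `3`. -/
def consider (j : ℕ) : Prog :=
  .seq (block [.load 29 28]) (.ite (.lt 11 29)
    (.seq (block [.rload 2 28, .radd 2 2 3])
      (.ite (.lt 11 27) (.ite (.rlt 1 2) (block [.const 27 j, .rcopy 1 2]) nop)
        (block [.const 27 j, .rcopy 1 2])))
    nop)

/-- The state `s` differs from `s₀` only in scratch registers and holds a best element of `X`. -/
structure Scan (s₀ : State) (X : ℕ → ℝ → Prop) (s : State) : Prop where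
  agree : ∀ x, x ≠ 27 → x ≠ 28 → x ≠ 29 → x ≠ 30 → x ≠ 33 → s.reg x = s₀.reg x
  mem : s.mem = s₀.mem
  rmem : s.rmem = s₀.rmem
  rzero : s.rreg 4 = 0
  best : BestOf X (s.reg 27) (s.rreg 1)

theorem Scan.congr {s₀ s : State} {X Y : ℕ → ℝ → Prop} (h : Scan s₀ X s)
    (hXY : ∀ i w, Y i w ↔ X i w) : Scan s₀ Y s :=
  { h with best := h.best.congr hXY }

theorem runs_nop {s : State} {K : ℕ} {Q : State → Prop} (h : Q s) (hK : 1 ≤ K) :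
    Runs nop s K Q := Runs.block h hK

/-- Adding the constant gain `g` preserves the order, so among all completions through the target
only its recorded best one has to be compared. A stored code `0` means that there are none. -/
theorem runs_consider {s₀ s : State} {X Z : ℕ → ℝ → Prop} {j : ℕ} {g : ℝ} (hs : Scan s₀ X s)
    (hzero : s₀.reg 11 = 0) (hj : 0 < j) (hg : s.rreg 3 = g)
    (hZ : BestOf Z (s₀.mem (s.reg 28)) (s₀.rmem (s.reg 28))) :
    Runs (consider j) s 11 (Scan s₀ fun i v => X i v ∨ (i = j ∧ ∃ w, (∃ q, Z q w) ∧ v = w + g)) := by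
  obtain ⟨ha, hm, hr, hz, hb⟩ := hs
  have h11 : s.reg 11 = 0 := by rw [ha 11 (by norm_num) (by norm_num) (by norm_num) (by norm_num)
    (by norm_num), hzero]
  rw [← hm, ← hr] at hZ
  refine Runs.seq (K₁ := 2) (K₂ := 9) (Q := fun s' => s' = s.setReg 29 (s.mem (s.reg 28)))
    (Runs.block rfl (by simp)) ?_ le_rfl
  rintro _ rfl
  refine Runs.ite (fun hc => ?_) (fun hc => ?_)
  · have hpos : 0 < s.mem (s.reg 28) := by
      simpa [Test.Holds, State.setReg, h11] using hc
    obtain ⟨h0, -⟩ | ⟨-, hZ1, hZ2⟩ := hZ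
    · omega
    refine Runs.block_seq (K := 5) ?_ (by simp)
    rintro s' hs'
    have hs'reg : s'.reg = Function.update s.reg 29 (s.mem (s.reg 28)) := by
      rw [hs']
      rfl
    have hs'mem : s'.mem = s₀.mem := by
      rw [hs', ← hm]
      rfl
    have hs'rmem : s'.rmem = s₀.rmem := by
      rw [hs', ← hr]
      rfl
    have hs'2 : s'.rreg 2 = s.rmem (s.reg 28) + g := by
      rw [hs']
      simp [effect, Instr.apply, State.setReg, hg]
    have hs'r : ∀ a, a ≠ 2 → s'.rreg a = s.rreg a := by
      intro a h2
      rw [hs']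
      simp [effect, Instr.apply, State.setReg, h2]
    have hset : (∀ i w, X i w → w ≤ s'.rreg 2) → Runs (block [.const 27 j, .rcopy 1 2]) s' 3
        (Scan s₀ fun i v => X i v ∨ (i = j ∧ ∃ w, (∃ q, Z q w) ∧ v = w + g)) := by
      intro hX
      refine Runs.block ⟨?_, ?_, ?_, ?_, ?_⟩ (by simp)
      · intro x h1 h2 h3 h4 h5
        simp [effect, Instr.apply, hs'reg, h1, h3, ha x h1 h2 h3 h4 h5]
      · simpa [effect, Instr.apply] using hs'mem
      · simpa [effect, Instr.apply] using hs'rmem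
      · simp [effect, Instr.apply, hs'r, hz]
      · refine Or.inr ⟨by simpa [effect, Instr.apply] using hj, Or.inr ⟨by simp [effect,
          Instr.apply], s.rmem (s.reg 28), ⟨_, hZ1⟩, by simp [effect, Instr.apply, hs'2]⟩, ?_⟩
        have : (effect [.const 27 j, .rcopy 1 2] s').rreg 1 = s'.rreg 2 := by
          simp [effect, Instr.apply]
        rw [this]
        rintro i w (h | ⟨-, w, ⟨q, hq⟩, rfl⟩)
        · exact hX i w h
        · rw [hs'2]
          have := hZ2 q w hq
          linarith
    refine Runs.ite (K := 4) (fun hc' => ?_) (fun hc' => ?_)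
    · have hpos' : 0 < s.reg 27 := by
        simpa [Test.Holds, hs'reg, h11] using hc'
      obtain ⟨h0, -⟩ | ⟨-, hX1, hX2⟩ := hb
      · omega
      refine Runs.ite (K := 3) (fun hlt => ?_) (fun hlt => ?_)
      · have hlt' : s'.rreg 1 < s'.rreg 2 := hlt
        rw [hs'r 1 (by norm_num)] at hlt'
        exact hset fun i w hw => (hX2 i w hw).trans hlt'.le
      · have hle : s'.rreg 2 ≤ s'.rreg 1 := not_lt.1 hlt
        have e1 : s'.rreg 1 = s.rreg 1 := hs'r 1 (by norm_num)
        have e27 : s'.reg 27 = s.reg 27 := by simp [hs'reg]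
        refine runs_nop ⟨?_, hs'mem, hs'rmem, ?_, ?_⟩ (by norm_num)
        · intro x h1 h2 h3 h4 h5
          simp [hs'reg, h3, ha x h1 h2 h3 h4 h5]
        · rw [hs'r 4 (by norm_num), hz]
        · rw [e1, e27]
          refine Or.inr ⟨hpos', Or.inl hX1, ?_⟩
          rintro i w (h | ⟨-, w, ⟨q, hq⟩, rfl⟩)
          · exact hX2 i w h
          · have := hZ2 q w hq
            rw [hs'2, e1] at hle
            linarith
    · have hpos' : s.reg 27 = 0 := by
        simpa [Test.Holds, hs'reg, h11] using hc'
      obtain ⟨-, hX⟩ | ⟨h0, -⟩ := hb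
      · exact (hset fun i w hw => absurd hw (hX i w)).mono (by norm_num) fun _ h => h
      · omega
  · have hpos : s.mem (s.reg 28) = 0 := by
      simpa [Test.Holds, State.setReg, h11] using hc
    obtain ⟨-, hZ⟩ | ⟨h0, -⟩ := hZ
    · refine runs_nop ⟨?_, hm, hr, hz, ?_⟩ (by norm_num)
      · intro x h1 h2 h3 h4 h5
        simp [State.setReg, h3, ha x h1 h2 h3 h4 h5]
      · have : (s.setReg 29 (s.mem (s.reg 28))).reg 27 = s.reg 27 := by simp [State.setReg]
        rw [this]
        refine hb.congr fun i w => ⟨?_, Or.inl⟩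
        rintro (h | ⟨-, w, ⟨q, hq⟩, rfl⟩)
        · exact h
        · exact absurd hq (hZ q w)
    · omega

/-- Consider lowering the bound. -/
def tryLower : Prog :=
  .ite (.lt 11 19) (.seq (block [.sub 28 16 6, .rcopy 3 4]) (consider 2)) nop

/-- Consider fixing an entry at the bottom. -/
def tryBottom : Prog :=
  .ite (.lt 19 22) nop (.seq (block [.add 30 21 22]) (.ite (.lt 10 30) nop
    (.seq (block [.sub 28 16 7, .add 28 28 22, .rload 3 22]) (consider 3))))

/-- Consider fixing an entry at the top. -/
def tryTop : Prog :=
  .ite (.lt 22 19) (.seq (block [.add 30 20 19]) (.ite (.lt 10 30) nop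
    (.seq (block [.add 30 30 24, .add 33 25 21]) (.ite (.lt 33 30) nop
      (.seq (block [.sub 28 16 8, .add 28 28 26, .rload 3 19]) (consider 4)))))) nop

/-- Compute one table cell and advance to the next. -/
def cell : Prog :=
  .seq (block [.add 30 22 23, .const 27 0, .rcopy 1 4])
    (.seq (.ite (.lt 30 0) (.seq tryLower (.seq tryBottom tryTop))
      (.seq (block [.add 30 20 21])
        (.ite (.lt 30 10) nop (.ite (.lt 10 30) nop (block [.const 27 1])))))
      (block [.store 16 27, .rstore 16 1, .add 16 16 2]))

/-- The part of the invariant of the loops that does not depend on their counters: the first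
`N` cells of the table are filled. -/
structure Filled (n m : ℕ) (F : ℕ → ℝ) (N : ℕ) (s : State) : Prop where
  consts : Consts n m s.reg
  rzero : s.rreg 4 = 0
  low : ∀ a < 2 * m + 2 * n, s.mem a = 0
  table : ∀ a ≤ m, s.rmem a = F a
  addr : s.reg 16 = 2 * m + 2 * n + N
  below : TableBelow n m F N s.mem s.rmem

theorem Filled.congr {n m : ℕ} {F : ℕ → ℝ} {N : ℕ} {s s' : State} (h : Filled n m F N s)
    (hR : ∀ x ≤ 16, s'.reg x = s.reg x) (h4 : s'.rreg 4 = s.rreg 4) (hm : s'.mem = s.mem)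
    (hr : s'.rmem = s.rmem) : Filled n m F N s' where
  consts := h.consts.congr fun x hx => hR x (by omega)
  rzero := h4.trans h.rzero
  low := by
    rw [hm]
    exact h.low
  table := by
    rw [hr]
    exact h.table
  addr := (hR 16 le_rfl).trans h.addr
  below := by
    rw [hm, hr]
    exact h.below

theorem Filled.setReg {n m : ℕ} {F : ℕ → ℝ} {N : ℕ} {s : State} (h : Filled n m F N s) {x : ℕ}
    (hx : 16 < x) (v : ℕ) : Filled n m F N (s.setReg x v) :=
  h.congr (fun y hy => by simp [State.setReg, show y ≠ x by omega]) rfl rfl rfl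

/-- The invariant of the innermost loop. -/
structure AtCell (n m : ℕ) (F : ℕ → ℝ) (kb lb r A T : ℕ) (s : State) : Prop where
  filled : Filled n m F (idx n m kb lb r A T) s
  r17 : s.reg 17 = kb
  r18 : s.reg 18 = lb
  r19 : s.reg 19 = r
  r20 : s.reg 20 = A
  r21 : s.reg 21 = T
  r22 : s.reg 22 = n - kb
  r23 : s.reg 23 = n - lb
  r24 : s.reg 24 = (n - kb + 1) * (n - lb)
  r25 : s.reg 25 = (n - kb + 1) * (n - 1)
  r26 : s.reg 26 = (2 * m + 1) * r
  r32 : s.reg 32 = n - kb + 1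

section Cell

variable {n m : ℕ} {F : ℕ → ℝ} {kb lb r A T : ℕ} {s₀ s : State} {X : ℕ → ℝ → Prop}

theorem Scan.setScratch (hs : Scan s₀ X s) {s' : State}
    (h : ∀ x, x ≠ 28 → x ≠ 30 → x ≠ 33 → s'.reg x = s.reg x) (hm : s'.mem = s.mem)
    (hr : s'.rmem = s.rmem) (ha : ∀ a, a ≠ 3 → s'.rreg a = s.rreg a) : Scan s₀ X s' where
  agree x h1 h2 h3 h4 h5 := (h x h2 h4 h5).trans (hs.agree x h1 h2 h3 h4 h5)
  mem := hm.trans hs.mem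
  rmem := hr.trans hs.rmem
  rzero := (ha 4 (by norm_num)).trans hs.rzero
  best := by
    rw [h 27 (by norm_num) (by norm_num) (by norm_num), ha 1 (by norm_num)]
    exact hs.best

theorem runs_tryLower (h : AtCell n m F kb lb r A T s₀) (hkb : kb ≤ n) (hlb : lb ≤ n) (hr : r ≤ m)
    (hA : A ≤ 2 * m) (hT : T ≤ 2 * m) (hs : Scan s₀ X s) :
    Runs tryLower s 15 (Scan s₀ fun i v => X i v ∨
      (i = 2 ∧ 0 < r ∧ Path n m F (n - kb) (n - lb) (r - 1) A T v)) := by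
  have e11 : s.reg 11 = 0 := by rw [hs.agree] <;> norm_num [h.filled.consts.r11]
  have e19 : s.reg 19 = r := by rw [hs.agree] <;> norm_num [h.r19]
  have e16 : s.reg 16 = 2 * m + 2 * n + idx n m kb lb r A T := by
    rw [hs.agree] <;> norm_num [h.filled.addr]
  have e6 : s.reg 6 = (2 * m + 1) * (2 * m + 1) := by
    rw [hs.agree] <;> norm_num [h.filled.consts.r6]
  refine Runs.ite (K := 14) (fun hc => ?_) (fun hc => ?_)
  · have hpos : 0 < r := by simpa [Test.Holds, e11, e19] using hc
    obtain ⟨q, rfl⟩ : ∃ q, r = q + 1 := ⟨r - 1, by omega⟩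
    refine Runs.block_seq (K := 11) ?_ (by simp)
    rintro s' hs'
    have hsc : Scan s₀ X s' := by
      refine hs.setScratch ?_ (by rw [hs']; rfl) (by rw [hs']; rfl) ?_
      · intro x h1 h2 h3
        simp [hs', effect, Instr.apply, h1]
      · intro a h1
        simp [hs', effect, Instr.apply, h1]
    have e28 : s'.reg 28 = 2 * m + 2 * n + idx n m kb lb q A T := by
      have := idx_lower n m kb lb q A T
      simp only [hs', effect, Instr.apply, Function.update_self, e16, e6]
      omega
    have hZ := h.filled.below kb lb q A T hkb hlb (by omega) hA hT (by
      rw [← idx_lower n m kb lb q A T]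
      have : 0 < (2 * m + 1) * (2 * m + 1) := by positivity
      omega)
    rw [← e28] at hZ
    have e3 : s'.rreg 3 = 0 := by simp [hs', effect, Instr.apply, hs.rzero]
    refine (runs_consider hsc h.filled.consts.r11 (by norm_num) e3 hZ).mono le_rfl
      fun s'' hs'' => hs''.congr fun i w => or_congr_right ?_
    simp only [← path_iff_firstMove, add_zero, exists_eq_right', Nat.add_sub_cancel]
    tauto
  · have hpos : ¬ 0 < r := by simpa [Test.Holds, e11, e19] using hc
    refine runs_nop (hs.congr fun i w => ?_) (by norm_num)
    tauto

theorem runs_tryBottom (h : AtCell n m F kb lb r A T s₀) (hkb : kb ≤ n) (hlb : lb ≤ n) (hr : r ≤ m)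
    (hA : A ≤ 2 * m) (hlt : n - kb + (n - lb) < n) (hs : Scan s₀ X s) :
    Runs tryBottom s 19 (Scan s₀ fun i v => X i v ∨
      (i = 3 ∧ n - kb ≤ r ∧ T + (n - kb) ≤ 2 * m ∧
        ∃ w, Path n m F (n - kb) (n - lb + 1) r A (T + (n - kb)) w ∧ v = w + F (n - kb))) := by
  have e22 : s.reg 22 = n - kb := by rw [hs.agree] <;> norm_num [h.r22]
  have e19 : s.reg 19 = r := by rw [hs.agree] <;> norm_num [h.r19]
  have e21 : s.reg 21 = T := by rw [hs.agree] <;> norm_num [h.r21]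
  have e10 : s.reg 10 = 2 * m := by rw [hs.agree] <;> norm_num [h.filled.consts.r10]
  have e16 : s.reg 16 = 2 * m + 2 * n + idx n m kb lb r A T := by
    rw [hs.agree] <;> norm_num [h.filled.addr]
  have e7 : s.reg 7 = (2 * m + 1) * (2 * m + 1) * (m + 1) := by
    rw [hs.agree] <;> norm_num [h.filled.consts.r7]
  refine Runs.ite (K := 18) (fun hc => ?_) (fun hc => ?_)
  · have hc' : r < n - kb := by simpa [Test.Holds, e19, e22] using hc
    refine runs_nop (hs.congr fun i w => ?_) (by norm_num)
    have : ¬ n - kb ≤ r := by omega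
    tauto
  have hc' : n - kb ≤ r := by simpa [Test.Holds, e19, e22] using hc
  refine Runs.block_seq (K := 16) ?_ (by simp)
  rintro s₁ hs₁
  have hsc₁ : Scan s₀ X s₁ := by
    refine hs.setScratch ?_ (by rw [hs₁]; rfl) (by rw [hs₁]; rfl) ?_
    · intro x h1 h2 h3
      simp [hs₁, effect, Instr.apply, h2]
    · intro a h1
      simp [hs₁, effect, Instr.apply]
  have e30 : s₁.reg 30 = T + (n - kb) := by simp [hs₁, effect, Instr.apply, e21, e22]
  have old : ∀ x, x ≠ 30 → s₁.reg x = s.reg x := by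
    intro x hx
    simp [hs₁, effect, Instr.apply, hx]
  refine Runs.ite (K := 15) (fun hd => ?_) (fun hd => ?_)
  · have hd' : 2 * m < T + (n - kb) := by simpa [Test.Holds, e30, old, e10] using hd
    refine runs_nop (hsc₁.congr fun i w => ?_) (by norm_num)
    have : ¬ T + (n - kb) ≤ 2 * m := by omega
    tauto
  have hd' : T + (n - kb) ≤ 2 * m := by simpa [Test.Holds, e30, old, e10] using hd
  obtain ⟨q, rfl⟩ : ∃ q, lb = q + 1 := ⟨lb - 1, by omega⟩
  refine Runs.block_seq (K := 11) ?_ (by simp)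
  rintro s' hs'
  have hsc : Scan s₀ X s' := by
    refine hsc₁.setScratch ?_ (by rw [hs']; rfl) (by rw [hs']; rfl) ?_
    · intro x h1 h2 h3
      simp [hs', effect, Instr.apply, h1]
    · intro a h1
      simp [hs', effect, Instr.apply, h1]
  have hidx := idx_bottom n m kb q r A T (n - kb)
  -- The increase of the last coordinate, at most `r ≤ m`, is smaller than the stride, so the target
  -- precedes the current cell and is already filled.
  have hkD : n - kb < (2 * m + 1) * (2 * m + 1) * (m + 1) := by nlinarith
  have e28 : s'.reg 28 = 2 * m + 2 * n + idx n m kb q r A (T + (n - kb)) := by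
    have : s'.reg 28 = s.reg 16 - s.reg 7 + s.reg 22 := by
      simp [hs', effect, Instr.apply, old]
    rw [this, e16, e7, e22]
    have h2 : (2 * m + 1) * (2 * m + 1) * (m + 1) ≤ idx n m kb (q + 1) r A T := by
      have h3 : idx n m kb (q + 1) r A T =
          idx n m kb q r A T + (2 * m + 1) * (2 * m + 1) * (m + 1) := by
        unfold idx
        ring
      omega
    omega
  have hZ := h.filled.below kb q r A (T + (n - kb)) hkb (by omega) hr hA hd' (by omega)
  rw [← e28] at hZ
  have e3 : s'.rreg 3 = F (n - kb) := by
    have : s'.rreg 3 = s₁.rmem (s₁.reg 22) := by simp [hs', effect, Instr.apply]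
    rw [this, hsc₁.rmem, old 22 (by norm_num), e22, h.filled.table _ (by omega)]
  refine (runs_consider hsc h.filled.consts.r11 (by norm_num) e3 hZ).mono le_rfl
    fun s'' hs'' => hs''.congr fun i w => or_congr_right ?_
  simp only [← path_iff_firstMove]
  rw [show n - (q + 1) + 1 = n - q by omega]
  tauto

theorem runs_tryTop (h : AtCell n m F kb lb r A T s₀) (hkb : kb ≤ n) (hlb : lb ≤ n) (hr : r ≤ m)
    (hT : T ≤ 2 * m) (hlt : n - kb + (n - lb) < n) (hs : Scan s₀ X s) :
    Runs tryTop s 23 (Scan s₀ fun i v => X i v ∨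
      (i = 4 ∧ n - kb < r ∧ A + r ≤ 2 * m ∧
        A + r + (n - kb + 1) * (n - lb) ≤ (n - kb + 1) * (n - 1) + T ∧
        ∃ w, Path n m F (n - kb + 1) (n - lb) r (A + r) T w ∧ v = w + F r)) := by
  have e22 : s.reg 22 = n - kb := by rw [hs.agree] <;> norm_num [h.r22]
  have e19 : s.reg 19 = r := by rw [hs.agree] <;> norm_num [h.r19]
  have e20 : s.reg 20 = A := by rw [hs.agree] <;> norm_num [h.r20]
  have e21 : s.reg 21 = T := by rw [hs.agree] <;> norm_num [h.r21]
  have e24 : s.reg 24 = (n - kb + 1) * (n - lb) := by rw [hs.agree] <;> norm_num [h.r24]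
  have e25 : s.reg 25 = (n - kb + 1) * (n - 1) := by rw [hs.agree] <;> norm_num [h.r25]
  have e26 : s.reg 26 = (2 * m + 1) * r := by rw [hs.agree] <;> norm_num [h.r26]
  have e10 : s.reg 10 = 2 * m := by rw [hs.agree] <;> norm_num [h.filled.consts.r10]
  have e16 : s.reg 16 = 2 * m + 2 * n + idx n m kb lb r A T := by
    rw [hs.agree] <;> norm_num [h.filled.addr]
  have e8 : s.reg 8 = (2 * m + 1) * (2 * m + 1) * (m + 1) * (n + 1) := by
    rw [hs.agree] <;> norm_num [h.filled.consts.r8]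
  refine Runs.ite (K := 22) (fun hc => ?_) (fun hc => ?_)
  swap
  · have hc' : ¬ n - kb < r := by simpa [Test.Holds, e19, e22] using hc
    refine runs_nop (hs.congr fun i w => ?_) (by norm_num)
    tauto
  have hc' : n - kb < r := by simpa [Test.Holds, e19, e22] using hc
  refine Runs.block_seq (K := 20) ?_ (by simp)
  rintro s₁ hs₁
  have hsc₁ : Scan s₀ X s₁ := by
    refine hs.setScratch ?_ (by rw [hs₁]; rfl) (by rw [hs₁]; rfl) ?_
    · intro x h1 h2 h3
      simp [hs₁, effect, Instr.apply, h2]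
    · intro a h1
      simp [hs₁, effect, Instr.apply]
  have e30 : s₁.reg 30 = A + r := by simp [hs₁, effect, Instr.apply, e20, e19]
  have old : ∀ x, x ≠ 30 → s₁.reg x = s.reg x := by
    intro x hx
    simp [hs₁, effect, Instr.apply, hx]
  refine Runs.ite (K := 19) (fun hd => ?_) (fun hd => ?_)
  · have hd' : 2 * m < A + r := by simpa [Test.Holds, e30, old, e10] using hd
    refine runs_nop (hsc₁.congr fun i w => ?_) (by norm_num)
    have : ¬ A + r ≤ 2 * m := by omega
    tauto
  have hd' : A + r ≤ 2 * m := by simpa [Test.Holds, e30, old, e10] using hd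
  refine Runs.block_seq (K := 16) ?_ (by simp)
  rintro s₂ hs₂
  have hsc₂ : Scan s₀ X s₂ := by
    refine hsc₁.setScratch ?_ (by rw [hs₂]; rfl) (by rw [hs₂]; rfl) ?_
    · intro x h1 h2 h3
      simp [hs₂, effect, Instr.apply, h2, h3]
    · intro a h1
      simp [hs₂, effect, Instr.apply]
  have f30 : s₂.reg 30 = A + r + (n - kb + 1) * (n - lb) := by
    simp [hs₂, effect, Instr.apply, e30, old, e24]
  have f33 : s₂.reg 33 = (n - kb + 1) * (n - 1) + T := by
    simp [hs₂, effect, Instr.apply, old, e25, e21]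
  have old₂ : ∀ x, x ≠ 30 → x ≠ 33 → s₂.reg x = s.reg x := by
    intro x hx hx'
    simp [hs₂, effect, Instr.apply, hx, hx', old]
  refine Runs.ite (K := 15) (fun he => ?_) (fun he => ?_)
  · have he' : s₂.reg 33 < s₂.reg 30 := he
    rw [f30, f33] at he'
    refine runs_nop (hsc₂.congr fun i w => ?_) (by norm_num)
    have := not_le.2 he'
    tauto
  have he' : s₂.reg 30 ≤ s₂.reg 33 := not_lt.1 he
  rw [f30, f33] at he'
  obtain ⟨q, rfl⟩ : ∃ q, kb = q + 1 := ⟨kb - 1, by omega⟩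
  refine Runs.block_seq (K := 11) ?_ (by simp)
  rintro s' hs'
  have hsc : Scan s₀ X s' := by
    refine hsc₂.setScratch ?_ (by rw [hs']; rfl) (by rw [hs']; rfl) ?_
    · intro x h1 h2 h3
      simp [hs', effect, Instr.apply, h1]
    · intro a h1
      simp [hs', effect, Instr.apply, h1]
  have hidx := idx_top n m q lb r A T
  -- As for the bottom move, the step back by a stride outweighs the increase of `A` by `r`.
  have hrD : (2 * m + 1) * r < (2 * m + 1) * (2 * m + 1) * (m + 1) * (n + 1) := by
    calc (2 * m + 1) * r < (2 * m + 1) * (2 * m + 1) :=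
          Nat.mul_lt_mul_of_pos_left (by omega) (by omega)
      _ ≤ (2 * m + 1) * (2 * m + 1) * ((m + 1) * (n + 1)) := Nat.le_mul_of_pos_right _ (by positivity)
      _ = _ := by ring
  have e28 : s'.reg 28 = 2 * m + 2 * n + idx n m q lb r (A + r) T := by
    have : s'.reg 28 = s.reg 16 - s.reg 8 + s.reg 26 := by
      simp [hs', effect, Instr.apply, old₂]
    rw [this, e16, e8, e26]
    have h2 : (2 * m + 1) * (2 * m + 1) * (m + 1) * (n + 1) ≤ idx n m (q + 1) lb r A T := by
      have h3 : idx n m (q + 1) lb r A T =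
          idx n m q lb r A T + (2 * m + 1) * (2 * m + 1) * (m + 1) * (n + 1) := by
        unfold idx
        ring
      omega
    omega
  have hZ := h.filled.below q lb r (A + r) T (by omega) hlb hr hd' hT (by omega)
  rw [← e28] at hZ
  have e3 : s'.rreg 3 = F r := by
    have : s'.rreg 3 = s₂.rmem (s₂.reg 19) := by simp [hs', effect, Instr.apply]
    rw [this, hsc₂.rmem, old₂ 19 (by norm_num) (by norm_num), e19, h.filled.table _ (by omega)]
  refine (runs_consider hsc h.filled.consts.r11 (by norm_num) e3 hZ).mono le_rfl
    fun s'' hs'' => hs''.congr fun i w => or_congr_right ?_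
  simp only [← path_iff_firstMove]
  rw [show n - (q + 1) + 1 = n - q by omega] at *
  tauto

end Cell

end DegSeq

namespace DegSeq

open RAM

theorem firstMove_iff_of_lt {n m : ℕ} {F : ℕ → ℝ} {k l r A T j : ℕ} {v : ℝ} (h : k + l < n) :
    FirstMove n m F k l r A T j v ↔
      ((False ∨ (j = 2 ∧ 0 < r ∧ Path n m F k l (r - 1) A T v)) ∨
        (j = 3 ∧ k ≤ r ∧ T + k ≤ 2 * m ∧ ∃ w, Path n m F k (l + 1) r A (T + k) w ∧ v = w + F k)) ∨
      (j = 4 ∧ k < r ∧ A + r ≤ 2 * m ∧ A + r + (k + 1) * l ≤ (k + 1) * (n - 1) + T ∧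
        ∃ w, Path n m F (k + 1) l r (A + r) T w ∧ v = w + F r) := by
  have : ¬ n ≤ k + l := by omega
  simp only [FirstMove, h, this, true_and, false_and, and_false, false_or, or_assoc]

theorem firstMove_iff_of_le {n m : ℕ} {F : ℕ → ℝ} {k l r A T j : ℕ} {v : ℝ} (h : n ≤ k + l) :
    FirstMove n m F k l r A T j v ↔ j = 1 ∧ A + T = 2 * m ∧ v = 0 := by
  have : ¬ k + l < n := by omega
  simp only [FirstMove, h, this, true_and, false_and, and_false, or_false]

/-- Positivity of `m` puts the base address `2 * m + 2 * n` beyond the real cells `0, …, m` that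
hold `f`, so writing values never damages the input. -/
theorem runs_cell {n m : ℕ} {F : ℕ → ℝ} {kb lb r A T : ℕ} {s : State} (hm : 0 < m)
    (h : AtCell n m F kb lb r A T s)
    (hkb : kb ≤ n) (hlb : lb ≤ n) (hr : r ≤ m) (hA : A ≤ 2 * m) (hT : T ≤ 2 * m) :
    Runs cell s 66 fun s' => AtCell n m F kb lb r A (T + 1) (s'.setReg 21 (T + 1)) ∧
      s'.reg 21 = T ∧ s'.reg 2 = 1 := by
  have hc := h.filled.consts
  refine Runs.block_seq (K := 62) ?_ (by simp)
  rintro s₁ hs₁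
  have f30 : s₁.reg 30 = n - kb + (n - lb) := by simp [hs₁, effect, Instr.apply, h.r22, h.r23]
  have old : ∀ x, x ≠ 27 → x ≠ 30 → s₁.reg x = s.reg x := by
    intro x hx hx'
    simp [hs₁, effect, Instr.apply, hx, hx']
  have hsc : Scan s (fun _ _ => False) s₁ := by
    refine ⟨fun x h1 h2 h3 h4 h5 => old x h1 h4, by simp [hs₁, effect, Instr.apply],
      by simp [hs₁, effect, Instr.apply], by simp [hs₁, effect, Instr.apply, h.filled.rzero],
      Or.inl ⟨by simp [hs₁, effect, Instr.apply], by simp⟩⟩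
  have hmid : Runs (.ite (.lt 30 0) (.seq tryLower (.seq tryBottom tryTop))
      (.seq (block [.add 30 20 21])
        (.ite (.lt 30 10) nop (.ite (.lt 10 30) nop (block [.const 27 1]))))) s₁ 58
      (Scan s (FirstMove n m F (n - kb) (n - lb) r A T)) := by
    -- The budget `57` is `15 + 19 + 23` for the three kinds of moves.
    refine Runs.ite (K := 57) (fun hlt => ?_) (fun hlt => ?_)
    · have hlt' : n - kb + (n - lb) < n := by
        simpa [Test.Holds, f30, old, hc.r0] using hlt
      refine (runs_tryLower h hkb hlb hr hA hT hsc).seq (K₂ := 42) (fun s₂ hs₂ => ?_) le_rfl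
      refine (runs_tryBottom h hkb hlb hr hA hlt' hs₂).seq (K₂ := 23) (fun s₃ hs₃ => ?_) le_rfl
      exact (runs_tryTop h hkb hlb hr hT hlt' hs₃).mono le_rfl fun s₄ hs₄ =>
        hs₄.congr fun i w => firstMove_iff_of_lt hlt'
    · have hle : n ≤ n - kb + (n - lb) := by
        simpa [Test.Holds, f30, old, hc.r0] using hlt
      refine Runs.block_seq (K := 4) ?_ (by simp)
      rintro s₂ hs₂
      have old₂ : ∀ x, x ≠ 27 → x ≠ 30 → s₂.reg x = s.reg x := by
        intro x hx hx'
        simp [hs₂, effect, Instr.apply, hx', old x hx hx']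
      have e30 : s₂.reg 30 = A + T := by
        simp [hs₂, effect, Instr.apply, old, h.r20, h.r21]
      have hsc₂ : Scan s (fun _ _ => False) s₂ := by
        refine hsc.setScratch ?_ (by rw [hs₂]; rfl) (by rw [hs₂]; rfl) ?_
        · intro x h1 h2 h3
          simp [hs₂, effect, Instr.apply, h2]
        · intro a h1
          simp [hs₂, effect, Instr.apply]
      have hnone : A + T ≠ 2 * m → Scan s (FirstMove n m F (n - kb) (n - lb) r A T) s₂ :=
        fun hne => hsc₂.congr fun i w => by
          rw [firstMove_iff_of_le hle]
          tauto
      refine Runs.ite (K := 3) (fun h1 => ?_) (fun h1 => ?_)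
      · have h1' : A + T < 2 * m := by simpa [Test.Holds, e30, old₂, hc.r10] using h1
        exact runs_nop (hnone (by omega)) (by norm_num)
      have h1' : 2 * m ≤ A + T := by simpa [Test.Holds, e30, old₂, hc.r10] using h1
      refine Runs.ite (K := 2) (fun h2 => ?_) (fun h2 => ?_)
      · have h2' : 2 * m < A + T := by simpa [Test.Holds, e30, old₂, hc.r10] using h2
        exact runs_nop (hnone (by omega)) (by norm_num)
      have h2' : A + T ≤ 2 * m := by simpa [Test.Holds, e30, old₂, hc.r10] using h2
      have hr1 : s₂.rreg 1 = 0 := by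
        simp [hs₂, hs₁, effect, Instr.apply, h.filled.rzero]
      refine Runs.block ⟨?_, hsc₂.mem, hsc₂.rmem, hsc₂.rzero, ?_⟩ (by simp)
      · intro x h1 h2 h3 h4 h5
        simp [effect, Instr.apply, h1, old₂ x h1 h4]
      · refine Or.inr ⟨by simp [effect, Instr.apply], ?_, ?_⟩
        · rw [firstMove_iff_of_le hle]
          exact ⟨by simp [effect, Instr.apply], by omega, by simp [effect, Instr.apply, hr1]⟩
        · intro i w hw
          rw [firstMove_iff_of_le hle] at hw
          simp [effect, Instr.apply, hr1, hw.2.2]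
  refine hmid.seq (K₂ := 4) (fun s₂ hs₂ => ?_) le_rfl
  have e16 : s₂.reg 16 = 2 * m + 2 * n + idx n m kb lb r A T := by
    rw [hs₂.agree] <;> norm_num [h.filled.addr]
  have e2 : s₂.reg 2 = 1 := by rw [hs₂.agree] <;> norm_num [hc.r2]
  refine Runs.block ?_ (by simp)
  set s' := effect [.store 16 27, .rstore 16 1, .add 16 16 2] s₂ with hs'
  have hmem : s'.mem = Function.update s.mem (2 * m + 2 * n + idx n m kb lb r A T)
      (s₂.reg 27) := by
    simp [hs', effect, Instr.apply, e16, hs₂.mem]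
  have hrmem : s'.rmem = Function.update s.rmem (2 * m + 2 * n + idx n m kb lb r A T)
      (s₂.rreg 1) := by
    simp [hs', effect, Instr.apply, e16, hs₂.rmem]
  have hrreg : s'.rreg = s₂.rreg := by simp [hs', effect, Instr.apply]
  have hreg : s'.reg = Function.update s₂.reg 16
      (2 * m + 2 * n + idx n m kb lb r A T + 1) := by
    simp [hs', effect, Instr.apply, e16, e2]
  have old' : ∀ x, x ≠ 16 → x ≠ 27 → x ≠ 28 → x ≠ 29 → x ≠ 30 → x ≠ 33 → s'.reg x = s.reg x := by
    intro x h0 h1 h2 h3 h4 h5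
    rw [hreg, Function.update_of_ne h0, hs₂.agree x h1 h2 h3 h4 h5]
  have hfill : Filled n m F (idx n m kb lb r A (T + 1)) s' := by
    refine ⟨hc.congr fun x hx => old' x (by omega) (by omega) (by omega) (by omega) (by omega)
      (by omega), by rw [hrreg, hs₂.rzero], ?_, ?_, by simp [hreg, idx, Nat.add_assoc], ?_⟩
    · intro a ha
      rw [hmem, Function.update_of_ne (by omega)]
      exact h.filled.low a ha
    · intro a ha
      rw [hrmem, Function.update_of_ne (by omega)]
      exact h.filled.table a ha
    · intro kb' lb' r' A' T' h1 h2 h3 h4 h5 h6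
      rw [hmem, hrmem]
      -- Positions determine states within the coordinate bounds, so a hit on the written position
      -- is the state just computed.
      by_cases heq : idx n m kb' lb' r' A' T' = idx n m kb lb r A T
      · obtain ⟨rfl, rfl, rfl, rfl, rfl⟩ := idx_inj h2 hlb h3 hr h4 hA h5 hT heq
        rw [Function.update_self, Function.update_self]
        exact hs₂.best
      · rw [Function.update_of_ne (by omega), Function.update_of_ne (by omega)]
        have h7 : idx n m kb lb r A (T + 1) = idx n m kb lb r A T + 1 := rfl
        exact h.filled.below kb' lb' r' A' T' h1 h2 h3 h4 h5 (by omega)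
  refine ⟨⟨hfill.setReg (by norm_num) _, ?_, ?_, ?_, ?_, ?_, ?_, ?_, ?_, ?_, ?_, ?_⟩, ?_, ?_⟩
  all_goals simp [State.setReg, old', h.r17, h.r18, h.r19, h.r20, h.r21, h.r22, h.r23, h.r24, h.r25,
    h.r26, h.r32, hc.r2]

/-! ### The nested loops over all states -/

/-- Fill the cells for all `T`. -/
def fillT : Prog := forLoop 21 3 2 cell

/-- Fill the cells for all `A` and `T`. -/
def fillA : Prog := forLoop 20 3 2 fillT

/-- Fill the cells for all `r`, `A` and `T`. -/
def fillR : Prog := forLoop 19 5 2 (.seq (mul 26 3 19 31 2) fillA)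

/-- Fill the cells for all `l`, `r`, `A` and `T`. -/
def fillL : Prog := forLoop 18 4 2 (.seq (block [.sub 23 0 18]) (.seq (mul 24 32 23 31 2) fillR))

/-- Fill the table. -/
def fill : Prog :=
  forLoop 17 4 2 (.seq (block [.sub 22 0 17, .add 32 22 2]) (.seq (mul 25 32 12 31 2) fillL))

section Fill

variable {n m : ℕ} {F : ℕ → ℝ} {kb lb r A : ℕ} {s : State}

theorem runs_fillT (hm : 0 < m) (h : AtCell n m F kb lb r A 0 (s.setReg 21 0))
    (hkb : kb ≤ n) (hlb : lb ≤ n) (hr : r ≤ m) (hA : A ≤ 2 * m) :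
    Runs fillT s ((2 * m + 1) * 70) (AtCell n m F kb lb r A (2 * m + 1)) :=
  (Runs.forLoop (N := 2 * m + 1) (K := 66) (fun T s => AtCell n m F kb lb r A T s)
    (fun _ _ hs => ⟨hs.r21, hs.filled.consts.r3⟩)
    (fun T hT s hs => runs_cell hm hs hkb hlb hr hA (by omega)) h).mono (by omega) fun _ h => h

/-- The invariant of the loop over `A`. -/
structure AtA (n m : ℕ) (F : ℕ → ℝ) (kb lb r A : ℕ) (s : State) : Prop where
  filled : Filled n m F (idx n m kb lb r A 0) s
  r17 : s.reg 17 = kb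
  r18 : s.reg 18 = lb
  r19 : s.reg 19 = r
  r20 : s.reg 20 = A
  r22 : s.reg 22 = n - kb
  r23 : s.reg 23 = n - lb
  r24 : s.reg 24 = (n - kb + 1) * (n - lb)
  r25 : s.reg 25 = (n - kb + 1) * (n - 1)
  r26 : s.reg 26 = (2 * m + 1) * r
  r32 : s.reg 32 = n - kb + 1

theorem runs_fillA (hm : 0 < m) (h : AtA n m F kb lb r 0 (s.setReg 20 0))
    (hkb : kb ≤ n) (hlb : lb ≤ n) (hr : r ≤ m) :
    Runs fillA s ((2 * m + 1) * (2 * m + 1) * 80) (AtA n m F kb lb r (2 * m + 1)) := by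
  refine (Runs.forLoop (N := 2 * m + 1) (K := (2 * m + 1) * 70)
    (fun A s => AtA n m F kb lb r A s)
    (fun _ _ hs => ⟨hs.r20, hs.filled.consts.r3⟩)
    (fun A hA s hs => ?_) h).mono (by nlinarith) fun _ h => h
  refine (runs_fillT hm (s := s) (A := A) ⟨hs.filled.setReg (by norm_num) _, ?_, ?_, ?_, ?_, ?_, ?_,
    ?_, ?_, ?_, ?_, ?_⟩ hkb hlb hr (by omega)).mono le_rfl fun s' h' => ⟨⟨?_, ?_, ?_, ?_, ?_, ?_, ?_,
      ?_, ?_, ?_, ?_⟩, h'.r20, h'.filled.consts.r2⟩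
  case refine_12 =>
    -- A coordinate one past its range carries into the next one, so the end of the inner loop is
    -- the start of the next outer round. The outer loops use the same fact.
    have : idx n m kb lb r A (2 * m + 1) = idx n m kb lb r (A + 1) 0 := by
      unfold idx
      ring
    rw [← this]
    exact h'.filled.setReg (by norm_num) _
  all_goals first
    | simp [State.setReg, hs.r17, hs.r18, hs.r19, hs.r20, hs.r22, hs.r23, hs.r24, hs.r25, hs.r26,
        hs.r32]; done
    | simp [State.setReg, h'.r17, h'.r18, h'.r19, h'.r22, h'.r23, h'.r24, h'.r25, h'.r26, h'.r32]

/-- The invariant of the loop over `r`. -/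
structure AtR (n m : ℕ) (F : ℕ → ℝ) (kb lb r : ℕ) (s : State) : Prop where
  filled : Filled n m F (idx n m kb lb r 0 0) s
  r17 : s.reg 17 = kb
  r18 : s.reg 18 = lb
  r19 : s.reg 19 = r
  r22 : s.reg 22 = n - kb
  r23 : s.reg 23 = n - lb
  r24 : s.reg 24 = (n - kb + 1) * (n - lb)
  r25 : s.reg 25 = (n - kb + 1) * (n - 1)
  r32 : s.reg 32 = n - kb + 1

theorem runs_fillR (hm : 0 < m) (h : AtR n m F kb lb 0 (s.setReg 19 0))
    (hkb : kb ≤ n) (hlb : lb ≤ n) :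
    Runs fillR s ((m + 1) * ((2 * m + 1) * (2 * m + 1)) * 100) (AtR n m F kb lb (m + 1)) := by
  refine (Runs.forLoop (N := m + 1) (K := (2 * m + 1) * (2 * m + 1) * 80 + (3 * m + 3))
    (fun r s => AtR n m F kb lb r s)
    (fun _ _ hs => ⟨hs.r19, hs.filled.consts.r5⟩)
    (fun r hr s hs => ?_) h).mono (by nlinarith) fun _ h => h
  refine (Runs.mul (by norm_num) (by norm_num) (by norm_num) (by norm_num) (by norm_num)
    (by norm_num) (by norm_num) hs.filled.consts.r2).seq
    (K₂ := (2 * m + 1) * (2 * m + 1) * 80) ?_ (by have := hs.r19; omega)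
  rintro _ rfl
  refine (runs_fillA hm (r := r) (kb := kb) (lb := lb) ⟨((hs.filled.setReg (by norm_num) _).setReg
      (by norm_num) _).setReg (by norm_num) _, ?_, ?_, ?_, ?_, ?_, ?_,
    ?_, ?_, ?_, ?_⟩ hkb hlb (by omega)).mono le_rfl fun s' h' => ⟨⟨?_, ?_, ?_, ?_, ?_, ?_, ?_,
      ?_, ?_⟩, h'.r19, h'.filled.consts.r2⟩
  case refine_11 =>
    have : idx n m kb lb r (2 * m + 1) 0 = idx n m kb lb (r + 1) 0 0 := by
      unfold idx
      ring
    rw [← this]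
    exact h'.filled.setReg (by norm_num) _
  all_goals first
    | simp [State.setReg, hs.r17, hs.r18, hs.r19, hs.r22, hs.r23, hs.r24, hs.r25,
        hs.r32, hs.filled.consts.r3]; done
    | simp [State.setReg, h'.r17, h'.r18, h'.r22, h'.r23, h'.r24, h'.r25, h'.r32]

/-- The invariant of the loop over `l`. -/
structure AtL (n m : ℕ) (F : ℕ → ℝ) (kb lb : ℕ) (s : State) : Prop where
  filled : Filled n m F (idx n m kb lb 0 0 0) s
  r17 : s.reg 17 = kb
  r18 : s.reg 18 = lb
  r22 : s.reg 22 = n - kb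
  r25 : s.reg 25 = (n - kb + 1) * (n - 1)
  r32 : s.reg 32 = n - kb + 1

theorem runs_fillL (hm : 0 < m) (h : AtL n m F kb 0 (s.setReg 18 0)) (hkb : kb ≤ n) :
    Runs fillL s ((n + 1) * ((m + 1) * ((2 * m + 1) * (2 * m + 1)) * 100 + 3 * n + 7) + 2)
      (AtL n m F kb (n + 1)) := by
  refine (Runs.forLoop (N := n + 1)
    (K := (m + 1) * ((2 * m + 1) * (2 * m + 1)) * 100 + 3 * n + 5)
    (fun lb s => AtL n m F kb lb s)
    (fun _ _ hs => ⟨hs.r18, hs.filled.consts.r4⟩)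
    (fun lb hlb s hs => ?_) h).mono (by linarith) fun _ h => h
  refine Runs.block_seq (K := (m + 1) * ((2 * m + 1) * (2 * m + 1)) * 100 + 3 * n + 3) ?_
    (by simp; omega)
  rintro s₁ hs₁
  have hs₁' : s₁ = s.setReg 23 (n - lb) := by
    simp [hs₁, effect, Instr.apply, State.setReg, hs.filled.consts.r0, hs.r18]
  have hf₁ : Filled n m F (idx n m kb lb 0 0 0) s₁ := by
    rw [hs₁']
    exact hs.filled.setReg (by norm_num) _
  have e23 : s₁.reg 23 = n - lb := by simp [hs₁', State.setReg]
  refine (Runs.mul (by norm_num) (by norm_num) (by norm_num) (by norm_num) (by norm_num)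
    (by norm_num) (by norm_num) hf₁.consts.r2).seq
    (K₂ := (m + 1) * ((2 * m + 1) * (2 * m + 1)) * 100) ?_ (by omega)
  rintro _ rfl
  refine (runs_fillR hm (kb := kb) (lb := lb) ⟨((hf₁.setReg (by norm_num) _).setReg
      (by norm_num) _).setReg (by norm_num) _, ?_, ?_, ?_, ?_, ?_, ?_, ?_, ?_⟩ hkb
      (by omega)).mono le_rfl fun s' h' => ⟨⟨?_, ?_, ?_, ?_, ?_, ?_⟩, h'.r18, h'.filled.consts.r2⟩
  case refine_9 =>
    have : idx n m kb lb (m + 1) 0 0 = idx n m kb (lb + 1) 0 0 0 := by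
      unfold idx
      ring
    rw [← this]
    exact h'.filled.setReg (by norm_num) _
  all_goals first
    | simp [State.setReg, hs₁', hs.r17, hs.r18, hs.r22, hs.r25, hs.r32]; done
    | simp [State.setReg, h'.r17, h'.r22, h'.r25, h'.r32]

theorem runs_fill (hm : 0 < m) (h : Filled n m F 0 s) :
    Runs fill s ((n + 1) * (n + 1) * ((m + 1) * ((2 * m + 1) * (2 * m + 1)) * 100 + 6 * n + 20))
      (Filled n m F (idx n m (n + 1) 0 0 0 0)) := by
  refine (Runs.forLoop (N := n + 1)
    (K := (n + 1) * ((m + 1) * ((2 * m + 1) * (2 * m + 1)) * 100 + 3 * n + 7) + 3 * n + 8)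
    (fun kb s => Filled n m F (idx n m kb 0 0 0 0) s ∧ s.reg 17 = kb)
    (fun _ _ hs => ⟨hs.2, hs.1.consts.r4⟩)
    (fun kb hkb s hs => ?_) ?_).mono ?_ fun _ h => h.1
  · refine Runs.block_seq
      (K := (n + 1) * ((m + 1) * ((2 * m + 1) * (2 * m + 1)) * 100 + 3 * n + 7) + 3 * n + 5) ?_
      (by simp; omega)
    rintro s₁ hs₁
    have hs₁' : s₁ = (s.setReg 22 (n - kb)).setReg 32 (n - kb + 1) := by
      simp [hs₁, effect, Instr.apply, State.setReg, hs.1.consts.r0, hs.1.consts.r2, hs.2]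
    have hf₁ : Filled n m F (idx n m kb 0 0 0 0) s₁ := by
      rw [hs₁']
      exact (hs.1.setReg (by norm_num) _).setReg (by norm_num) _
    have e12 : s₁.reg 12 = n - 1 := hf₁.consts.r12
    refine (Runs.mul (by norm_num) (by norm_num) (by norm_num) (by norm_num) (by norm_num)
      (by norm_num) (by norm_num) hf₁.consts.r2).seq
      (K₂ := (n + 1) * ((m + 1) * ((2 * m + 1) * (2 * m + 1)) * 100 + 3 * n + 7) + 2) ?_
      (by omega)
    rintro _ rfl
    refine (runs_fillL hm (kb := kb) ⟨((hf₁.setReg (by norm_num) _).setReg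
        (by norm_num) _).setReg (by norm_num) _, ?_, ?_, ?_, ?_, ?_⟩
        (by omega)).mono le_rfl fun s' h' => ⟨⟨?_, ?_⟩, h'.r17, h'.filled.consts.r2⟩
    case refine_6 =>
      have : idx n m kb (n + 1) 0 0 0 = idx n m (kb + 1) 0 0 0 0 := by
        unfold idx
        ring
      rw [← this]
      exact h'.filled.setReg (by norm_num) _
    all_goals simp [State.setReg, hs₁', hs.2, hs.1.consts.r12]
  · refine ⟨?_, by simp [State.setReg]⟩
    have : idx n m 0 0 0 0 0 = 0 := by simp [idx]
    rw [this]
    exact h.setReg (by norm_num) _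
  · nlinarith

end Fill

end DegSeq

/-! ### Reading off an optimal sequence -/

namespace DegSeq

open RAM Finset

/-- The invariant of the loop that follows the stored moves. -/
structure Trace (n m : ℕ) (F : ℕ → ℝ) (V : ℝ) (k l r A T : ℕ) (s : State) : Prop where
  consts : Consts n m s.reg
  r16 : s.reg 16 = 2 * m + 2 * n + idx n m (n - k) (n - l) r A T
  r19 : s.reg 19 = r
  r22 : s.reg 22 = k
  r23 : s.reg 23 = l
  r26 : s.reg 26 = (2 * m + 1) * r
  r29 : s.reg 29 = s.mem (s.reg 16)
  r34 : s.reg 34 = 3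
  r35 : s.reg 35 = 4
  hr : r ≤ m
  hA : A ≤ 2 * m
  hT : T ≤ 2 * m
  below : TableBelow n m F (idx n m (n + 1) 0 0 0 0) s.mem s.rmem
  marks : ∀ a, 2 * m + n ≤ a → a < 2 * m + 2 * n → s.mem a = 0
  entries : Partial n k l r A T fun i => s.mem (2 * m + i)
  pos : 0 < s.mem (s.reg 16)
  value : ∑ i ∈ range k, F (s.mem (2 * m + i)) + ∑ i ∈ Ico (n - l) n, F (s.mem (2 * m + i)) +
    s.rmem (s.reg 16) = V
  out : s.rreg 0 = V

/-- Follow one stored move. -/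
def traceStep : Prog :=
  -- Registers `34` and `35` hold `3` and `4`, so the two tests separate the codes `2`, `3` and `4`.
  .seq (.ite (.lt 29 34)
    (block [.sub 16 16 6, .sub 19 19 2, .sub 26 26 3])
    (.ite (.lt 29 35)
      (block [.sub 16 16 7, .add 16 16 22, .sub 30 12 23, .add 30 30 10, .store 30 22, .add 23 23 2])
      (block [.sub 16 16 8, .add 16 16 26, .add 30 10 22, .store 30 19, .add 22 22 2])))
    (block [.load 29 16])

theorem idx_lt {n m kb lb r A T : ℕ} (hkb : kb ≤ n) (hlb : lb ≤ n) (hr : r ≤ m) (hA : A ≤ 2 * m)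
    (hT : T ≤ 2 * m) : idx n m kb lb r A T < idx n m (n + 1) 0 0 0 0 := by
  have step : ∀ {x X y b : ℕ}, x < X → y < b → x * b + y < X * b + 0 := by
    intro x X y b hx hy
    calc x * b + y < x * b + b := by omega
      _ = (x + 1) * b := by ring
      _ ≤ X * b + 0 := Nat.mul_le_mul_right b hx
  unfold idx
  exact step (step (step (step (by omega) (by omega)) (by omega)) (by omega)) (by omega)

/-- Bellman's principle along a stored move: the best value at the target plus the gain is a
candidate at the source, and it is no worse than the stored best, which itself goes through the
target. -/
theorem TableBelow.of_path {n m : ℕ} {F : ℕ → ℝ} {mem : ℕ → ℕ} {rmem : ℕ → ℝ}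
    (h : TableBelow n m F (idx n m (n + 1) 0 0 0 0) mem rmem) {k l r A T : ℕ} (hk : k ≤ n)
    (hl : l ≤ n) (hr : r ≤ m) (hA : A ≤ 2 * m) (hT : T ≤ 2 * m) {X : ℕ → ℝ → Prop} {j : ℕ}
    {g v w : ℝ} (hX : BestOf X j v) (hw : Path n m F k l r A T w) (hvw : v = w + g)
    (hadd : ∀ w, Path n m F k l r A T w → ∃ i, X i (w + g)) :
    0 < mem (2 * m + 2 * n + idx n m (n - k) (n - l) r A T) ∧
      rmem (2 * m + 2 * n + idx n m (n - k) (n - l) r A T) + g = v := by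
  have hb := h (n - k) (n - l) r A T (Nat.sub_le _ _) (Nat.sub_le _ _) hr hA hT
    (idx_lt (Nat.sub_le _ _) (Nat.sub_le _ _) hr hA hT)
  rw [Nat.sub_sub_self hk, Nat.sub_sub_self hl] at hb
  obtain ⟨q, hq⟩ := path_iff_firstMove.1 hw
  obtain ⟨-, h0⟩ | ⟨hpos, hmem, hmax⟩ := hb
  · exact absurd hq (h0 q w)
  refine ⟨hpos, le_antisymm ?_ ?_⟩
  · obtain ⟨i, hi⟩ := hadd _ (path_iff_firstMove.2 ⟨_, hmem⟩)
    obtain ⟨-, h0⟩ | ⟨-, -, hXmax⟩ := hX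
    · exact absurd hi (h0 _ _)
    · exact hXmax _ _ hi
  · have := hmax q w hq
    linarith

theorem TableBelow.update {n m : ℕ} {F : ℕ → ℝ} {N : ℕ} {mem : ℕ → ℕ} {rmem : ℕ → ℝ}
    (h : TableBelow n m F N mem rmem) {a : ℕ} (ha : a < 2 * m + 2 * n) (v : ℕ) :
    TableBelow n m F N (Function.update mem a v) rmem := by
  intro kb lb r A T h1 h2 h3 h4 h5 h6
  rw [Function.update_of_ne (by omega)]
  exact h kb lb r A T h1 h2 h3 h4 h5 h6

theorem update_add (mem : ℕ → ℕ) (b i v : ℕ) :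
    (fun j => Function.update mem (b + i) v (b + j)) =
      Function.update (fun j => mem (b + j)) i v := by
  funext j
  simp only [Function.update_apply]
  by_cases hj : j = i
  · simp [hj]
  · simp [hj]

/-- Each move fixes an entry or lowers `r`, so the variant drops. Top entries are written upwards
from cell `2 * m` and bottom entries downwards from `2 * m + n - 1`, so the finished sequence
occupies consecutive cells. -/
theorem runs_traceStep {n m : ℕ} {F : ℕ → ℝ} {V : ℝ} {k l r A T : ℕ} {s : State}
    (h : Trace n m F V k l r A T s) (hc : 1 < s.reg 29) :
    Runs traceStep s 11 fun s' => (∃ k l r A T, Trace n m F V k l r A T s') ∧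
      (n - s'.reg 22) + (n - s'.reg 23) + s'.reg 19 <
        (n - s.reg 22) + (n - s.reg 23) + s.reg 19 := by
  have hcs := h.consts
  have hcard := h.entries.card_le
  have hbest := h.below (n - k) (n - l) r A T (Nat.sub_le _ _) (Nat.sub_le _ _) h.hr h.hA h.hT
    (idx_lt (Nat.sub_le _ _) (Nat.sub_le _ _) h.hr h.hA h.hT)
  rw [Nat.sub_sub_self (show k ≤ n by omega), Nat.sub_sub_self (show l ≤ n by omega),
    ← h.r16, ← h.r29] at hbest
  have hmove : FirstMove n m F k l r A T (s.reg 29) (s.rmem (s.reg 16)) := by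
    obtain ⟨h0, -⟩ | ⟨-, h1, -⟩ := hbest
    · omega
    · exact h1
  refine Runs.seq (K₁ := 9) (K₂ := 2)
    (Q := fun s' => (∃ k l r A T, Trace n m F V k l r A T (s'.setReg 29 (s'.mem (s'.reg 16)))) ∧
      (n - s'.reg 22) + (n - s'.reg 23) + s'.reg 19 <
        (n - s.reg 22) + (n - s.reg 23) + s.reg 19) ?_ (fun s' hs' => Runs.block ?_ le_rfl) le_rfl
  swap
  · refine ⟨hs'.1, ?_⟩
    simpa [effect, Instr.apply] using hs'.2
  obtain ⟨hj, -⟩ | ⟨hj, hlt, hrpos, hp⟩ | ⟨hj, hlt, hkr, hTk, w, hp, hv⟩ |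
    ⟨hj, hlt, hkr, hAr, hbd, w, hp, hv⟩ := hmove
  · omega
  · refine (Runs.ite (K := 4) (fun _ => ?_) (fun hn => ?_)).mono (by norm_num) fun _ h => h
    swap
    · exact absurd (show s.reg 29 < s.reg 34 by rw [h.r34]; omega) hn
    obtain ⟨q, rfl⟩ : ∃ q, r = q + 1 := ⟨r - 1, by omega⟩
    have hq : q ≤ m := by have := h.hr; omega
    have hnext := h.below.of_path (show k ≤ n by omega) (show l ≤ n by omega) hq h.hA h.hT
      (g := 0) hbest hp (by simp) (fun w hw => path_iff_firstMove.1 (by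
        rw [add_zero]
        exact .lower hlt hw))
    rw [add_zero] at hnext
    have e16 : s.reg 16 - s.reg 6 = 2 * m + 2 * n + idx n m (n - k) (n - l) q A T := by
      have := idx_lower n m (n - k) (n - l) q A T
      rw [h.r16, hcs.r6]
      omega
    refine Runs.block ?_ (by simp)
    have hs' : effect [.sub 16 16 6, .sub 19 19 2, .sub 26 26 3] s =
        ((s.setReg 16 (2 * m + 2 * n + idx n m (n - k) (n - l) q A T)).setReg 19 q).setReg 26
          ((2 * m + 1) * q) := by
      have e26 : (2 * m + 1) * (q + 1) - (2 * m + 1) = (2 * m + 1) * q := by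
        rw [Nat.mul_succ]
        omega
      simp [effect, Instr.apply, State.setReg, e16, h.r19, hcs.r2, hcs.r3, h.r26, e26]
    rw [hs']
    refine ⟨⟨k, l, q, A, T, ?_⟩, ?_⟩
    · refine ⟨hcs.congr ?_, ?_, ?_, ?_, ?_, ?_, ?_, ?_, ?_, hq, h.hA, h.hT, h.below, h.marks,
        h.entries.lower, ?_, ?_, h.out⟩
      · intro x hx
        simp [State.setReg, show x ≠ 16 by omega, show x ≠ 19 by omega, show x ≠ 26 by omega,
          show x ≠ 29 by omega]
      case refine_10 => simpa [State.setReg] using hnext.1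
      case refine_11 => simpa [State.setReg, hnext.2] using h.value
      all_goals simp [State.setReg, h.r22, h.r23, h.r34, h.r35]
    · simp [State.setReg, h.r19]
  · refine (Runs.ite (K := 8) (fun hn => ?_) (fun _ => ?_)).mono (by norm_num) fun _ h => h
    · have : s.reg 29 < s.reg 34 := hn
      rw [h.r34] at this
      omega
    refine (Runs.ite (K := 7) (fun _ => ?_) (fun hn => ?_)).mono (by norm_num) fun _ h => h
    swap
    · exact absurd (show s.reg 29 < s.reg 35 by rw [h.r35]; omega) hn
    have hnext := h.below.of_path (show k ≤ n by omega) (show l + 1 ≤ n by omega) h.hr h.hA hTk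
      (g := F k) hbest hp hv (fun w hw => path_iff_firstMove.1 (.bottom hlt hkr hTk hw))
    have e16 : s.reg 16 - s.reg 7 + s.reg 22 =
        2 * m + 2 * n + idx n m (n - k) (n - (l + 1)) r A (T + k) := by
      have h1 := idx_bottom n m (n - k) (n - (l + 1)) r A T k
      have h3 : idx n m (n - k) (n - (l + 1) + 1) r A T =
          idx n m (n - k) (n - (l + 1)) r A T + (2 * m + 1) * (2 * m + 1) * (m + 1) := by
        unfold idx
        ring
      rw [show n - (l + 1) + 1 = n - l by omega] at h1 h3
      rw [h.r16, hcs.r7, h.r22]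
      omega
    refine Runs.block ?_ (by simp)
    set s' := effect [.sub 16 16 7, .add 16 16 22, .sub 30 12 23, .add 30 30 10, .store 30 22,
      .add 23 23 2] s with hs'
    have hmem : s'.mem = Function.update s.mem (2 * m + (n - 1 - l)) k := by
      simp [hs', effect, Instr.apply, hcs.r12, h.r23, hcs.r10, h.r22, add_comm]
    have hrmem : s'.rmem = s.rmem := by simp [hs', effect, Instr.apply]
    have hrreg : s'.rreg = s.rreg := by simp [hs', effect, Instr.apply]
    have f16 : s'.reg 16 = 2 * m + 2 * n + idx n m (n - k) (n - (l + 1)) r A (T + k) := by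
      rw [← e16]
      simp [hs', effect, Instr.apply]
    have f23 : s'.reg 23 = l + 1 := by simp [hs', effect, Instr.apply, h.r23, hcs.r2]
    have old : ∀ x, x ≠ 16 → x ≠ 23 → x ≠ 30 → s'.reg x = s.reg x := by
      intro x h1 h2 h3
      simp [hs', effect, Instr.apply, h1, h2, h3]
    have hent : (fun i => s'.mem (2 * m + i)) =
        Function.update (fun i => s.mem (2 * m + i)) (n - 1 - l) k := by
      rw [hmem]
      exact update_add _ _ _ _
    have hsame : ∀ a, a ≠ 2 * m + (n - 1 - l) → s'.mem a = s.mem a := by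
      intro a ha
      rw [hmem, Function.update_of_ne ha]
    refine ⟨⟨k, l + 1, r, A, T + k, ?_⟩, ?_⟩
    · refine ⟨hcs.congr ?_, ?_, ?_, ?_, ?_, ?_, ?_, ?_, ?_, h.hr, h.hA, hTk, ?_, ?_, ?_, ?_, ?_, ?_⟩
      · intro x hx
        simp [State.setReg, show x ≠ 29 by omega, old x (by omega) (by omega) (by omega)]
      case refine_10 =>
        show TableBelow _ _ _ _ s'.mem s'.rmem
        rw [hmem, hrmem]
        exact h.below.update (by omega) _
      case refine_11 =>
        intro a h1 h2
        show s'.mem a = 0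
        rw [hsame a (by omega)]
        exact h.marks a h1 h2
      case refine_12 =>
        show Partial _ _ _ _ _ _ fun i => s'.mem (2 * m + i)
        rw [hent]
        exact h.entries.bottom hlt
      case refine_13 =>
        have : s'.mem (s'.reg 16) = s.mem (s'.reg 16) := hsame _ (by omega)
        simp only [State.setReg, Function.update_of_ne (show (16 : ℕ) ≠ 29 by norm_num), this]
        rw [f16]
        exact hnext.1
      case refine_14 =>
        simp only [State.setReg, Function.update_of_ne (show (16 : ℕ) ≠ 29 by norm_num)]
        rw [hrmem, f16, ← h.value]
        have hI : Ico (n - (l + 1)) n = insert (n - 1 - l) (Ico (n - l) n) := by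
          ext i
          simp only [mem_Ico, mem_insert]
          omega
        have hnm : n - 1 - l ∉ Ico (n - l) n := by
          simp only [mem_Ico]
          omega
        rw [hI, sum_insert hnm, sum_congr rfl (s₂ := range k) fun i hi => by
          rw [hsame _ (by rw [mem_range] at hi; omega)],
          sum_congr rfl (s₂ := Ico (n - l) n) fun i hi => by
          rw [hsame _ (by rw [mem_Ico] at hi; omega)], hmem, Function.update_self, ← hnext.2]
        ring
      case refine_15 =>
        show s'.rreg 0 = V
        rw [hrreg, h.out]
      all_goals simp [State.setReg, old, f16, f23, h.r19, h.r22, h.r26, h.r34, h.r35]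
    · rw [f23, old 22 (by norm_num) (by norm_num) (by norm_num),
        old 19 (by norm_num) (by norm_num) (by norm_num), h.r23]
      omega
  · refine (Runs.ite (K := 8) (fun hn => ?_) (fun _ => ?_)).mono (by norm_num) fun _ h => h
    · have : s.reg 29 < s.reg 34 := hn
      rw [h.r34] at this
      omega
    refine (Runs.ite (K := 7) (fun hn => ?_) (fun _ => ?_)).mono (by norm_num) fun _ h => h
    · have : s.reg 29 < s.reg 35 := hn
      rw [h.r35] at this
      omega
    have hnext := h.below.of_path (show k + 1 ≤ n by omega) (show l ≤ n by omega) h.hr hAr h.hT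
      (g := F r) hbest hp hv (fun w hw => path_iff_firstMove.1 (.top hlt hkr hAr hbd hw))
    have e16 : s.reg 16 - s.reg 8 + s.reg 26 =
        2 * m + 2 * n + idx n m (n - (k + 1)) (n - l) r (A + r) T := by
      have h1 := idx_top n m (n - (k + 1)) (n - l) r A T
      have h3 : idx n m (n - (k + 1) + 1) (n - l) r A T =
          idx n m (n - (k + 1)) (n - l) r A T +
            (2 * m + 1) * (2 * m + 1) * (m + 1) * (n + 1) := by
        unfold idx
        ring
      rw [show n - (k + 1) + 1 = n - k by omega] at h1 h3
      rw [h.r16, hcs.r8, h.r26]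
      omega
    refine Runs.block ?_ (by simp)
    set s' := effect [.sub 16 16 8, .add 16 16 26, .add 30 10 22, .store 30 19,
      .add 22 22 2] s with hs'
    have hmem : s'.mem = Function.update s.mem (2 * m + k) r := by
      simp [hs', effect, Instr.apply, h.r19, hcs.r10, h.r22]
    have hrmem : s'.rmem = s.rmem := by simp [hs', effect, Instr.apply]
    have hrreg : s'.rreg = s.rreg := by simp [hs', effect, Instr.apply]
    have f16 : s'.reg 16 = 2 * m + 2 * n + idx n m (n - (k + 1)) (n - l) r (A + r) T := by
      rw [← e16]
      simp [hs', effect, Instr.apply]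
    have f22 : s'.reg 22 = k + 1 := by simp [hs', effect, Instr.apply, h.r22, hcs.r2]
    have old : ∀ x, x ≠ 16 → x ≠ 22 → x ≠ 30 → s'.reg x = s.reg x := by
      intro x h1 h2 h3
      simp [hs', effect, Instr.apply, h1, h2, h3]
    have hent : (fun i => s'.mem (2 * m + i)) =
        Function.update (fun i => s.mem (2 * m + i)) k r := by
      rw [hmem]
      exact update_add _ _ _ _
    have hsame : ∀ a, a ≠ 2 * m + k → s'.mem a = s.mem a := by
      intro a ha
      rw [hmem, Function.update_of_ne ha]
    refine ⟨⟨k + 1, l, r, A + r, T, ?_⟩, ?_⟩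
    · refine ⟨hcs.congr ?_, ?_, ?_, ?_, ?_, ?_, ?_, ?_, ?_, h.hr, hAr, h.hT, ?_, ?_, ?_, ?_, ?_, ?_⟩
      · intro x hx
        simp [State.setReg, show x ≠ 29 by omega, old x (by omega) (by omega) (by omega)]
      case refine_10 =>
        show TableBelow _ _ _ _ s'.mem s'.rmem
        rw [hmem, hrmem]
        exact h.below.update (by omega) _
      case refine_11 =>
        intro a h1 h2
        show s'.mem a = 0
        rw [hsame a (by omega)]
        exact h.marks a h1 h2
      case refine_12 =>
        show Partial _ _ _ _ _ _ fun i => s'.mem (2 * m + i)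
        rw [hent]
        exact h.entries.top hlt hkr hbd
      case refine_13 =>
        have : s'.mem (s'.reg 16) = s.mem (s'.reg 16) := hsame _ (by omega)
        simp only [State.setReg, Function.update_of_ne (show (16 : ℕ) ≠ 29 by norm_num), this]
        rw [f16]
        exact hnext.1
      case refine_14 =>
        simp only [State.setReg, Function.update_of_ne (show (16 : ℕ) ≠ 29 by norm_num)]
        rw [hrmem, f16, ← h.value, sum_range_succ, sum_congr rfl (s₂ := range k) fun i hi => by
          rw [hsame _ (by rw [mem_range] at hi; omega)],
          sum_congr rfl (s₂ := Ico (n - l) n) fun i hi => by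
          rw [hsame _ (by rw [mem_Ico] at hi; omega)], hmem, Function.update_self, ← hnext.2]
        ring
      case refine_15 =>
        show s'.rreg 0 = V
        rw [hrreg, h.out]
      all_goals simp [State.setReg, old, f16, f22, h.r19, h.r23, h.r26, h.r34, h.r35]
    · rw [f22, old 23 (by norm_num) (by norm_num) (by norm_num),
        old 19 (by norm_num) (by norm_num) (by norm_num), h.r22]
      omega

/-- Follow the stored moves and write the sequence into the memory. -/
def trace : Prog := .loop (.lt 2 29) traceStep

/-- The memory holds a degree sequence of a graph with `m` edges and objective value `V`. -/
structure HasSequence (n m : ℕ) (F : ℕ → ℝ) (V : ℝ) (s : State) : Prop where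
  consts : Consts n m s.reg
  marks : ∀ a, 2 * m + n ≤ a → a < 2 * m + 2 * n → s.mem a = 0
  erdosGallai : ErdosGallai fun i : Fin n => s.mem (2 * m + i)
  sum_eq : ∑ i : Fin n, s.mem (2 * m + i) = 2 * m
  value : ∑ i : Fin n, F (s.mem (2 * m + i)) = V
  out : s.rreg 0 = V

/-- The loop ends at a code of at most `1`. Code `0` is excluded by the invariant, and code `1`
means that all entries are fixed with sum `2 * m` and that nothing is missing from the value. -/
theorem runs_trace {n m : ℕ} {F : ℕ → ℝ} {V : ℝ} {s : State}
    (h : Trace n m F V 0 0 m 0 0 s) : Runs trace s ((2 * n + m) * 12 + 1) (HasSequence n m F V) := by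
  refine (Runs.loop (K := 11) (fun s => ∃ k l r A T, Trace n m F V k l r A T s)
    (fun s => (n - s.reg 22) + (n - s.reg 23) + s.reg 19) ?_ ⟨_, _, _, _, _, h⟩).mono ?_ ?_
  · rintro s ⟨k, l, r, A, T, hs⟩ hc
    refine runs_traceStep hs ?_
    have : s.reg 2 < s.reg 29 := hc
    rwa [hs.consts.r2] at this
  · show ((n - s.reg 22) + (n - s.reg 23) + s.reg 19) * 12 + 1 ≤ _
    rw [h.r22, h.r23, h.r19]
    omega
  · rintro s' ⟨⟨k, l, r, A, T, hs⟩, hc⟩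
    have hc' : ¬ s'.reg 2 < s'.reg 29 := hc
    have hpos := hs.pos
    rw [← hs.r29] at hpos
    rw [hs.consts.r2] at hc'
    have hone : s'.reg 29 = 1 := by omega
    have hcard := hs.entries.card_le
    have hbest := hs.below (n - k) (n - l) r A T (Nat.sub_le _ _) (Nat.sub_le _ _) hs.hr hs.hA hs.hT
      (idx_lt (Nat.sub_le _ _) (Nat.sub_le _ _) hs.hr hs.hA hs.hT)
    rw [Nat.sub_sub_self (show k ≤ n by omega), Nat.sub_sub_self (show l ≤ n by omega),
      ← hs.r16, ← hs.r29, hone] at hbest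
    obtain ⟨h0, -⟩ | ⟨-, h1, -⟩ := hbest
    · omega
    obtain ⟨-, hle, hsum, hval⟩ | ⟨h2, -⟩ | ⟨h2, -⟩ | ⟨h2, -⟩ := h1
    · have hkl : n - l = k := by omega
      have hsplit : ∀ {M : Type} [AddCommMonoid M] (g : ℕ → M),
          ∑ i ∈ range k, g i + ∑ i ∈ Ico (n - l) n, g i = ∑ i : Fin n, g i := by
        intro M _ g
        rw [hkl, sum_range_add_sum_Ico _ (show k ≤ n by omega), ← Fin.sum_univ_eq_sum_range]
      refine ⟨hs.consts, hs.marks, hs.entries.erdosGallai hle, ?_, ?_, hs.out⟩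
      · rw [← hsplit fun i => s'.mem (2 * m + i), hs.entries.sum_top, hs.entries.sum_bottom, hsum]
      · rw [← hsplit fun i => F (s'.mem (2 * m + i)), ← hs.value, hval, add_zero]
    all_goals omega

end DegSeq

/-! ### Building the graph -/

namespace DegSeq

open RAM Finset

/-- Compare the vertex in register `23` with the best vertex found so far. -/
def scanStep : Prog :=
  .seq (block [.add 30 10 23, .load 24 30])
    (.seq (.ite (.lt 21 24)
      (.seq (block [.add 30 13 23, .load 26 30])
        (.ite (.lt 26 27) (block [.copy 21 24, .copy 22 23]) nop)) nop)
      (block [.add 23 23 2]))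

/-- Join the current vertex to an unmarked vertex of maximal remaining degree, or move on to the
next vertex. -/
def joinStep : Prog :=
  .seq (block [.add 20 10 17, .load 19 20, .add 27 17 2])
    (.ite (.lt 11 19)
      (.seq (block [.const 21 0, .const 22 0, .copy 23 27])
        (.seq (.loop (.lt 23 0) scanStep)
          (block [.add 30 13 22, .store 30 27, .add 30 10 22, .sub 21 21 2, .store 30 21,
            .sub 19 19 2, .store 20 19, .store 18 17, .add 18 18 2, .store 18 22, .add 18 18 2])))
      (block [.add 17 17 2]))

/-- Build a graph with the given degree sequence. -/
def build : Prog := .seq (block [.const 17 0, .const 18 0]) (.loop (.lt 17 0) joinStep)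

/-- The invariant of the search for a vertex of maximal remaining degree. -/
structure Search (n m v : ℕ) (s₀ s : State) : Prop where
  agree : ∀ x, x ≠ 21 → x ≠ 22 → x ≠ 23 → x ≠ 24 → x ≠ 26 → x ≠ 30 → s.reg x = s₀.reg x
  mem : s.mem = s₀.mem
  rreg : s.rreg = s₀.rreg
  lower : v < s.reg 23
  upper : s.reg 23 ≤ n
  max : ∀ w, v < w → w < s.reg 23 → s₀.mem (2 * m + n + w) ≤ v → s₀.mem (2 * m + w) ≤ s.reg 21
  -- The value `0` means that no candidate of positive remaining degree has been met, in which case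
  -- register `22` carries no information.
  best : s.reg 21 = 0 ∨ (v < s.reg 22 ∧ s.reg 22 < n ∧ s₀.mem (2 * m + n + s.reg 22) ≤ v ∧
    s₀.mem (2 * m + s.reg 22) = s.reg 21)

theorem runs_scanStep {n m v : ℕ} {s₀ s : State} (hc : Consts n m s₀.reg) (h27 : s₀.reg 27 = v + 1)
    (h : Search n m v s₀ s) (hlt : s.reg 23 < n) :
    Runs scanStep s 13 fun s' => Search n m v s₀ s' ∧ s'.reg 23 = s.reg 23 + 1 := by
  have e10 : s.reg 10 = 2 * m := by rw [h.agree] <;> norm_num [hc.r10]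
  have e13 : s.reg 13 = 2 * m + n := by rw [h.agree] <;> norm_num [hc.r13]
  have e2 : s.reg 2 = 1 := by rw [h.agree] <;> norm_num [hc.r2]
  have e27 : s.reg 27 = v + 1 := by rw [h.agree] <;> norm_num [h27]
  refine Runs.block_seq (K := 10) ?_ (by simp)
  rintro s₁ hs₁
  have old : ∀ x, x ≠ 24 → x ≠ 30 → s₁.reg x = s.reg x := by
    intro x h1 h2
    simp [hs₁, effect, Instr.apply, h1, h2]
  have hmem₁ : s₁.mem = s₀.mem := by
    rw [← h.mem]
    simp [hs₁, effect, Instr.apply]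
  have hrreg₁ : s₁.rreg = s₀.rreg := by
    rw [← h.rreg]
    simp [hs₁, effect, Instr.apply]
  have e24 : s₁.reg 24 = s₀.mem (2 * m + s.reg 23) := by
    rw [← h.mem]
    simp [hs₁, effect, Instr.apply, e10]
  have hkeep : ∀ s₂ : State, (∀ x, x ≠ 24 → x ≠ 26 → x ≠ 30 → s₂.reg x = s.reg x) →
      s₂.mem = s₀.mem → s₂.rreg = s₀.rreg →
      (s₀.mem (2 * m + n + s.reg 23) ≤ v → s₀.mem (2 * m + s.reg 23) ≤ s.reg 21) →
      Search n m v s₀ (s₂.setReg 23 (s.reg 23 + 1)) := by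
    intro s₂ ho hm hrr hmax
    have f21 : s₂.reg 21 = s.reg 21 := ho 21 (by norm_num) (by norm_num) (by norm_num)
    have f22 : s₂.reg 22 = s.reg 22 := ho 22 (by norm_num) (by norm_num) (by norm_num)
    refine ⟨?_, hm, hrr, ?_, ?_, ?_, ?_⟩
    · intro x h1 h2 h3 h4 h5 h6
      rw [← h.agree x h1 h2 h3 h4 h5 h6, ← ho x h4 h5 h6]
      simp [State.setReg, h3]
    · simpa [State.setReg] using h.lower.trans (Nat.lt_succ_self _)
    · simpa [State.setReg] using hlt
    · intro w hw1 hw2 hw3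
      simp only [State.setReg, Function.update_self] at hw2
      simp only [State.setReg, Function.update_of_ne (show (21 : ℕ) ≠ 23 by norm_num), f21]
      rcases Nat.lt_succ_iff_lt_or_eq.1 hw2 with hw | rfl
      · exact h.max w hw1 hw hw3
      · exact hmax hw3
    · simpa [State.setReg, f21, f22] using h.best
  have hinc : ∀ s₂ : State, s₂.reg 23 = s.reg 23 → s₂.reg 2 = 1 →
      effect [.add 23 23 2] s₂ = s₂.setReg 23 (s.reg 23 + 1) := by
    intro s₂ h1 h2
    simp [effect, Instr.apply, State.setReg, h1, h2]
  refine Runs.seq (K₁ := 8) (K₂ := 2)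
    (Q := fun s₂ => Search n m v s₀ (s₂.setReg 23 (s.reg 23 + 1)) ∧ s₂.reg 23 = s.reg 23 ∧
      s₂.reg 2 = 1) ?_ (fun s₂ hs₂ => Runs.block ?_ le_rfl) le_rfl
  swap
  · rw [hinc s₂ hs₂.2.1 hs₂.2.2]
    exact ⟨hs₂.1, by simp [State.setReg]⟩
  refine Runs.ite (K := 7) (fun hb => ?_) (fun hb => ?_)
  swap
  · have hb' : s₀.mem (2 * m + s.reg 23) ≤ s.reg 21 := by
      simpa [Test.Holds, e24, old] using hb
    refine runs_nop ⟨hkeep s₁ (fun x h1 _ h3 => old x h1 h3) hmem₁ hrreg₁ fun _ => hb', ?_, ?_⟩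
      (by norm_num)
    · simp [old]
    · simp [old, e2]
  have hb' : s.reg 21 < s₀.mem (2 * m + s.reg 23) := by
    simpa [Test.Holds, e24, old] using hb
  refine Runs.block_seq (K := 4) ?_ (by simp)
  rintro s₂ hs₂
  have old₂ : ∀ x, x ≠ 24 → x ≠ 26 → x ≠ 30 → s₂.reg x = s.reg x := by
    intro x h1 h2 h3
    simp [hs₂, effect, Instr.apply, h2, h3, old x h1 h3]
  have hmem₂ : s₂.mem = s₀.mem := by
    rw [← hmem₁]
    simp [hs₂, effect, Instr.apply]
  have hrreg₂ : s₂.rreg = s₀.rreg := by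
    rw [← hrreg₁]
    simp [hs₂, effect, Instr.apply]
  have f24 : s₂.reg 24 = s₀.mem (2 * m + s.reg 23) := by
    rw [← e24]
    simp [hs₂, effect, Instr.apply]
  have f26 : s₂.reg 26 = s₀.mem (2 * m + n + s.reg 23) := by
    rw [← hmem₁]
    simp [hs₂, effect, Instr.apply, old, e13]
  refine Runs.ite (K := 3) (fun hd => ?_) (fun hd => ?_)
  swap
  · have hd' : v + 1 ≤ s₀.mem (2 * m + n + s.reg 23) := by
      simpa [Test.Holds, f26, old₂, e27] using hd
    refine runs_nop ⟨hkeep s₂ old₂ hmem₂ hrreg₂ fun hle => by omega, ?_, ?_⟩ (by norm_num)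
    · simp [old₂]
    · simp [old₂, e2]
  have hd' : s₀.mem (2 * m + n + s.reg 23) < v + 1 := by
    simpa [Test.Holds, f26, old₂, e27] using hd
  refine Runs.block ⟨⟨?_, hmem₂, hrreg₂, ?_, ?_, ?_, ?_⟩, ?_, ?_⟩ le_rfl
  · intro x h1 h2 h3 h4 h5 h6
    rw [← h.agree x h1 h2 h3 h4 h5 h6, ← old₂ x h4 h5 h6]
    simp [State.setReg, effect, Instr.apply, h1, h2, h3]
  · simpa [State.setReg, effect, Instr.apply] using h.lower.trans (Nat.lt_succ_self _)
  · simpa [State.setReg, effect, Instr.apply] using hlt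
  · intro w hw1 hw2 hw3
    simp only [State.setReg, Function.update_self] at hw2
    have : ((effect [.copy 21 24, .copy 22 23] s₂).setReg 23 (s.reg 23 + 1)).reg 21 =
        s₀.mem (2 * m + s.reg 23) := by
      simp [State.setReg, effect, Instr.apply, f24]
    rw [this]
    rcases Nat.lt_succ_iff_lt_or_eq.1 hw2 with hw | rfl
    · exact (h.max w hw1 hw hw3).trans hb'.le
    · exact le_rfl
  · right
    have h22 : ((effect [.copy 21 24, .copy 22 23] s₂).setReg 23 (s.reg 23 + 1)).reg 22 =
        s.reg 23 := by
      simp [State.setReg, effect, Instr.apply, old₂]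
    have h21 : ((effect [.copy 21 24, .copy 22 23] s₂).setReg 23 (s.reg 23 + 1)).reg 21 =
        s₀.mem (2 * m + s.reg 23) := by
      simp [State.setReg, effect, Instr.apply, f24]
    rw [h22, h21]
    exact ⟨h.lower, hlt, by omega, rfl⟩
  · simp [effect, Instr.apply, old₂]
  · simp [effect, Instr.apply, old₂, e2]

/-- The pair `a, b` is among the first `j` pairs in the memory. -/
def Listed (mem : ℕ → ℕ) (j a b : ℕ) : Prop :=
  ∃ i < j, (mem (2 * i) = a ∧ mem (2 * i + 1) = b) ∨ (mem (2 * i) = b ∧ mem (2 * i + 1) = a)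

/-- The invariant of the construction: the graph `E` has been listed, the graph `H` is still to be
listed, and the vertices below `v` are finished. -/
structure Building (n m : ℕ) (d : Fin n → ℕ) (V : ℝ) (v j : ℕ) (E H : SimpleGraph (Fin n))
    (s : State) : Prop where
  consts : Consts n m s.reg
  r17 : s.reg 17 = v
  r18 : s.reg 18 = 2 * j
  v_le : v ≤ n
  rest : ∀ x : Fin n, s.mem (2 * m + x) = nbrs H x
  listed : ∀ a b : Fin n, E.Adj a b ↔ Listed s.mem j a b
  listed_lt : ∀ i < j, s.mem (2 * i) < n ∧ s.mem (2 * i + 1) < n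
  degrees : ∀ x, nbrs E x + nbrs H x = d x
  total : ∑ x, nbrs H x + 2 * j = 2 * m
  le_of_adj : ∀ a b, H.Adj a b → v ≤ a
  -- Edges that a swap adds to `H` have both ends above `v`, so by this field they are never edges
  -- already listed.
  lt_of_adj : ∀ a b : Fin n, E.Adj a b → (a : ℕ) ≤ v ∨ (b : ℕ) ≤ v
  -- Joining `x` to `v` sets its mark to `v + 1`. Marks become stale by themselves when `v`
  -- advances, so they never have to be cleared, and the shift by one distinguishes vertex `0` from
  -- an unset mark.
  mark_le : ∀ x : Fin n, s.mem (2 * m + n + x) ≤ v + 1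
  mark_iff : ∀ a x : Fin n, (a : ℕ) = v → a < x → (s.mem (2 * m + n + x) = v + 1 ↔ E.Adj a x)
  disjoint : ∀ a b, E.Adj a b → ¬ H.Adj a b
  out : s.rreg 0 = V

theorem runs_search {n m v : ℕ} {s₀ : State} (hc : Consts n m s₀.reg) (h27 : s₀.reg 27 = v + 1)
    (h21 : s₀.reg 21 = 0) (h23 : s₀.reg 23 = v + 1) (hv : v < n) :
    Runs (.loop (.lt 23 0) scanStep) s₀ (n * 14 + 1) fun s =>
      Search n m v s₀ s ∧ s.reg 23 = n := by
  have h0 : Search n m v s₀ s₀ := by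
    refine ⟨fun _ _ _ _ _ _ _ => rfl, rfl, rfl, by omega, by omega, ?_, Or.inl h21⟩
    intro w h1 h2
    omega
  have e0 : ∀ s, Search n m v s₀ s → s.reg 0 = n := by
    intro s hs
    rw [hs.agree] <;> norm_num [hc.r0]
  refine (Runs.loop (K := 13) (Search n m v s₀) (fun s => n - s.reg 23) ?_ h0).mono ?_ ?_
  · intro s hs hlt
    have hlt' : s.reg 23 < s.reg 0 := hlt
    rw [e0 s hs] at hlt'
    refine (runs_scanStep hc h27 hs hlt').mono le_rfl fun s' hs' => ⟨hs'.1, ?_⟩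
    have := hs'.2
    omega
  · show (n - s₀.reg 23) * 14 + 1 ≤ _
    omega
  · rintro s ⟨hs, hn⟩
    have hn' : ¬ s.reg 23 < s.reg 0 := hn
    rw [e0 s hs] at hn'
    have := hs.upper
    exact ⟨hs, by omega⟩

theorem listed_succ {mem mem' : ℕ → ℕ} {j : ℕ} (hold : ∀ a < 2 * j, mem' a = mem a) (a b : ℕ) :
    Listed mem' (j + 1) a b ↔ Listed mem j a b ∨ (mem' (2 * j) = a ∧ mem' (2 * j + 1) = b) ∨
      (mem' (2 * j) = b ∧ mem' (2 * j + 1) = a) := by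
  constructor
  · rintro ⟨i, hi, h⟩
    rcases Nat.lt_succ_iff_lt_or_eq.1 hi with hlt | rfl
    · rw [hold _ (by omega), hold _ (by omega)] at h
      exact Or.inl ⟨i, hlt, h⟩
    · exact Or.inr h
  · rintro (⟨i, hi, h⟩ | h)
    · refine ⟨i, by omega, ?_⟩
      rw [hold _ (by omega), hold _ (by omega)]
      exact h
    · exact ⟨j, by omega, h⟩

theorem nbrs_pos {n : ℕ} {H : SimpleGraph (Fin n)} {a b : Fin n} (h : H.Adj a b) :
    0 < nbrs H a := (Set.ncard_pos (Set.toFinite _)).2 ⟨b, h⟩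

/-- The unmarked vertices above `v` serve as the set `Q` of `exists_remove_max`. They contain all
neighbours of `v` in `H`, because marked vertices above `v` are already joined to `v` in `E`, which
is disjoint from `H`. Each round finishes `v` or lists an edge. -/
theorem runs_joinStep {n m : ℕ} {d : Fin n → ℕ} {V : ℝ} {v j : ℕ} {E H : SimpleGraph (Fin n)}
    {s : State} (h : Building n m d V v j E H s) (hv : v < n) :
    Runs joinStep s (n * 14 + 22) fun s' => (∃ v j E H, Building n m d V v j E H s') ∧
      (n - s'.reg 17) + (2 * m - s'.reg 18) < (n - s.reg 17) + (2 * m - s.reg 18) := by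
  have hc := h.consts
  refine Runs.block_seq (K := n * 14 + 18) ?_ (by simp; omega)
  rintro s₁ hs₁
  have old : ∀ x, x ≠ 19 → x ≠ 20 → x ≠ 27 → s₁.reg x = s.reg x := by
    intro x h1 h2 h3
    simp [hs₁, effect, Instr.apply, h1, h2, h3]
  have e20 : s₁.reg 20 = 2 * m + v := by simp [hs₁, effect, Instr.apply, hc.r10, h.r17]
  have e19 : s₁.reg 19 = s.mem (2 * m + v) := by
    simp [hs₁, effect, Instr.apply, hc.r10, h.r17]
  have e27 : s₁.reg 27 = v + 1 := by simp [hs₁, effect, Instr.apply, hc.r2, h.r17]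
  have hmem₁ : s₁.mem = s.mem := by simp [hs₁, effect, Instr.apply]
  have hrreg₁ : s₁.rreg = s.rreg := by simp [hs₁, effect, Instr.apply]
  set p : Fin n := ⟨v, hv⟩ with hp
  have hrest : s.mem (2 * m + v) = nbrs H p := h.rest p
  refine Runs.ite (K := n * 14 + 17) (fun hb => ?_) (fun hb => ?_)
  swap
  · have hzero : s.mem (2 * m + v) = 0 := by
      simpa [Test.Holds, e19, old, hc.r11] using hb
    rw [hrest] at hzero
    refine Runs.block ?_ (by simp)
    set s' := effect [.add 17 17 2] s₁ with hs'
    have f17 : s'.reg 17 = v + 1 := by simp [hs', effect, Instr.apply, old, h.r17, hc.r2]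
    have old' : ∀ x, x ≠ 17 → x ≠ 19 → x ≠ 20 → x ≠ 27 → s'.reg x = s.reg x := by
      intro x h0 h1 h2 h3
      simp [hs', effect, Instr.apply, h0, old x h1 h2 h3]
    have hmem' : s'.mem = s.mem := by
      rw [← hmem₁]
      simp [hs', effect, Instr.apply]
    have hrreg' : s'.rreg = s.rreg := by
      rw [← hrreg₁]
      simp [hs', effect, Instr.apply]
    refine ⟨⟨v + 1, j, E, H, ?_⟩, ?_⟩
    · refine ⟨hc.congr fun x hx => old' x (by omega) (by omega) (by omega) (by omega), f17,
        by rw [old' _ (by norm_num) (by norm_num) (by norm_num) (by norm_num), h.r18], hv,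
        by rw [hmem']; exact h.rest, by rw [hmem']; exact h.listed,
        by rw [hmem']; exact h.listed_lt, h.degrees, h.total, ?_, ?_, ?_, ?_, h.disjoint,
        by rw [hrreg', h.out]⟩
      · intro a b hab
        have h1 := h.le_of_adj a b hab
        rcases h1.lt_or_eq with h2 | h2
        · exact h2
        · have h3 : a = p := Fin.ext h2.symm
          have h4 := nbrs_pos hab
          rw [h3] at h4
          omega
      · intro a b hab
        have := h.lt_of_adj a b hab
        omega
      · intro x
        rw [hmem']
        exact (h.mark_le x).trans (Nat.le_succ _)
      · intro a x ha hax
        rw [hmem']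
        have h1 := h.mark_le x
        refine ⟨fun h2 => by omega, fun h2 => ?_⟩
        have h3 := h.lt_of_adj a x h2
        have h4 : (a : ℕ) < x := hax
        omega
    · rw [f17, old' 18 (by norm_num) (by norm_num) (by norm_num) (by norm_num), h.r17]
      omega
  have hpos : 0 < nbrs H p := by
    rw [← hrest]
    simpa [Test.Holds, e19, old, hc.r11] using hb
  refine Runs.block_seq (K := n * 14 + 13) ?_ (by simp; omega)
  rintro s₂ hs₂
  have old₂ : ∀ x, x ≠ 21 → x ≠ 22 → x ≠ 23 → s₂.reg x = s₁.reg x := by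
    intro x h1 h2 h3
    simp [hs₂, effect, Instr.apply, h1, h2, h3]
  have hmem₂ : s₂.mem = s.mem := by
    rw [← hmem₁]
    simp [hs₂, effect, Instr.apply]
  have hrreg₂ : s₂.rreg = s.rreg := by
    rw [← hrreg₁]
    simp [hs₂, effect, Instr.apply]
  have hc₂ : Consts n m s₂.reg := hc.congr fun x hx => by
    rw [old₂ x (by omega) (by omega) (by omega), old x (by omega) (by omega) (by omega)]
  refine (runs_search hc₂ (v := v) (by simp [old₂, e27]) (by simp [hs₂, effect, Instr.apply])
    (by simp [hs₂, effect, Instr.apply, e27]) hv).seq (K₂ := 12) ?_ le_rfl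
  rintro s₃ ⟨hs₃, h23⟩
  have hmem₃ : s₃.mem = s.mem := hs₃.mem.trans hmem₂
  have hmax := hs₃.max
  have hbest := hs₃.best
  rw [hmem₂] at hmax hbest
  have keep : ∀ x, x ≠ 21 → x ≠ 22 → x ≠ 23 → x ≠ 24 → x ≠ 26 → x ≠ 30 → s₃.reg x = s₁.reg x := by
    intro x h1 h2 h3 h4 h5 h6
    rw [hs₃.agree x h1 h2 h3 h4 h5 h6, old₂ x h1 h2 h3]
  have hN : ∀ w, H.Adj p w → v < w ∧ s.mem (2 * m + n + w) ≤ v := by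
    intro w hw
    have h1 := h.le_of_adj w p hw.symm
    have h2 : (w : ℕ) ≠ v := fun he => hw.ne (Fin.ext he.symm)
    have h3 : v < w := by omega
    refine ⟨h3, ?_⟩
    have h4 := h.mark_le w
    by_contra hgt
    exact h.disjoint p w ((h.mark_iff p w rfl h3).1 (by omega)) hw
  obtain ⟨w₀, hw₀⟩ : ∃ w, H.Adj p w := by
    obtain ⟨w, hw⟩ := (Set.ncard_pos (Set.toFinite _)).1 hpos
    exact ⟨w, hw⟩
  -- A neighbour of `v` in `H` is a candidate of positive remaining degree, so the search succeeds.
  have hbpos : s₃.reg 21 ≠ 0 := by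
    have h1 := hmax w₀ (hN w₀ hw₀).1 (by rw [h23]; exact w₀.2) (hN w₀ hw₀).2
    rw [h.rest] at h1
    have h2 := nbrs_pos hw₀.symm
    omega
  obtain ⟨hvu, hun, hmark, hbd⟩ := hbest.resolve_left hbpos
  set u := s₃.reg 22 with hu
  set q : Fin n := ⟨u, hun⟩ with hq
  have hrestq : s.mem (2 * m + u) = nbrs H q := h.rest q
  have hqp : q ≠ p := fun he => by
    have : u = v := congrArg Fin.val he
    omega
  obtain ⟨H', hd', hn', ha'⟩ := exists_remove_max H (v := p) (u := q)
    (Q := {w | v < w ∧ s.mem (2 * m + n + w) ≤ v}) (by simp [hp]) ⟨hvu, hmark⟩ hN hpos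
    (fun w hw => by
      rw [← hrestq, hbd, ← h.rest]
      exact hmax w hw.1 (by rw [h23]; exact w.2) hw.2)
  have hnE : ¬ E.Adj p q := fun hE => by
    have := (h.mark_iff p q rfl hvu).2 hE
    have h1 : s.mem (2 * m + n + u) = v + 1 := this
    omega
  obtain ⟨E', hdE, haE⟩ := exists_add_edge E hqp.symm hnE
  have hsum : ∑ x, nbrs H' x + 2 = ∑ x, nbrs H x := by
    simp only [← hd', sum_add_distrib]
    simp
  have htot := h.total
  -- An edge of `H` remains, so the new pair still fits below cell `2 * m`, away from the degrees
  -- and the marks.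
  have hjm : j < m := by omega
  refine Runs.block ?_ (by simp)
  set s' := effect [.add 30 13 22, .store 30 27, .add 30 10 22, .sub 21 21 2, .store 30 21,
    .sub 19 19 2, .store 20 19, .store 18 17, .add 18 18 2, .store 18 22, .add 18 18 2] s₃ with hs'
  have g2 : s₃.reg 2 = 1 := by simp [keep, old, hc.r2]
  have g10 : s₃.reg 10 = 2 * m := by simp [keep, old, hc.r10]
  have g13 : s₃.reg 13 = 2 * m + n := by simp [keep, old, hc.r13]
  have g17 : s₃.reg 17 = v := by simp [keep, old, h.r17]
  have g18 : s₃.reg 18 = 2 * j := by simp [keep, old, h.r18]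
  have g19 : s₃.reg 19 = s.mem (2 * m + v) := by simp [keep, e19]
  have g20 : s₃.reg 20 = 2 * m + v := by simp [keep, e20]
  have g27 : s₃.reg 27 = v + 1 := by simp [keep, e27]
  have hmem' : s'.mem = Function.update (Function.update (Function.update (Function.update
      (Function.update s.mem (2 * m + n + u) (v + 1)) (2 * m + u) (s.mem (2 * m + u) - 1))
      (2 * m + v) (s.mem (2 * m + v) - 1)) (2 * j) v) (2 * j + 1) u := by
    simp [hs', effect, Instr.apply, g2, g10, g13, g17, g18, g19, g20, g27, hmem₃, hbd, ← hu]
  have f17 : s'.reg 17 = v := by simp [hs', effect, Instr.apply, g17]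
  have f18 : s'.reg 18 = 2 * (j + 1) := by
    simp [hs', effect, Instr.apply, g18, g2]
    ring
  have hrreg' : s'.rreg = s.rreg := by
    rw [← hrreg₂, ← hs₃.rreg]
    simp [hs', effect, Instr.apply]
  have old' : ∀ x < 16, s'.reg x = s.reg x := by
    intro x hx
    have h1 : s'.reg x = s₃.reg x := by
      simp [hs', effect, Instr.apply, show x ≠ 30 by omega, show x ≠ 21 by omega,
        show x ≠ 19 by omega, show x ≠ 18 by omega]
    rw [h1, keep x (by omega) (by omega) (by omega) (by omega) (by omega) (by omega),
      old x (by omega) (by omega) (by omega)]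
  have mdeg : ∀ x : Fin n, s'.mem (2 * m + x) = nbrs H' x := by
    intro x
    have hx := x.2
    have h1 := hd' x
    rw [hmem', Function.update_of_ne (by omega), Function.update_of_ne (by omega)]
    by_cases hxp : x = p
    · subst hxp
      rw [show ((p : Fin n) : ℕ) = v from rfl, Function.update_self, hrest, ← h1]
      simp [hqp.symm]
    · have hxv : (x : ℕ) ≠ v := fun he => hxp (Fin.ext he)
      rw [Function.update_of_ne (by omega)]
      by_cases hxq : x = q
      · subst hxq
        rw [show ((q : Fin n) : ℕ) = u from rfl, Function.update_self, hrestq, ← h1]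
        simp [hqp]
      · have hxu : (x : ℕ) ≠ u := fun he => hxq (Fin.ext he)
        rw [Function.update_of_ne (by omega), Function.update_of_ne (by omega), h.rest, ← h1]
        simp [hxp, hxq]
  have mmark : ∀ x : Fin n, s'.mem (2 * m + n + x) =
      if x = q then v + 1 else s.mem (2 * m + n + x) := by
    intro x
    rw [hmem', Function.update_of_ne (by omega), Function.update_of_ne (by omega),
      Function.update_of_ne (by omega), Function.update_of_ne (by omega)]
    split_ifs with hxq
    · rw [hxq]
      exact Function.update_self _ _ _
    · have hxu : (x : ℕ) ≠ u := fun he => hxq (Fin.ext he)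
      rw [Function.update_of_ne (by omega)]
  have mold : ∀ a < 2 * j, s'.mem a = s.mem a := by
    intro a ha
    rw [hmem', Function.update_of_ne (by omega), Function.update_of_ne (by omega),
      Function.update_of_ne (by omega), Function.update_of_ne (by omega),
      Function.update_of_ne (by omega)]
  have mnew : s'.mem (2 * j) = v := by
    rw [hmem', Function.update_of_ne (by omega), Function.update_self]
  have mnew' : s'.mem (2 * j + 1) = u := by rw [hmem', Function.update_self]
  refine ⟨⟨v, j + 1, E', H', ?_⟩, ?_⟩
  · refine ⟨hc.congr old', f17, f18, hv.le, mdeg, ?_, ?_, ?_, by omega, ?_, ?_, ?_, ?_, ?_,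
      by rw [hrreg', h.out]⟩
    · intro a b
      rw [haE, listed_succ mold, h.listed, mnew, mnew', hp, hq]
      simp only [Fin.ext_iff]
      constructor
      · rintro (h1 | ⟨h1, h2⟩ | ⟨h1, h2⟩)
        · exact Or.inl h1
        · exact Or.inr (Or.inl ⟨h1.symm, h2.symm⟩)
        · exact Or.inr (Or.inr ⟨h2.symm, h1.symm⟩)
      · rintro (h1 | ⟨h1, h2⟩ | ⟨h1, h2⟩)
        · exact Or.inl h1
        · exact Or.inr (Or.inl ⟨h1.symm, h2.symm⟩)
        · exact Or.inr (Or.inr ⟨h2.symm, h1.symm⟩)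
    · intro i hi
      rcases Nat.lt_succ_iff_lt_or_eq.1 hi with hlt | rfl
      · rw [mold _ (by omega), mold _ (by omega)]
        exact h.listed_lt i hlt
      · rw [mnew, mnew']
        exact ⟨hv, hun⟩
    · intro x
      rw [hdE, ← h.degrees x, ← hd' x]
      omega
    · intro a b hab
      rcases ha' a b hab with h1 | ⟨-, -, ⟨z, hz⟩, -⟩
      · exact h.le_of_adj a b h1
      · exact h.le_of_adj a z hz
    · intro a b hab
      rcases (haE a b).1 hab with h1 | ⟨rfl, rfl⟩ | ⟨rfl, rfl⟩
      · exact h.lt_of_adj a b h1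
      · exact Or.inl le_rfl
      · exact Or.inr le_rfl
    · intro x
      rw [mmark]
      split_ifs
      · exact le_rfl
      · exact h.mark_le x
    · intro a x ha hax
      obtain rfl : a = p := Fin.ext ha
      rw [mmark, haE]
      split_ifs with hxq
      · simp [hxq]
      · rw [h.mark_iff p x rfl hax]
        constructor
        · exact Or.inl
        · rintro (h1 | ⟨-, h1⟩ | ⟨h1, -⟩)
          · exact h1
          · exact absurd h1 hxq
          · exact absurd h1.symm hqp
    · intro a b hab hab'
      have key : E.Adj a b → False := by
        intro h1
        rcases ha' a b hab' with h2 | ⟨h2, h3, ⟨z, hz⟩, ⟨z', hz'⟩⟩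
        · exact h.disjoint a b h1 h2
        · have h4 := h.le_of_adj a z hz
          have h5 := h.le_of_adj b z' hz'
          have h6 : (a : ℕ) ≠ v := fun he => h2 (Fin.ext he)
          have h7 : (b : ℕ) ≠ v := fun he => h3 (Fin.ext he)
          have h8 := h.lt_of_adj a b h1
          omega
      rcases (haE a b).1 hab with h1 | ⟨rfl, rfl⟩ | ⟨rfl, rfl⟩
      · exact key h1
      · exact hn' hab'
      · exact hn' hab'.symm
  · rw [f17, f18, h.r17, h.r18]
    omega

/-- The memory lists the edges of a graph with the degrees `d`. -/
structure Built (n m : ℕ) (d : Fin n → ℕ) (V : ℝ) (E : SimpleGraph (Fin n)) (s : State) : Prop where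
  degrees : ∀ x, nbrs E x = d x
  listed : ∀ a b : Fin n, E.Adj a b ↔ Listed s.mem m a b
  listed_lt : ∀ i < m, s.mem (2 * i) < n ∧ s.mem (2 * i + 1) < n
  out : s.rreg 0 = V

/-- The invariant starts with `E` empty and `H` any realization of the sequence, which exists by the
Erdős–Gallai theorem. The program never sees `H`, only its degrees. -/
theorem runs_build {n m : ℕ} {F : ℕ → ℝ} {V : ℝ} {s : State} (h : HasSequence n m F V s) :
    Runs build s ((n + 2 * m) * (n * 14 + 23) + 4) fun s' =>
      ∃ E, Built n m (fun i => s.mem (2 * m + i)) V E s' := by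
  set d : Fin n → ℕ := fun i => s.mem (2 * m + i) with hd
  obtain ⟨G, hG⟩ := h.erdosGallai.exists_graph (by rw [h.sum_eq]; exact even_two_mul m)
  refine Runs.block_seq (K := (n + 2 * m) * (n * 14 + 23) + 1) ?_ (by simp; omega)
  rintro s₁ hs₁
  have hmem : s₁.mem = s.mem := by simp [hs₁, effect, Instr.apply]
  have h17 : s₁.reg 17 = 0 := by simp [hs₁, effect, Instr.apply]
  have h18 : s₁.reg 18 = 0 := by simp [hs₁, effect, Instr.apply]
  have h0 : Building n m d V 0 0 ⊥ G s₁ := by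
    refine ⟨h.consts.congr ?_, h17, h18, Nat.zero_le _, ?_, ?_, by simp, ?_, ?_, by simp, by simp,
      ?_, ?_, by simp, ?_⟩
    · intro x hx
      simp [hs₁, effect, Instr.apply, show x ≠ 17 by omega, show x ≠ 18 by omega]
    · intro x
      rw [hmem, hG]
    · simp [Listed]
    · intro x
      rw [hG]
      simp [nbrs, hd]
    · simp only [hG]
      rw [h.sum_eq, mul_zero, add_zero]
    · intro x
      rw [hmem, h.marks _ (by omega) (by omega)]
      omega
    · intro a x _ _
      rw [hmem, h.marks _ (by omega) (by omega)]
      simp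
    · rw [← h.out]
      simp [hs₁, effect, Instr.apply]
  refine (Runs.loop (K := n * 14 + 22) (fun s => ∃ v j E H, Building n m d V v j E H s)
    (fun s => (n - s.reg 17) + (2 * m - s.reg 18)) ?_ ⟨_, _, _, _, h0⟩).mono ?_ ?_
  · rintro s ⟨v, j, E, H, hs⟩ hc
    have hc' : s.reg 17 < s.reg 0 := hc
    rw [hs.r17, hs.consts.r0] at hc'
    exact runs_joinStep hs hc'
  · show ((n - s₁.reg 17) + (2 * m - s₁.reg 18)) * (n * 14 + 22 + 1) + 1 ≤ _
    rw [h17, h18, Nat.sub_zero, Nat.sub_zero]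
  · rintro s' ⟨⟨v, j, E, H, hs⟩, hc⟩
    have hc' : ¬ s'.reg 17 < s'.reg 0 := hc
    rw [hs.r17, hs.consts.r0] at hc'
    -- All edges of `H` have their ends at or above `v = n`, so none is left.
    have hH : ∀ x, nbrs H x = 0 := by
      intro x
      by_contra hne
      obtain ⟨w, hw⟩ := (Set.ncard_pos (Set.toFinite _)).1 (Nat.pos_of_ne_zero hne)
      have h1 := hs.le_of_adj x w hw
      have h2 := x.2
      omega
    have hjm : j = m := by
      have := hs.total
      simp only [hH, sum_const_zero] at this
      omega
    subst hjm
    refine ⟨E, fun x => ?_, hs.listed, hs.listed_lt, hs.out⟩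
    rw [← hs.degrees x, hH, add_zero]

end DegSeq

/-! ### The complete program -/

namespace DegSeq

open RAM Finset

theorem deg_eq_nbrs {n m : ℕ} (G : GraphWith n m) (i : Fin n) : deg G i = nbrs G.1 i := by
  classical
  unfold deg nbrs
  rw [← Nat.card_coe_set_eq, ← Nat.card_coe_set_eq]
  exact Nat.card_congr (G.1.incidenceSetEquivNeighborSet i)

/-- The table of `f`, extended by `0`. -/
noncomputable def table {m : ℕ} (f : Fin (m + 1) → ℝ) (x : ℕ) : ℝ :=
  if h : x < m + 1 then f ⟨x, h⟩ else 0

theorem value_eq_sum_table {n m : ℕ} (f : Fin (m + 1) → ℝ) (G : GraphWith n m) :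
    value f G = ∑ i, table f (nbrs G.1 i) := by
  refine sum_congr rfl fun i _ => ?_
  rw [← deg_eq_nbrs, table, dif_pos (deg_lt G i)]

theorem path_of_graph {n m : ℕ} (f : Fin (m + 1) → ℝ) (G : GraphWith n m) :
    Path n m (table f) 0 0 m 0 0 (value f G) := by
  have h := (erdosGallai_nbrs G.1).path (table f) (m := m) (by rw [sum_nbrs, G.2]) (S := ∅) (B := ∅)
    (X := univ) m (disjoint_empty_left _) (by simp) (by simp)
    (fun x _ => by
      rw [← deg_eq_nbrs]
      exact Nat.le_of_lt_succ (deg_lt G x))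
  rw [value_eq_sum_table]
  simpa using h

/-- The bound is crude, since the table detects the remaining infeasible cases. Its purpose is the
inequality `m ≤ n * n` used in the running time. -/
theorem isEmpty_of_lt {n m : ℕ} (h : n * n < m) : IsEmpty (GraphWith n m) := by
  refine ⟨fun G => ?_⟩
  have h1 := sum_nbrs G.1
  have h2 : ∑ x, nbrs G.1 x ≤ ∑ _x : Fin n, n := sum_le_sum fun x _ => by
    have := Set.ncard_le_card (G.1.neighborSet x)
    rwa [Nat.card_fin] at this
  rw [G.2] at h1
  simp only [sum_const, card_univ, Fintype.card_fin, smul_eq_mul] at h2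
  omega

/-- Build an optimal graph from the table. -/
def output : Prog :=
  .seq (mul 26 3 1 31 2) (.seq (block [.const 34 3, .const 35 4, .const 22 0, .const 23 0,
    .copy 19 1]) (.seq trace (.seq build (block [.const 0 1]))))

/-- Set up the constants, fill the table, and build an optimal graph if there is one. -/
def solve : Prog :=
  .seq (block [.add 10 1 1, .add 3 10 2, .add 4 0 2, .add 5 1 2, .sub 12 0 2, .add 13 10 0,
    .add 9 13 0]) (.seq (mul 6 3 3 31 2) (.seq (mul 7 6 5 31 2) (.seq (mul 8 7 4 31 2)
    (.seq (block [.copy 16 9]) (.seq fill (.seq (block [.sub 16 16 6, .load 29 16, .rload 0 16])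
      (.ite (.lt 11 29) output (block [.const 0 0]))))))))

/-- The value of the graph without edges. -/
def edgeless : Prog :=
  .seq (block [.rload 1 11]) (.seq (forLoop 16 0 2 (.instr (.radd 0 0 1))) (block [.const 0 1]))

/-- The program that solves the optimization problem. -/
def optimize : Prog :=
  .seq (block [.const 2 1, .const 11 0])
    (.ite (.lt 11 1) (.seq (mul 3 0 0 31 2) (.ite (.lt 3 1) (block [.const 0 0]) solve)) edgeless)

/-- The case `m = 0` is separate because the time bound is then linear in `n`, too little for
filling a table. The only graph has value `n * f 0`. -/
theorem runs_edgeless {n : ℕ} (f : Fin (0 + 1) → ℝ) {s : State} (h0 : s.reg 0 = n) (h2 : s.reg 2 = 1)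
    (h11 : s.reg 11 = 0) (hr : s.rreg 0 = 0) (hf : s.rmem = table f) :
    Runs edgeless s (n * 3 + 6) (Solves n 0 f) := by
  refine Runs.block_seq (K := n * 3 + 4) ?_ (by simp; omega)
  rintro s₁ hs₁
  have e1 : s₁.rreg 1 = f 0 := by
    simp [hs₁, effect, Instr.apply, h11, hf, table]
  have e0 : s₁.rreg 0 = 0 := by simp [hs₁, effect, Instr.apply, hr]
  have ereg : s₁.reg = s.reg := by simp [hs₁, effect, Instr.apply]
  refine Runs.seq (K₁ := n * 3 + 2) (K₂ := 2) (Q := fun s => s.rreg 0 = n * f 0) ?_ ?_ le_rfl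
  · refine (Runs.forLoop (N := n) (K := 1)
      (fun i s => s.reg 16 = i ∧ s.reg 0 = n ∧ s.reg 2 = 1 ∧ s.rreg 1 = f 0 ∧ s.rreg 0 = i * f 0)
      (fun i s hs => ⟨hs.1, hs.2.1⟩) ?_ ?_).mono le_rfl fun s hs => hs.2.2.2.2
    · rintro i hi s ⟨g16, g0, g2, gr1, gr0⟩
      refine ⟨_, _, .instr _ _, le_rfl, ?_, ?_, ?_⟩
      · refine ⟨by simp [State.setReg], by simp [State.setReg, Instr.apply, g0],
          by simp [State.setReg, Instr.apply, g2], by simp [State.setReg, Instr.apply, gr1], ?_⟩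
        simp [State.setReg, Instr.apply, gr0, gr1]
        ring
      · simpa [Instr.apply] using g16
      · simpa [Instr.apply] using g2
    · simp [State.setReg, ereg, h0, h2, e1, e0]
  · intro s₂ hs₂
    have hval : ∀ G : GraphWith n 0, value f G = n * f 0 := by
      intro G
      unfold value
      rw [sum_congr rfl (g := fun _ => f 0) fun i _ =>
        congrArg f (Fin.ext (Nat.lt_one_iff.1 (deg_lt G i)))]
      simp
    obtain ⟨G, hG⟩ : ∃ G : GraphWith n 0, G.1 = ⊥ := ⟨⟨⊥, by simp⟩, rfl⟩
    refine Runs.block (Or.inr ⟨by simp [effect, Instr.apply], G, ?_, ?_, ?_⟩) (by simp)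
    · intro H
      rw [hval, hval]
    · refine ⟨fun j hj => absurd hj (Nat.not_lt_zero _), fun u v h => ?_⟩
      simp [hG] at h
    · rw [hval]
      simpa [effect, Instr.apply] using hs₂

/-- The listed graph attains the value stored for the initial state, and every graph yields a path
from that state, so none does better. -/
theorem runs_output {n m : ℕ} (f : Fin (m + 1) → ℝ) {s : State} {w : ℕ}
    (h : Filled n m (table f) (idx n m (n + 1) 0 0 0 0) (s.setReg 16 w))
    (h16 : s.reg 16 = 2 * m + 2 * n + idx n m n n m 0 0) (h29 : s.reg 29 = s.mem (s.reg 16))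
    (hpos : 0 < s.reg 29) (hout : s.rreg 0 = s.rmem (s.reg 16)) :
    Runs output s (m * 3 + (2 * n + m) * 12 + (n + 2 * m) * (n * 14 + 23) + 20)
      (Solves n m f) := by
  have hc : Consts n m s.reg := h.consts.congr fun x hx => by
    simp [State.setReg, show x ≠ 16 by omega]
  have hbest := h.below n n m 0 0 le_rfl le_rfl le_rfl (Nat.zero_le _) (Nat.zero_le _)
    (idx_lt le_rfl le_rfl le_rfl (Nat.zero_le _) (Nat.zero_le _))
  change BestOf _ (s.mem _) (s.rmem _) at hbest
  rw [Nat.sub_self, ← h16, ← h29, ← hout] at hbest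
  refine (Runs.mul (by norm_num) (by norm_num) (by norm_num) (by norm_num) (by norm_num)
    (by norm_num) (by norm_num) hc.r2).seq
    (K₂ := (2 * n + m) * 12 + (n + 2 * m) * (n * 14 + 23) + 17) ?_ (by rw [hc.r1]; omega)
  rintro _ rfl
  refine Runs.block_seq (K := (2 * n + m) * 12 + (n + 2 * m) * (n * 14 + 23) + 11) ?_
    (by simp; omega)
  rintro s₁ hs₁
  have old : ∀ x, x ≠ 19 → x ≠ 22 → x ≠ 23 → x ≠ 26 → x ≠ 31 → x ≠ 34 → x ≠ 35 →
      s₁.reg x = s.reg x := by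
    intro x h1 h2 h3 h4 h5 h6 h7
    simp [hs₁, effect, Instr.apply, State.setReg, h1, h2, h3, h4, h5, h6, h7]
  have hmem : s₁.mem = s.mem := by simp [hs₁, effect, Instr.apply, State.setReg]
  have hrmem : s₁.rmem = s.rmem := by simp [hs₁, effect, Instr.apply, State.setReg]
  have hrreg : s₁.rreg = s.rreg := by simp [hs₁, effect, Instr.apply, State.setReg]
  have htr : Trace n m (table f) (s.rreg 0) 0 0 m 0 0 s₁ := by
    refine ⟨hc.congr fun x hx => old x (by omega) (by omega) (by omega) (by omega) (by omega)
      (by omega) (by omega), ?_, ?_, ?_, ?_, ?_, ?_, ?_, ?_, le_rfl, Nat.zero_le _, Nat.zero_le _,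
      ?_, ?_, Partial.init _ _ _, ?_, ?_, by rw [hrreg]⟩
    case refine_9 =>
      rw [hmem, hrmem]
      exact h.below
    case refine_10 =>
      intro a _ ha
      rw [hmem]
      exact h.low a ha
    case refine_11 =>
      rw [hmem, old 16 (by norm_num) (by norm_num) (by norm_num) (by norm_num) (by norm_num)
        (by norm_num) (by norm_num), ← h29]
      exact hpos
    case refine_12 =>
      rw [hrmem, old 16 (by norm_num) (by norm_num) (by norm_num) (by norm_num) (by norm_num)
        (by norm_num) (by norm_num), ← hout]
      simp
    case refine_1 => simp [old, h16]
    case refine_6 => simp [old, hmem, h29]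
    all_goals simp [hs₁, effect, Instr.apply, State.setReg, hc.r1, hc.r3]
  refine (runs_trace htr).seq (K₂ := (n + 2 * m) * (n * 14 + 23) + 10) (fun s₂ hs₂ => ?_) (by omega)
  refine (runs_build hs₂).seq (K₂ := 6) ?_ (by omega)
  rintro s₃ ⟨E, hE⟩
  refine Runs.block (Or.inr ⟨by simp [effect, Instr.apply], ?_⟩) (by simp)
  have hcard : E.edgeSet.ncard = m := by
    have h1 := sum_nbrs E
    simp only [hE.degrees] at h1
    have h2 := hs₂.sum_eq
    omega
  obtain ⟨G, rfl⟩ : ∃ G : GraphWith n m, G.1 = E := ⟨⟨E, hcard⟩, rfl⟩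
  have hval : value f G = s.rreg 0 := by
    rw [value_eq_sum_table, ← hs₂.value]
    exact sum_congr rfl fun i _ => by rw [hE.degrees]
  refine ⟨G, ?_, ⟨?_, ?_⟩, ?_⟩
  · intro G'
    rw [hval]
    obtain ⟨j, hj⟩ := path_iff_firstMove.1 (path_of_graph f G')
    obtain ⟨h0, -⟩ | ⟨-, -, hmax⟩ := hbest
    · omega
    · exact hmax _ _ hj
  · intro j hj
    obtain ⟨h1, h2⟩ := hE.listed_lt j hj
    exact ⟨⟨_, h1⟩, ⟨_, h2⟩, rfl, rfl, (hE.listed _ _).2 ⟨j, hj, Or.inl ⟨rfl, rfl⟩⟩⟩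
  · intro u v huv
    exact (hE.listed u v).1 huv
  · rw [hval]
    exact hE.out

/-- The main term is of order `n² m³`, and one factor `m` is replaced by `n²`. The other terms are
dominated by `n³` or `n² m`, using that `n` and `m` are positive. -/
theorem solve_cost {n m : ℕ} (hm : 0 < m) (hmn : m ≤ n * n) :
    (n + 1) * (n + 1) * ((m + 1) * ((2 * m + 1) * (2 * m + 1)) * 100 + 6 * n + 20) +
      (m * 3 + (2 * n + m) * 12 + (n + 2 * m) * (n * 14 + 23) + 20) + 9 * m + 3 * n + 50 ≤
      10000 * (n ^ 5 * m ^ 2) := by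
  have hn : 0 < n := by
    rcases Nat.eq_zero_or_pos n with rfl | h
    · omega
    · exact h
  have h1 : (n + 1) * (n + 1) ≤ 4 * (n * n) := by nlinarith
  have h2 : (m + 1) * ((2 * m + 1) * (2 * m + 1)) ≤ 18 * (m * m * m) := by
    calc (m + 1) * ((2 * m + 1) * (2 * m + 1)) ≤ (2 * m) * ((3 * m) * (3 * m)) := by
          gcongr <;> omega
      _ = _ := by ring
  have h3 : (n + 1) * (n + 1) * ((m + 1) * ((2 * m + 1) * (2 * m + 1)) * 100 + 6 * n + 20) ≤
      4 * (n * n) * (18 * (m * m * m) * 100 + 26 * n) := by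
    refine Nat.mul_le_mul h1 ?_
    omega
  have h4 : n * n * (m * m * m) ≤ n ^ 5 * m ^ 2 := by
    calc n * n * (m * m * m) ≤ n * n * (m * m * (n * n)) := by gcongr
      _ = n ^ 4 * m ^ 2 := by ring
      _ ≤ n ^ 5 * m ^ 2 := Nat.mul_le_mul_right _ (Nat.pow_le_pow_right hn (by norm_num))
  have h5 : n * n * n ≤ n ^ 5 * m ^ 2 := by
    calc n * n * n = n ^ 3 * 1 := by ring
      _ ≤ n ^ 5 * m ^ 2 := Nat.mul_le_mul (Nat.pow_le_pow_right hn (by norm_num))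
        (Nat.one_le_pow _ _ hm)
  have h6 : n * n * m ≤ n ^ 5 * m ^ 2 := by
    calc n * n * m = n ^ 2 * m ^ 1 := by ring
      _ ≤ n ^ 5 * m ^ 2 := Nat.mul_le_mul (Nat.pow_le_pow_right hn (by norm_num))
        (Nat.pow_le_pow_right hm (by norm_num))
  have h7 : n ≤ n * n * m := by
    calc n = n * 1 * 1 := by ring
      _ ≤ n * n * m := by gcongr <;> omega
  have h8 : m ≤ n * n * m := by
    calc m = 1 * 1 * m := by ring
      _ ≤ n * n * m := by gcongr <;> omega
  have h9 : (n + 2 * m) * (n * 14 + 23) ≤ 111 * (n * n * m) := by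
    have e1 : n + 2 * m ≤ 3 * (n * m) := by nlinarith
    calc (n + 2 * m) * (n * 14 + 23) ≤ 3 * (n * m) * (37 * n) := by
          refine Nat.mul_le_mul e1 ?_
          omega
      _ = _ := by ring
  have h10 : 4 * (n * n) * (18 * (m * m * m) * 100 + 26 * n) =
      7200 * (n * n * (m * m * m)) + 104 * (n * n * n) := by ring
  omega

theorem runs_solve {n m : ℕ} (f : Fin (m + 1) → ℝ) (hm : 0 < m) (hmn : m ≤ n * n) {s : State}
    (h0 : s.reg 0 = n) (h1 : s.reg 1 = m) (h2 : s.reg 2 = 1) (h11 : s.reg 11 = 0)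
    (hmem : ∀ a, s.mem a = 0) (hr : s.rreg 4 = 0) (hf : s.rmem = table f) :
    Runs solve s (10000 * (n ^ 5 * m ^ 2)) (Solves n m f) := by
  set K := (m * 3 + (2 * n + m) * 12 + (n + 2 * m) * (n * 14 + 23) + 20) with hK
  set L := (n + 1) * (n + 1) * ((m + 1) * ((2 * m + 1) * (2 * m + 1)) * 100 + 6 * n + 20) with hL
  refine Runs.mono (K := L + K + 9 * m + 3 * n + 50) ?_ (solve_cost hm hmn) fun _ h => h
  refine Runs.block_seq (K := L + K + 9 * m + 3 * n + 42) ?_ (by simp; omega)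
  rintro s₁ hs₁
  have e2 : s₁.reg 2 = 1 := by simp [hs₁, effect, Instr.apply, h2]
  have e3 : s₁.reg 3 = 2 * m + 1 := by
    simp [hs₁, effect, Instr.apply, h1, h2]
    ring
  refine (Runs.mul (by norm_num) (by norm_num) (by norm_num) (by norm_num) (by norm_num)
    (by norm_num) (by norm_num) e2).seq (K₂ := L + K + 3 * m + 3 * n + 36) ?_ (by rw [e3]; omega)
  intro s₂ hs₂
  have f2 : s₂.reg 2 = 1 := by simp [hs₂, State.setReg, e2]
  have f5 : s₂.reg 5 = m + 1 := by simp [hs₂, hs₁, effect, Instr.apply, State.setReg, h1, h2]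
  refine (Runs.mul (by norm_num) (by norm_num) (by norm_num) (by norm_num) (by norm_num)
    (by norm_num) (by norm_num) f2).seq (K₂ := L + K + 3 * n + 30) ?_ (by rw [f5]; omega)
  intro s₃ hs₃
  have g2 : s₃.reg 2 = 1 := by simp [hs₃, State.setReg, f2]
  have g4 : s₃.reg 4 = n + 1 := by
    simp [hs₃, hs₂, hs₁, effect, Instr.apply, State.setReg, h0, h2]
  refine (Runs.mul (by norm_num) (by norm_num) (by norm_num) (by norm_num) (by norm_num)
    (by norm_num) (by norm_num) g2).seq (K₂ := L + K + 24) ?_ (by rw [g4]; omega)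
  intro s₄ hs₄
  refine Runs.block_seq (K := L + K + 20) ?_ (by simp; omega)
  intro s₅ hs₅
  have hfill : Filled n m (table f) 0 s₅ := by
    have r6 : s₂.reg 6 = (2 * m + 1) * (2 * m + 1) := by simp [hs₂, State.setReg, e3]
    have r7 : s₃.reg 7 = (2 * m + 1) * (2 * m + 1) * (m + 1) := by
      simp [hs₃, State.setReg, r6, f5]
    have r8 : s₄.reg 8 = (2 * m + 1) * (2 * m + 1) * (m + 1) * (n + 1) := by
      simp [hs₄, State.setReg, r7, g4]
    have k6 : s₅.reg 6 = s₂.reg 6 := by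
      simp [hs₅, hs₄, hs₃, effect, Instr.apply, State.setReg]
    have k7 : s₅.reg 7 = s₃.reg 7 := by simp [hs₅, hs₄, effect, Instr.apply, State.setReg]
    have k8 : s₅.reg 8 = s₄.reg 8 := by simp [hs₅, effect, Instr.apply]
    have kold : ∀ x, x ≠ 6 → x ≠ 7 → x ≠ 8 → x ≠ 16 → x ≠ 31 → s₅.reg x = s₁.reg x := by
      intro x x6 x7 x8 x16 x31
      simp [hs₅, hs₄, hs₃, hs₂, effect, Instr.apply, State.setReg, x6, x7, x8, x16, x31]
    have r9 : s₅.reg 9 = 2 * m + 2 * n := by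
      simp [kold, hs₁, effect, Instr.apply, h0, h1]
      ring
    refine ⟨⟨?_, ?_, ?_, ?_, ?_, ?_, by rw [k6, r6], by rw [k7, r7], by rw [k8, r8], r9,
      ?_, ?_, ?_, ?_⟩, ?_, ?_, ?_, ?_, ?_⟩
    case refine_11 => simp [hs₅, hs₄, hs₃, hs₂, hs₁, effect, Instr.apply, State.setReg, hr]
    case refine_12 =>
      intro a _
      simp [hs₅, hs₄, hs₃, hs₂, hs₁, effect, Instr.apply, State.setReg, hmem]
    case refine_13 =>
      intro a _
      simp [hs₅, hs₄, hs₃, hs₂, hs₁, effect, Instr.apply, State.setReg, hf]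
    case refine_14 =>
      have : s₅.reg 16 = s₅.reg 9 := by simp [hs₅, effect, Instr.apply]
      rw [this, r9, add_zero]
    case refine_15 =>
      intro kb lb r A T _ _ _ _ _ hlt
      exact absurd hlt (Nat.not_lt_zero _)
    all_goals
      simp [kold, hs₁, effect, Instr.apply, h0, h1, h2, h11]
      try ring
  refine (runs_fill hm hfill).seq (K₂ := K + 20) ?_ (by omega)
  intro s₆ hs₆
  refine Runs.block_seq (K := K + 16) ?_ (by simp; omega)
  intro s₇ hs₇
  -- The initial state `k = l = 0`, `r = m`, `A = T = 0` opens the last block of `(2 * m + 1)²`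
  -- cells, so its address is found by stepping back from the end of the table.
  have hidx : idx n m n n m 0 0 + (2 * m + 1) * (2 * m + 1) = idx n m (n + 1) 0 0 0 0 := by
    unfold idx
    ring
  have q16 : s₇.reg 16 = 2 * m + 2 * n + idx n m n n m 0 0 := by
    have : s₇.reg 16 = s₆.reg 16 - s₆.reg 6 := by simp [hs₇, effect, Instr.apply]
    rw [this, hs₆.addr, hs₆.consts.r6]
    omega
  have qmem : s₇.mem = s₆.mem := by simp [hs₇, effect, Instr.apply]
  have qrmem : s₇.rmem = s₆.rmem := by simp [hs₇, effect, Instr.apply]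
  have q29 : s₇.reg 29 = s₇.mem (s₇.reg 16) := by simp [hs₇, effect, Instr.apply]
  have qout : s₇.rreg 0 = s₇.rmem (s₇.reg 16) := by simp [hs₇, effect, Instr.apply]
  have q11 : s₇.reg 11 = 0 := by simp [hs₇, effect, Instr.apply, hs₆.consts.r11]
  have hfin : Filled n m (table f) (idx n m (n + 1) 0 0 0 0)
      (s₇.setReg 16 (s₆.reg 16)) := by
    refine hs₆.congr (fun x hx => ?_) ?_ qmem qrmem
    · by_cases hx16 : x = 16
      · simp [State.setReg, hx16]
      · simp [State.setReg, hx16, hs₇, effect, Instr.apply, show x ≠ 29 by omega]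
    · simp [State.setReg, hs₇, effect, Instr.apply]
  refine (Runs.ite (K := K) (fun hc => ?_) (fun hc => ?_)).mono (by omega) fun _ h => h
  · have hc' : 0 < s₇.reg 29 := by
      have : s₇.reg 11 < s₇.reg 29 := hc
      omega
    exact runs_output f hfin q16 q29 hc' qout
  · have hc' : s₇.reg 29 = 0 := by
      have : ¬ s₇.reg 11 < s₇.reg 29 := hc
      omega
    refine Runs.block (Or.inl ⟨by simp [effect, Instr.apply], ⟨fun G => ?_⟩⟩) (by simp; omega)
    have hbest := hs₆.below n n m 0 0 le_rfl le_rfl le_rfl (Nat.zero_le _) (Nat.zero_le _)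
      (idx_lt le_rfl le_rfl le_rfl (Nat.zero_le _) (Nat.zero_le _))
    rw [Nat.sub_self, ← qmem, ← q16, ← q29, hc'] at hbest
    obtain ⟨j, hj⟩ := path_iff_firstMove.1 (path_of_graph f G)
    obtain ⟨-, hnone⟩ | ⟨hlt, -⟩ := hbest
    · exact hnone _ _ hj
    · omega

theorem runs_optimize (n m : ℕ) (f : Fin (m + 1) → ℝ) :
    Runs optimize (input n m f) (10000 * (n ^ 5 * m ^ 2 + n + 1)) (Solves n m f) := by
  refine Runs.mono (K := 10000 * (n ^ 5 * m ^ 2) + 3 * n + 12) ?_ (by omega) fun _ h => h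
  refine Runs.block_seq (K := 10000 * (n ^ 5 * m ^ 2) + 3 * n + 9) ?_ (by simp; omega)
  intro s₁ hs₁
  have e0 : s₁.reg 0 = n := by simp [hs₁, effect, Instr.apply, input]
  have e1 : s₁.reg 1 = m := by simp [hs₁, effect, Instr.apply, input]
  have e2 : s₁.reg 2 = 1 := by simp [hs₁, effect, Instr.apply]
  have e11 : s₁.reg 11 = 0 := by simp [hs₁, effect, Instr.apply]
  have emem : ∀ a, s₁.mem a = 0 := by simp [hs₁, effect, Instr.apply, input]
  have erreg : ∀ a, s₁.rreg a = 0 := by simp [hs₁, effect, Instr.apply, input]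
  have ermem : s₁.rmem = table f := by
    simp only [hs₁, effect, Instr.apply, input]
    rfl
  refine Runs.ite (K := 10000 * (n ^ 5 * m ^ 2) + 3 * n + 8) (fun hc => ?_) (fun hc => ?_)
  · have hm : 0 < m := by simpa [Test.Holds, e11, e1] using hc
    refine (Runs.mul (by norm_num) (by norm_num) (by norm_num) (by norm_num) (by norm_num)
      (by norm_num) (by norm_num) e2).seq (K₂ := 10000 * (n ^ 5 * m ^ 2) + 5) ?_
      (by rw [e0]; omega)
    intro s₂ hs₂
    have f3 : s₂.reg 3 = n * n := by simp [hs₂, State.setReg, e0]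
    have f1 : s₂.reg 1 = m := by simp [hs₂, State.setReg, e1]
    refine Runs.ite (K := 10000 * (n ^ 5 * m ^ 2) + 4) (fun hd => ?_) (fun hd => ?_)
    · have hd' : n * n < m := by simpa [Test.Holds, f3, f1] using hd
      exact Runs.block (Or.inl ⟨by simp [effect, Instr.apply], isEmpty_of_lt hd'⟩) (by simp)
    · have hd' : m ≤ n * n := by simpa [Test.Holds, f3, f1] using hd
      refine (runs_solve f hm hd' ?_ f1 ?_ ?_ ?_ ?_ ?_).mono (by omega) fun _ h => h
      · simp [hs₂, State.setReg, e0]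
      · simp [hs₂, State.setReg, e2]
      · simp [hs₂, State.setReg, e11]
      · simp [hs₂, State.setReg, emem]
      · simp [hs₂, State.setReg, erreg]
      · simp [hs₂, State.setReg, ermem]
  · have hm : m = 0 := by simpa [Test.Holds, e11, e1] using hc
    subst hm
    exact (runs_edgeless f e0 e2 e11 (erreg 0) ermem).mono (by omega) fun _ h => h

end DegSeq

/-- A single program solves the problem of optimizing `∑ i, f (d i)` over the degree sequences
of graphs with `m` edges on `n` vertices in time `O(n ^ 5 * m ^ 2)`, for all `n`, `m` and `f`. The
summand `n + 1` is absorbed by `n ^ 5 * m ^ 2` as soon as `n, m ≥ 1`; it only covers the degenerate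
cases in which the product is `0`. -/
theorem mainTheorem5 :
    ∃ (P : RAM.Prog) (C : ℕ), ∀ (n m : ℕ) (f : Fin (m + 1) → ℝ),
      ∃ (t : ℕ) (s : RAM.State),
        RAM.Exec P (DegSeq.input n m f) t s ∧
        t ≤ C * (n ^ 5 * m ^ 2 + n + 1) ∧
        DegSeq.Solves n m f s := by
  refine ⟨DegSeq.optimize, 10000, fun n m f => ?_⟩
  exact DegSeq.runs_optimize n m f
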